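/- Let $d\ge 2$, let $\Omega\subseteq\mathbb{R}^d$ be a non-empty bounded domain (open and connected) and let $D$ be a closed subset of $\partial\Omega$. Let $m_{d-1}$ denote the $(d-1)$-dimensional Hausdorff measure. Assume: (1) for every $x\in\overline{\partial\Omega\setminus D}$ there are an open neighbourhood $U_x$ of $x$ and a bi-Lipschitz map $\Phi_x$ from $U_x$ onto $(-1,1)^d$ with $\Phi_x(x)=0$, $\Phi_x(\Omega\cap U_x)=(-1,1)^{d-1}\times(-1,0)$ and $\Phi_x(\partial\Omega\cap U_x)=(-1,1)^{d-1}\times\{0\}$; (2) $D$ is either empty or a $(d-1)$-set, i.e. there are $c,C>0$ with $c\,r^{d-1}\le m_{d-1}(D\cap B(x,r))\le C\,r^{d-1}$ for all $x\in D$ and $0<r\le1$; (3) there is $\kappa\in(0,1)$ such that for each $x\in\overline\Omega$ and each $r\in(0,\operatorname{diam}\Omega)$ there is $y\in\overline{B(x,r)}$ with $\overline{B(y,\kappa r)}\subseteq\Omega$. All functions are complex valued. Let $C_D^\infty(\Omega)$ be the set of restrictions $u|_\Omega$ of functions $u\in C_c^\infty(\mathbb{R}^d)$ with $\operatorname{dist}(\operatorname{supp}u,D)>0$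 (where $\operatorname{dist}(\cdot,\emptyset)=\infty$), and let the form domain $\mathcal V$ be its closure under the norm $\|u\|_{\mathcal V}=\big(\int_\Omega|u|^2+|\nabla u|^2\big)^{1/2}$, taken in the space of functions $u\in L^2(\Omega)$ with weak gradient in $L^2(\Omega;\mathbb{C}^d)$. Let $H^1_D(\mathbb{R}^d)$ be the set of all $f\in H^1(\mathbb{R}^d)$ with $$\lim_{r\to0}\frac1{|B(x_0,r)|}\int_{B(x_0,r)}f(x)\,dx=0\qquad\text{for }m_{d-1}\text{-almost all }x_0\in D$$ (so $H^1_\emptyset(\mathbb{R}^d)=H^1(\mathbb{R}^d)$), and let $H^1_D(\Omega)=\{f|_\Omega:f\in H^1_D(\mathbb{R}^d)\}$ with the quotient norm $\|u\|_{H^1_D(\Omega)}=\inf\{\|f\|_{H^1(\mathbb{R}^d)}:f\in H^1_D(\mathbb{R}^d),\ f|_\Omega=u\}$, where $\|f\|_{H^1(\mathbb{R}^d)}=\big(\int_{\mathbb{R}^d}|f|^2+|\nabla f|^2\big)^{1/2}$. Then $\mathcal V=H^1_D(\Omega)$ as sets, and the two norms are equivalent: there are constants $c,C>0$ such that $c\,\|u\|_{\mathcal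 V}\le\|u\|_{H^1_D(\Omega)}\le C\,\|u\|_{\mathcal V}$ for all $u\in\mathcal V$. -/

import Mathlib

open MeasureTheory Filter Topology Set
open scoped ContDiff

noncomputable section

namespace MixedSobolev

/-- The Euclidean space `ℝ^d`. -/
abbrev Rd (d : ℕ) : Type := EuclideanSpace ℝ (Fin d)

/-- `L²(Ω)`, complex valued. -/
abbrev L2 {d : ℕ} (Ω : Set (Rd d)) : Type := Lp ℂ 2 (volume.restrict Ω)

/-- `L²(Ω; ℂ^d)`. -/
abbrev L2Vec {d : ℕ} (Ω : Set (Rd d)) : Type :=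
  Lp (EuclideanSpace ℂ (Fin d)) 2 (volume.restrict Ω)

/-! ### Geometry -/

/-- `F` is an `l`-set: a non-empty Borel set such that the `l`-dimensional Hausdorff measure of
`F ∩ B(x, r)` is comparable to `r ^ l`, uniformly in `x ∈ F` and `0 < r ≤ 1`. -/
def IsLSet {d : ℕ} (l : ℝ) (F : Set (Rd d)) : Prop :=
  F.Nonempty ∧ MeasurableSet F ∧
    ∃ c C : ℝ, 0 < c ∧ 0 < C ∧ ∀ x ∈ F, ∀ r : ℝ, 0 < r → r ≤ 1 →
      ENNReal.ofReal (c * r ^ l) ≤ Measure.hausdorffMeasure l (F ∩ Metric.ball x r) ∧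
      Measure.hausdorffMeasure l (F ∩ Metric.ball x r) ≤ ENNReal.ofReal (C * r ^ l)

/-- The open cube `(-1,1)^d`. -/
def cube (d : ℕ) : Set (Rd d) := {z | ∀ i, z i ∈ Ioo (-1 : ℝ) 1}

/-- The lower half cube `(-1,1)^(d-1) × (-1,0)`. -/
def lowerCube (d : ℕ) : Set (Rd d) := {z ∈ cube d | ∀ i : Fin d, (i : ℕ) + 1 = d → z i < 0}

/-- The mid plate `(-1,1)^(d-1) × {0}`. -/
def midPlate (d : ℕ) : Set (Rd d) := {z ∈ cube d | ∀ i : Fin d, (i : ℕ) + 1 = d → z i = 0}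

/-- `Φ` is bi-Lipschitz on `U`. -/
def IsBiLipschitzOn {d : ℕ} (Φ : Rd d → Rd d) (U : Set (Rd d)) : Prop :=
  ∃ c C : ℝ, 0 < c ∧ 0 < C ∧ ∀ x ∈ U, ∀ y ∈ U,
    c * dist x y ≤ dist (Φ x) (Φ y) ∧ dist (Φ x) (Φ y) ≤ C * dist x y

/-- The standing geometric assumptions on a domain `Ω` and the Dirichlet part `D` of its
boundary. -/
structure GeometricAssumption {d : ℕ} (Ω D : Set (Rd d)) : Prop where
  isOpen : IsOpen Ω
  /-- `Ω` is connected, and non-empty. -/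
  isConnected : IsConnected Ω
  isBounded : Bornology.IsBounded Ω
  isClosed_D : IsClosed D
  D_subset : D ⊆ frontier Ω
  /-- Bi-Lipschitz charts around the closure of the complement of `D` in the boundary. -/
  charts : ∀ x ∈ closure (frontier Ω \ D), ∃ (U : Set (Rd d)) (Φ : Rd d → Rd d),
    IsOpen U ∧ x ∈ U ∧ IsBiLipschitzOn Φ U ∧ Φ '' U = cube d ∧ Φ x = 0 ∧
      Φ '' (Ω ∩ U) = lowerCube d ∧ Φ '' (frontier Ω ∩ U) = midPlate d
  /-- `D` is empty or a `(d-1)`-set. -/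
  dirichlet : D = ∅ ∨ IsLSet ((d : ℝ) - 1) D
  /-- The plumpness (interior corkscrew) condition. -/
  plump : ∃ κ : ℝ, 0 < κ ∧ κ < 1 ∧ ∀ x ∈ closure Ω, ∀ r : ℝ, 0 < r → r < Metric.diam Ω →
    ∃ y ∈ closure (Metric.ball x r), closure (Metric.ball y (κ * r)) ⊆ Ω

/-! ### Weak gradients and first order Sobolev norms -/

/-- `g` is the weak (distributional) gradient of `u` on `Ω`. (Testing with real valued test
functions is the same as testing with complex valued ones.) -/
def IsWeakGrad {d : ℕ} (Ω : Set (Rd d)) (u : L2 Ω) (g : L2Vec Ω) : Prop :=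
  ∀ φ : Rd d → ℝ, ContDiff ℝ ∞ φ → HasCompactSupport φ → tsupport φ ⊆ Ω → ∀ i : Fin d,
    ∫ x in Ω, fderiv ℝ φ x (EuclideanSpace.single i 1) • u x = - ∫ x in Ω, φ x • g x i

/-- The `L²(Ω)` functions whose weak gradient is square integrable on `Ω`.
For `Ω = univ` this is the Sobolev space `H¹(ℝ^d)`. -/
def weakH1 {d : ℕ} (Ω : Set (Rd d)) : Set (L2 Ω) := {u | ∃ g, IsWeakGrad Ω u g}

open Classical in
/-- The weak gradient `∇u` of `u ∈ weakH1 Ω` (and `0` for other `u`). -/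
def weakGrad {d : ℕ} (Ω : Set (Rd d)) (u : L2 Ω) : L2Vec Ω :=
  if h : ∃ g, IsWeakGrad Ω u g then h.choose else 0

/-- The Hilbertian norm `(∫_Ω |u|² + |∇u|²)^(1/2)` of `u ∈ weakH1 Ω`. -/
def h1Norm {d : ℕ} (Ω : Set (Rd d)) (u : L2 Ω) : ℝ :=
  Real.sqrt (‖u‖ ^ 2 + ‖weakGrad Ω u‖ ^ 2)

/-- Weak gradients on open sets are unique. -/
theorem IsWeakGrad.unique {d : ℕ} {Ω : Set (Rd d)} (hΩ : IsOpen Ω) {u : L2 Ω} {g₁ g₂ : L2Vec Ω}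
    (h₁ : IsWeakGrad Ω u g₁) (h₂ : IsWeakGrad Ω u g₂) : g₁ = g₂ := by
  have hloc : ∀ (g : L2Vec Ω) (i : Fin d),
      LocallyIntegrable (fun x => g x i) (volume.restrict Ω) := by
    intro g i
    have hm : MemLp (fun x => g x i) 2 (volume.restrict Ω) :=
      (EuclideanSpace.proj i : EuclideanSpace ℂ (Fin d) →L[ℂ] ℂ).comp_memLp' (Lp.memLp g)
    exact hm.locallyIntegrable (by norm_num)
  have key : ∀ i : Fin d, ∀ᵐ x ∂volume, x ∈ Ω → g₁ x i - g₂ x i = 0 := by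
    intro i
    refine hΩ.ae_eq_zero_of_integral_contDiff_smul_eq_zero
      (f := fun x => g₁ x i - g₂ x i) 
      (locallyIntegrableOn_of_locallyIntegrable_restrict ((hloc g₁ i).sub (hloc g₂ i))) ?_
    intro φ hφ hc hs
    have hint : ∀ g : L2Vec Ω, Integrable (fun x => φ x • g x i) volume := fun g => by
      refine (integrableOn_iff_integrable_of_support_subset ?_).1
        ((hloc g i).integrable_smul_left_of_hasCompactSupport hφ.continuous hc)
      intro x hx
      exact hs (subset_tsupport φ (fun h => hx (by simp [h])))
    have hset : ∀ g : L2Vec Ω, ∫ x in Ω, φ x • g x i = ∫ x, φ x • g x i := fun g => by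
      apply setIntegral_eq_integral_of_forall_compl_eq_zero
      intro x hx
      have : φ x = 0 := image_eq_zero_of_notMem_tsupport (fun h => hx (hs h))
      simp [this]
    have e := (h₁ φ hφ hc hs i).symm.trans (h₂ φ hφ hc hs i)
    rw [neg_inj, hset, hset] at e
    simp only [smul_sub]
    rw [integral_sub (hint g₁) (hint g₂), e, sub_self]
  apply Lp.ext
  have hall : ∀ᵐ x ∂volume, ∀ i, x ∈ Ω → g₁ x i - g₂ x i = 0 := ae_all_iff.2 key
  refine (ae_restrict_iff' hΩ.measurableSet).2 ?_
  filter_upwards [hall] with x hx hxΩ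
  ext i
  exact sub_eq_zero.1 (hx i hxΩ)

/-! ### The form domain -/

/-- `C_D^∞(Ω)`: restrictions to `Ω` of smooth, compactly supported functions on `ℝ^d` whose
support has positive distance to `D` (the distance to the empty set being infinite). -/
def smoothD {d : ℕ} (Ω D : Set (Rd d)) : Set (L2 Ω) :=
  {v | ∃ φ : Rd d → ℂ, ContDiff ℝ ∞ φ ∧ HasCompactSupport φ ∧
    (∃ δ : ℝ, 0 < δ ∧ ∀ x ∈ tsupport φ, ∀ y ∈ D, δ ≤ dist x y) ∧
    v =ᵐ[volume.restrict Ω] φ}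

/-- The form domain `𝒱`: the closure of `C_D^∞(Ω)` under the norm `(∫_Ω |u|² + |∇u|²)^(1/2)`. -/
def formDomain {d : ℕ} (Ω D : Set (Rd d)) : Set (L2 Ω) :=
  {u ∈ weakH1 Ω | ∀ ε : ℝ, 0 < ε → ∃ v ∈ smoothD Ω D, h1Norm Ω (u - v) < ε}

/-! ### The Sobolev spaces with vanishing trace on `D` -/

/-- The function `f` has trace `c` at the point `x₀`: its averages over the balls `B(x₀, r)`
converge to `c` as `r → 0`. -/
def HasTraceAt {d : ℕ} (f : Rd d → ℂ) (x₀ : Rd d) (c : ℂ) : Prop :=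
  Tendsto (fun r : ℝ => ⨍ x in Metric.ball x₀ r, f x) (𝓝[>] 0) (𝓝 c)

/-- `H¹_D(ℝ^d)`: the functions in `H¹(ℝ^d)` whose trace vanishes almost everywhere on `D` with
respect to the `(d-1)`-dimensional Hausdorff measure. -/
def H1DWhole {d : ℕ} (D : Set (Rd d)) : Set (L2 (univ : Set (Rd d))) :=
  {f ∈ weakH1 univ | ∀ᵐ x₀ ∂((Measure.hausdorffMeasure ((d : ℝ) - 1)).restrict D),
    HasTraceAt f x₀ 0}

/-- The restriction map `L²(ℝ^d) → L²(Ω)`. -/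
def restr {d : ℕ} (Ω : Set (Rd d)) (f : L2 (univ : Set (Rd d))) : L2 Ω :=
  MemLp.toLp f ((Lp.memLp f).mono_measure (Measure.restrict_mono (subset_univ Ω) le_rfl))

/-- `H¹_D(Ω)`: the restrictions to `Ω` of the functions in `H¹_D(ℝ^d)`. -/
def H1D {d : ℕ} (Ω D : Set (Rd d)) : Set (L2 Ω) := restr Ω '' H1DWhole D

/-- The quotient norm of `H¹_D(Ω)`. -/
def h1DNorm {d : ℕ} (Ω D : Set (Rd d)) (u : L2 Ω) : ℝ :=
  sInf (h1Norm univ '' {f ∈ H1DWhole D | restr Ω f = u})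

end MixedSobolev

end

/-!
Two ways of imposing a Dirichlet condition on `D` are compared: closing up test functions that
vanish near `D`, and prescribing a trace that vanishes `m_{d-1}`-almost everywhere on `D`. Each
inclusion between the two spaces rests on its own estimate.

*From trace zero to test functions.* Let `f ∈ H¹_D(ℝ^d)` and cut `f` off at distance `R` from `D`.
The gradient of the cutoff contributes an error of size `R⁻¹ ‖f‖` over the `R`-neighbourhood of
`D`, so it is enough to bound `∫ |f|²` over that neighbourhood by `R² ∫ |∇f|²` over one of
comparable size, since the latter integral tends to zero (`D` is a null set). For a point `z ∈ D`
of trace zero, the average of `f` over `B(z, R)` is the telescoping sum of the differences of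
averages over concentric balls, which the energy of the gradient controls
(`HasWeakGradient.average_sub_sq_le`), and the Poincaré inequality passes from the average to the
`L²` norm. Integrating in `z` over `D` and using both bounds on the surface measure of balls gives
this Hardy type inequality (`UpperRegular.exists_lintegral_thickening_le`). Mollification then
makes the cut off function smooth (`HasWeakGradient.exists_testFunction_approx`).

*From test functions to trace zero.* A test function `φ` vanishing near `D` is extended from `Ω` to
`ℝ^d` with control of the `H¹` norm. By a partition of unity it splits into a piece that vanishes
near the closure of `∂Ω \ D`, which extends by zero, and pieces supported in boundary charts, which
extend by composition with the bi-Lipschitz fold of the chart onto its part in the closure of `Ω`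
(`GeometricAssumption.exists_partition`, `IsBoundaryFold.exists_isExtension`). The fold fixes the
boundary, so that the extension vanishes near `D` again. Only Lipschitz functions arise, and these
lie in `H¹` by Rademacher's theorem. The space `H¹_D(ℝ^d)` is complete: the averages of an `H¹`
function over small balls have a maximal function in `L²(D)` (`UpperRegular.exists_maximal_bound`),
hence vanishing traces survive limits (`UpperRegular.isClosed_traceGraph`). A bounded map from a
complete space that covers a subgroup with bounds covers its closure with bounds, which yields
`GeometricAssumption.exists_extension`: the inclusion and the bound on the quotient norm together.
The reverse bound on the norms is immediate, as restriction to `Ω` does not increase them.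
-/

namespace MixedSobolev

open scoped ENNReal NNReal

/-! ### Classical gradients and elementary integral inequalities -/

/-- The classical gradient of a complex valued function, as a vector of partial derivatives. It is
`0` wherever `f` is not differentiable. -/
noncomputable def cgrad {d : ℕ} (f : Rd d → ℂ) (x : Rd d) : EuclideanSpace ℂ (Fin d) :=
  WithLp.toLp 2 fun i => fderiv ℝ f x (EuclideanSpace.single i 1)

@[simp] lemma cgrad_apply {d : ℕ} (f : Rd d → ℂ) (x : Rd d) (i : Fin d) :
    cgrad f x i = fderiv ℝ f x (EuclideanSpace.single i 1) := rfl

lemma norm_fderiv_apply_le {d : ℕ} (f : Rd d → ℂ) (x v : Rd d) :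
    ‖fderiv ℝ f x v‖ ≤ ‖cgrad f x‖ * ‖v‖ := by
  have hv : v = ∑ i, v i • EuclideanSpace.single i (1 : ℝ) := by
    ext j
    simp [Finset.sum_apply, Pi.single_apply]
  have h1 : fderiv ℝ f x v = ∑ i, v i • cgrad f x i := by
    conv_lhs => rw [hv]
    simp
  rw [h1]
  calc ‖∑ i, v i • cgrad f x i‖ ≤ ∑ i, ‖cgrad f x i‖ * ‖v i‖ := by
        refine (norm_sum_le _ _).trans (le_of_eq ?_)
        refine Finset.sum_congr rfl fun i _ => ?_
        rw [norm_smul, mul_comm]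
    _ ≤ √(∑ i, ‖cgrad f x i‖ ^ 2) * √(∑ i, ‖v i‖ ^ 2) := Real.sum_mul_le_sqrt_mul_sqrt _ _ _
    _ = ‖cgrad f x‖ * ‖v‖ := by rw [EuclideanSpace.norm_eq, EuclideanSpace.norm_eq]

lemma norm_cgrad_le {d : ℕ} (f : Rd d → ℂ) (x : Rd d) :
    ‖cgrad f x‖ ≤ √d * ‖fderiv ℝ f x‖ := by
  rw [EuclideanSpace.norm_eq]
  refine Real.sqrt_le_iff.2 ⟨by positivity, ?_⟩
  rw [mul_pow, Real.sq_sqrt (Nat.cast_nonneg d)]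
  calc ∑ i, ‖cgrad f x i‖ ^ 2 ≤ ∑ _i : Fin d, ‖fderiv ℝ f x‖ ^ 2 := by
        refine Finset.sum_le_sum fun i _ => ?_
        gcongr
        refine ((fderiv ℝ f x).le_opNorm _).trans ?_
        simp
    _ = _ := by simp

lemma enorm_fderiv_apply_le {d : ℕ} (f : Rd d → ℂ) (x v : Rd d) :
    ‖fderiv ℝ f x v‖ₑ ≤ ‖cgrad f x‖ₑ * ‖v‖ₑ := by
  rw [← ofReal_norm, ← ofReal_norm, ← ofReal_norm, ← ENNReal.ofReal_mul (norm_nonneg _)]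
  exact ENNReal.ofReal_le_ofReal (norm_fderiv_apply_le f x v)

lemma norm_fderiv_le_cgrad {d : ℕ} (f : Rd d → ℂ) (x : Rd d) : ‖fderiv ℝ f x‖ ≤ ‖cgrad f x‖ :=
  ContinuousLinearMap.opNorm_le_bound _ (norm_nonneg _) (norm_fderiv_apply_le f x)

lemma cgrad_smul {d : ℕ} {η : Rd d → ℝ} {f : Rd d → ℂ} {x : Rd d} (hη : DifferentiableAt ℝ η x)
    (hf : DifferentiableAt ℝ f x) : cgrad (fun y => η y • f y) x =
      η x • cgrad f x +
        WithLp.toLp 2 fun i => fderiv ℝ η x (EuclideanSpace.single i 1) • f x := by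
  ext i
  simp only [cgrad_apply, PiLp.add_apply, PiLp.smul_apply]
  rw [fderiv_fun_smul hη hf]
  simp

/-- The commutator of the gradient with multiplication by `η`. -/
lemma norm_cgrad_smul_le {d : ℕ} {η : Rd d → ℝ} {f : Rd d → ℂ} {x : Rd d}
    (hη : DifferentiableAt ℝ η x) (hf : DifferentiableAt ℝ f x) :
    ‖cgrad (fun y => η y • f y) x - η x • cgrad f x‖ ≤ √d * ‖fderiv ℝ η x‖ * ‖f x‖ := by
  rw [cgrad_smul hη hf, add_sub_cancel_left, EuclideanSpace.norm_eq]
  refine Real.sqrt_le_iff.2 ⟨by positivity, ?_⟩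
  rw [mul_pow, mul_pow, Real.sq_sqrt (Nat.cast_nonneg d)]
  calc ∑ i : Fin d, ‖fderiv ℝ η x (EuclideanSpace.single i 1) • f x‖ ^ 2
      ≤ ∑ _i : Fin d, ‖fderiv ℝ η x‖ ^ 2 * ‖f x‖ ^ 2 := by
        refine Finset.sum_le_sum fun i _ => ?_
        rw [norm_smul, mul_pow]
        gcongr
        refine ((fderiv ℝ η x).le_opNorm _).trans ?_
        simp
    _ = _ := by simp [mul_assoc]

lemma continuous_cgrad {d : ℕ} {f : Rd d → ℂ} (hf : ContDiff ℝ 1 f) : Continuous (cgrad f) := by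
  unfold cgrad
  have := hf.continuous_fderiv (by norm_num)
  fun_prop

lemma measurable_cgrad {d : ℕ} (f : Rd d → ℂ) : Measurable (cgrad f) := by
  unfold cgrad
  refine (MeasurableEquiv.toLp 2 (Fin d → ℂ)).measurable.comp ?_
  exact measurable_pi_lambda _ fun i => measurable_fderiv_apply_const ℝ f _

/-- The Cauchy–Schwarz inequality against the constant function `1`. -/
lemma sq_lintegral_le {α : Type*} [MeasurableSpace α] (ν : Measure α) {h : α → ℝ≥0∞}
    (hh : AEMeasurable h ν) : (∫⁻ x, h x ∂ν) ^ 2 ≤ ν univ * ∫⁻ x, h x ^ 2 ∂ν := by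
  have := ENNReal.lintegral_mul_le_Lp_mul_Lq ν Real.HolderConjugate.two_two
    (f := fun _ => 1) (g := h) aemeasurable_const hh
  simp only [Pi.mul_apply, one_mul, ENNReal.one_rpow, lintegral_const] at this
  calc (∫⁻ x, h x ∂ν) ^ 2
      ≤ (ν univ ^ (1 / 2 : ℝ) * (∫⁻ x, h x ^ (2 : ℝ) ∂ν) ^ (1 / 2 : ℝ)) ^ 2 := by gcongr
    _ = _ := by
      rw [mul_pow, ← ENNReal.rpow_natCast, ← ENNReal.rpow_mul, ← ENNReal.rpow_natCast,
        ← ENNReal.rpow_mul]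
      norm_num

/-- Jensen's inequality for the square, without normalization of the measure. -/
lemma sq_enorm_integral_le {α F : Type*} [MeasurableSpace α] [NormedAddCommGroup F]
    [NormedSpace ℝ F] (ν : Measure α) {h : α → F} (hh : AEStronglyMeasurable h ν) :
    ‖∫ x, h x ∂ν‖ₑ ^ 2 ≤ ν univ * ∫⁻ x, ‖h x‖ₑ ^ 2 ∂ν := by
  refine le_trans ?_ (sq_lintegral_le ν hh.enorm)
  gcongr
  exact enorm_integral_le_lintegral_enorm _

lemma add_sq_le (a b : ℝ≥0∞) : (a + b) ^ 2 ≤ 2 * (a ^ 2 + b ^ 2) := by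
  have := ENNReal.rpow_add_le_mul_rpow_add_rpow a b (p := 2) (by norm_num)
  have h2 : (2 : ℝ≥0∞) ^ ((2 : ℝ) - 1) = 2 := by norm_num
  rw [h2] at this
  exact_mod_cast this

lemma add_sq_le_three (a b c : ℝ≥0∞) : (a + b + c) ^ 2 ≤ 4 * (a ^ 2 + b ^ 2 + c ^ 2) := by
  calc (a + b + c) ^ 2 ≤ 2 * ((a + b) ^ 2 + c ^ 2) := add_sq_le _ _
    _ ≤ 2 * (2 * (a ^ 2 + b ^ 2) + 2 * c ^ 2) := by
        gcongr
        · exact add_sq_le _ _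
        · exact le_mul_of_one_le_left zero_le (by norm_num)
    _ = _ := by ring

lemma enorm_add_sq_le {F : Type*} [NormedAddCommGroup F] (a b : F) :
    ‖a + b‖ₑ ^ 2 ≤ 2 * (‖a‖ₑ ^ 2 + ‖b‖ₑ ^ 2) :=
  (pow_le_pow_left' (enorm_add_le a b) 2).trans (add_sq_le _ _)

lemma enorm_sub_sq_le {F : Type*} [NormedAddCommGroup F] (a b : F) :
    ‖a - b‖ₑ ^ 2 ≤ 2 * (‖a‖ₑ ^ 2 + ‖b‖ₑ ^ 2) :=
  (pow_le_pow_left' (enorm_sub_le (a := a) (b := b)) 2).trans (add_sq_le _ _)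

lemma lintegral_comp_affine {d : ℕ} {h : Rd d → ℝ≥0∞} (hh : Measurable h) (z : Rd d) {ρ : ℝ}
    (hρ : 0 < ρ) :
    ∫⁻ y, h (z + ρ • y) = ENNReal.ofReal (ρ ^ d)⁻¹ * ∫⁻ x, h x := by
  have h1 : ∫⁻ y, h (z + ρ • y) = ∫⁻ x, h (z + x) ∂(Measure.map (fun y : Rd d => ρ • y) volume) :=
    (lintegral_map (hh.comp (measurable_const_add z)) (measurable_const_smul ρ)).symm
  rw [h1, Measure.map_addHaar_smul _ hρ.ne', lintegral_smul_measure, lintegral_add_left_eq_self]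
  simp [abs_of_pos hρ]

lemma mem_ball_affine_iff {d : ℕ} (z y : Rd d) {ρ : ℝ} (hρ : 0 < ρ) :
    z + ρ • y ∈ Metric.ball z ρ ↔ y ∈ Metric.ball (0 : Rd d) 1 := by
  simp only [Metric.mem_ball, dist_self_add_left, norm_smul, Real.norm_eq_abs, abs_of_pos hρ,
    dist_zero_right]
  exact mul_lt_iff_lt_one_right hρ

lemma lintegral_ball_eq {d : ℕ} {h : Rd d → ℝ≥0∞} (hh : Measurable h) (z : Rd d) {ρ : ℝ}
    (hρ : 0 < ρ) :
    ∫⁻ y in Metric.ball 0 1, h (z + ρ • y) =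
      ENNReal.ofReal (ρ ^ d)⁻¹ * ∫⁻ x in Metric.ball z ρ, h x := by
  rw [← lintegral_indicator measurableSet_ball, ← lintegral_indicator measurableSet_ball,
    ← lintegral_comp_affine (hh.indicator measurableSet_ball) z hρ]
  refine lintegral_congr fun y => ?_
  have h3 := mem_ball_affine_iff z y hρ
  by_cases h4 : y ∈ Metric.ball (0 : Rd d) 1
  · rw [indicator_of_mem h4, indicator_of_mem (h3.2 h4)]
  · rw [indicator_of_notMem h4, indicator_of_notMem (fun h => h4 (h3.1 h))]

lemma setAverage_ball_eq {d : ℕ} {F : Type*} [NormedAddCommGroup F] [NormedSpace ℝ F]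
    (f : Rd d → F) (z : Rd d) {ρ : ℝ} (hρ : 0 < ρ) :
    ⨍ x in Metric.ball z ρ, f x = ⨍ y in Metric.ball (0 : Rd d) 1, f (z + ρ • y) := by
  have h1 : ∫ y in Metric.ball (0 : Rd d) 1, f (z + ρ • y) =
      (ρ ^ d)⁻¹ • ∫ x in Metric.ball z ρ, f x := by
    have := Measure.integral_comp_smul (volume : Measure (Rd d))
      (fun x => (Metric.ball z ρ).indicator f (z + x)) ρ
    rw [integral_add_left_eq_self (μ := (volume : Measure (Rd d))) ((Metric.ball z ρ).indicator f),
      integral_indicator measurableSet_ball] at this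
    rw [← integral_indicator measurableSet_ball]
    simp only [finrank_euclideanSpace, Fintype.card_fin,
      abs_of_pos (inv_pos.2 (pow_pos hρ d))] at this
    rw [← this]
    refine integral_congr_ae (Eventually.of_forall fun y => ?_)
    have h3 := mem_ball_affine_iff z y hρ
    by_cases h4 : y ∈ Metric.ball (0 : Rd d) 1
    · simp only [indicator_of_mem h4, indicator_of_mem (h3.2 h4)]
    · simp only [indicator_of_notMem h4, indicator_of_notMem (fun h => h4 (h3.1 h))]
  have h2 : volume.real (Metric.ball z ρ) = ρ ^ d * volume.real (Metric.ball (0 : Rd d) 1) := by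
    rw [measureReal_def, Measure.addHaar_ball_of_pos _ _ hρ, ENNReal.toReal_mul,
      ENNReal.toReal_ofReal (by positivity), measureReal_def]
    simp
  rw [setAverage_eq, setAverage_eq, h1, h2, smul_smul, mul_inv, mul_comm]

/-! ### Averages and the Poincaré inequality for smooth functions -/

/-- The fundamental theorem of calculus along a path, followed by the Cauchy–Schwarz inequality. -/
lemma enorm_sub_sq_le_path {d : ℕ} {f : Rd d → ℂ} (hf : ContDiff ℝ 1 f) {γ γ' : ℝ → Rd d}
    (hγ : ∀ t, HasDerivAt γ (γ' t) t) (hγ' : Continuous γ') {a b : ℝ} (hab : a ≤ b) :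
    ‖f (γ b) - f (γ a)‖ₑ ^ 2 ≤
      ENNReal.ofReal (b - a) * ∫⁻ t in Ioc a b, (‖cgrad f (γ t)‖ₑ * ‖γ' t‖ₑ) ^ 2 := by
  have hγc : Continuous γ := continuous_iff_continuousAt.2 fun t => (hγ t).continuousAt
  have hc : Continuous fun t => fderiv ℝ f (γ t) (γ' t) := by
    have := hf.continuous_fderiv (by norm_num)
    fun_prop
  have h1 : ∫ t in Ioc a b, fderiv ℝ f (γ t) (γ' t) = f (γ b) - f (γ a) := by
    rw [← intervalIntegral.integral_of_le hab]
    refine intervalIntegral.integral_eq_sub_of_hasDerivAt (f := fun t => f (γ t))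
      (fun t _ => ?_) (hc.intervalIntegrable _ _)
    exact ((hf.differentiable (by norm_num)) _).hasFDerivAt.comp_hasDerivAt t (hγ t)
  rw [← h1]
  refine (sq_enorm_integral_le _ hc.aestronglyMeasurable).trans ?_
  rw [Measure.restrict_apply_univ, Real.volume_Ioc]
  gcongr
  exact enorm_fderiv_apply_le _ _ _

/-- The weighted energy `∫_a^b 4 s² s^(-2d) ∫_{B(z,s²)} h dx ds` that controls the change of the
averages over the balls `B(z, s²)` for `a ≤ s ≤ b`. Parametrising the radius as `s²` makes the
estimate scale correctly without any further weight. -/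
noncomputable def shellEnergy {d : ℕ} (a b : ℝ) (h : Rd d → ℝ≥0∞) (z : Rd d) : ℝ≥0∞ :=
  ∫⁻ s in Ioc a b, ENNReal.ofReal (4 * s ^ 2) *
    (ENNReal.ofReal ((s ^ 2) ^ d)⁻¹ * ∫⁻ x in Metric.ball z (s ^ 2), h x)

/-- Averages over concentric balls: both averages are taken over the unit ball by scaling, and the
path `t ↦ z + t² y` joins corresponding points. -/
lemma average_sub_sq_le_of_contDiff {d : ℕ} {f : Rd d → ℂ} (hf : ContDiff ℝ 1 f) (z : Rd d)
    {a b : ℝ} (ha : 0 < a) (hab : a ≤ b) :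
    ‖(⨍ x in Metric.ball z (b ^ 2), f x) - ⨍ x in Metric.ball z (a ^ 2), f x‖ₑ ^ 2 ≤
      (volume (Metric.ball (0 : Rd d) 1))⁻¹ *
        (ENNReal.ofReal (b - a) * shellEnergy a b (fun x => ‖cgrad f x‖ₑ ^ 2) z) := by
  set V := volume (Metric.ball (0 : Rd d) 1) with hV
  have hV0 : V ≠ 0 := (Metric.measure_ball_pos _ _ one_pos).ne'
  have hVt : V ≠ ⊤ := measure_ball_lt_top.ne
  have hb : 0 < b := ha.trans_le hab
  have hcg := continuous_cgrad hf
  have hfc := hf.continuous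
  have hint : ∀ ρ : ℝ, IntegrableOn (fun y : Rd d => f (z + ρ • y)) (Metric.ball 0 1) := fun ρ =>
    ((by fun_prop : Continuous fun y : Rd d => f (z + ρ • y)).continuousOn.integrableOn_compact
      (isCompact_closedBall 0 1)).mono_set Metric.ball_subset_closedBall
  rw [setAverage_ball_eq f z (pow_pos hb 2), setAverage_ball_eq f z (pow_pos ha 2),
    setAverage_eq, setAverage_eq, ← smul_sub, ← integral_sub (hint _) (hint _), enorm_smul, mul_pow]
  have h1 : ∀ y ∈ Metric.ball (0 : Rd d) 1, ‖f (z + b ^ 2 • y) - f (z + a ^ 2 • y)‖ₑ ^ 2 ≤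
      ENNReal.ofReal (b - a) * ∫⁻ s in Ioc a b,
        ENNReal.ofReal (4 * s ^ 2) * ‖cgrad f (z + s ^ 2 • y)‖ₑ ^ 2 := by
    intro y hy
    have := enorm_sub_sq_le_path hf (γ := fun t => z + t ^ 2 • y) (γ' := fun t => (2 * t) • y)
      (fun t => by simpa using ((hasDerivAt_pow 2 t).smul_const y).const_add z)
      (by fun_prop) hab
    refine this.trans ?_
    gcongr with t
    rw [mul_pow, mul_comm]
    gcongr
    rw [← ofReal_norm, ← ENNReal.ofReal_pow (norm_nonneg _), norm_smul, mul_pow]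
    refine ENNReal.ofReal_le_ofReal ?_
    have : ‖y‖ ≤ 1 := by simpa using (Metric.mem_ball.1 hy).le
    calc ‖2 * t‖ ^ 2 * ‖y‖ ^ 2 ≤ ‖2 * t‖ ^ 2 * 1 ^ 2 := by gcongr
      _ = _ := by rw [Real.norm_eq_abs, sq_abs]; ring
  have h2 : ∫⁻ y in Metric.ball (0 : Rd d) 1, ‖f (z + b ^ 2 • y) - f (z + a ^ 2 • y)‖ₑ ^ 2 ≤
      ENNReal.ofReal (b - a) * shellEnergy a b (fun x => ‖cgrad f x‖ₑ ^ 2) z := by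
    refine (setLIntegral_mono' measurableSet_ball h1).trans ?_
    rw [lintegral_const_mul' _ _ ENNReal.ofReal_ne_top, lintegral_lintegral_swap]
    · gcongr
      rw [shellEnergy]
      refine (setLIntegral_mono' measurableSet_Ioc fun s hs => ?_)
      rw [lintegral_const_mul' _ _ ENNReal.ofReal_ne_top,
        ← lintegral_ball_eq (by fun_prop) z (pow_pos (ha.trans hs.1) 2)]
    · refine Measurable.aemeasurable ?_
      have hc : Continuous fun p : Rd d × ℝ => cgrad f (z + p.2 ^ 2 • p.1) :=
        hcg.comp (by fun_prop)
      exact (by fun_prop : Measurable fun p : Rd d × ℝ => ENNReal.ofReal (4 * p.2 ^ 2)).mul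
        (hc.measurable.enorm.pow_const 2)
  have h3 : ‖((volume : Measure (Rd d)).real (Metric.ball 0 1))⁻¹‖ₑ = V⁻¹ := by
    rw [← ofReal_norm, Real.norm_of_nonneg (by positivity), ENNReal.ofReal_inv_of_pos,
      measureReal_def, ENNReal.ofReal_toReal hVt]
    exact ENNReal.toReal_pos hV0 hVt
  rw [h3]
  calc _ ≤ V⁻¹ ^ 2 * (V * (ENNReal.ofReal (b - a) *
        shellEnergy a b (fun x => ‖cgrad f x‖ₑ ^ 2) z)) := by
        gcongr
        refine (sq_enorm_integral_le _ ?_).trans ?_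
        · exact ((hint _).sub (hint _)).aestronglyMeasurable
        · rw [Measure.restrict_apply_univ]
          gcongr
    _ = _ := by
        rw [sq, mul_assoc, ← mul_assoc _ V, ENNReal.inv_mul_cancel hV0 hVt, one_mul]

/-- The Poincaré inequality on a ball, in the form of a double integral. Comparing both points with
their midpoint keeps the Jacobian of `x ↦ y + t (x - y)` bounded below. -/
lemma poincare_of_contDiff {d : ℕ} {f : Rd d → ℂ} (hf : ContDiff ℝ 1 f) (z : Rd d) {R : ℝ}
    (hR : 0 < R) :
    ∫⁻ x in Metric.ball z R, ∫⁻ y in Metric.ball z R, ‖f x - f y‖ₑ ^ 2 ≤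
      ENNReal.ofReal (2 ^ (d + 2) * R ^ 2) * volume (Metric.ball z R) *
        ∫⁻ x in Metric.ball z R, ‖cgrad f x‖ₑ ^ 2 := by
  have hcg := continuous_cgrad hf
  have hfc := hf.continuous
  set B := Metric.ball z R with hB
  set I := ∫⁻ x in B, ‖cgrad f x‖ₑ ^ 2 with hI
  -- the difference to the midpoint, for a fixed second endpoint
  have key : ∀ y ∈ B, ∫⁻ x in B, ‖f x - f (y + (1 / 2 : ℝ) • (x - y))‖ₑ ^ 2 ≤
      ENNReal.ofReal (2 ^ d * R ^ 2) * I := by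
    intro y hy
    have h1 : ∀ x ∈ B, ‖f x - f (y + (1 / 2 : ℝ) • (x - y))‖ₑ ^ 2 ≤
        ENNReal.ofReal (1 / 2) * ∫⁻ t in Ioc (1 / 2 : ℝ) 1,
          ENNReal.ofReal (4 * R ^ 2) *
            B.indicator (fun w => ‖cgrad f w‖ₑ ^ 2) ((y - t • y) + t • x) := by
      intro x hx
      have := enorm_sub_sq_le_path hf (γ := fun t => y + t • (x - y)) (γ' := fun _ => x - y)
        (fun t => by simpa using ((hasDerivAt_id t).smul_const (x - y)).const_add y)
        continuous_const (a := 1 / 2) (b := 1) (by norm_num)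
      simp only [one_smul, add_sub_cancel] at this
      refine this.trans ?_
      rw [show (1 : ℝ) - 1 / 2 = 1 / 2 by norm_num]
      refine mul_le_mul' le_rfl (setLIntegral_mono' measurableSet_Ioc fun t ht => ?_)
      have hm : (y - t • y) + t • x ∈ B := by
        have := (convex_ball z R) hy hx (by linarith [ht.2] : 0 ≤ 1 - t)
          (by linarith [ht.1] : 0 ≤ t) (by ring)
        rw [show (1 - t) • y + t • x = (y - t • y) + t • x by rw [sub_smul, one_smul]] at this
        exact this
      rw [indicator_of_mem hm, mul_pow, mul_comm]
      have he : y + t • (x - y) = (y - t • y) + t • x := by rw [smul_sub]; abel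
      rw [he]
      gcongr
      rw [← ofReal_norm, ← ENNReal.ofReal_pow (norm_nonneg _)]
      refine ENNReal.ofReal_le_ofReal ?_
      have h5 : ‖x - y‖ ≤ 2 * R := by
        rw [← dist_eq_norm]
        have := dist_triangle_right x y z
        have h6 := Metric.mem_ball.1 hx
        have h7 := Metric.mem_ball.1 hy
        linarith
      calc ‖x - y‖ ^ 2 ≤ (2 * R) ^ 2 := by gcongr
        _ = _ := by ring
    have hmeas : Measurable (B.indicator (fun w => ‖cgrad f w‖ₑ ^ 2)) :=
      (by fun_prop : Measurable fun w => ‖cgrad f w‖ₑ ^ 2).indicator measurableSet_ball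
    refine (setLIntegral_mono' measurableSet_ball h1).trans ?_
    rw [lintegral_const_mul' _ _ ENNReal.ofReal_ne_top, lintegral_lintegral_swap]
    · calc _ ≤ ENNReal.ofReal (1 / 2) * ∫⁻ t in Ioc (1 / 2 : ℝ) 1,
            ENNReal.ofReal (4 * R ^ 2) * (ENNReal.ofReal (2 ^ d) * I) := by
            refine mul_le_mul' le_rfl (setLIntegral_mono' measurableSet_Ioc fun t ht => ?_)
            rw [lintegral_const_mul' _ _ ENNReal.ofReal_ne_top]
            refine mul_le_mul' le_rfl ?_
            have ht0 : (0 : ℝ) < t := by linarith [ht.1]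
            refine (setLIntegral_le_lintegral _ _).trans ?_
            rw [lintegral_comp_affine hmeas (y - t • y) ht0, lintegral_indicator measurableSet_ball]
            gcongr
            rw [← inv_pow]
            gcongr
            rw [inv_le_comm₀ ht0 two_pos]
            linarith [ht.1]
        _ = ENNReal.ofReal (2 ^ d * R ^ 2) * I := by
            rw [lintegral_const, Measure.restrict_apply_univ, Real.volume_Ioc,
              mul_comm _ (ENNReal.ofReal (1 - 1 / 2)),
              ← mul_assoc, ← mul_assoc, ← mul_assoc, ← ENNReal.ofReal_mul (by norm_num),
              ← ENNReal.ofReal_mul (by norm_num), ← ENNReal.ofReal_mul (by positivity)]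
            congr 2
            ring
    · refine Measurable.aemeasurable ?_
      simp only [Function.uncurry_def]
      exact measurable_const.mul (hmeas.comp (by fun_prop))
  have h4 : ∀ x y : Rd d, ‖f x - f y‖ₑ ^ 2 ≤
      2 * (‖f x - f (y + (1 / 2 : ℝ) • (x - y))‖ₑ ^ 2 +
        ‖f y - f (x + (1 / 2 : ℝ) • (y - x))‖ₑ ^ 2) := by
    intro x y
    have he : x + (1 / 2 : ℝ) • (y - x) = y + (1 / 2 : ℝ) • (x - y) := by
      ext i
      simp
      ring
    rw [he]
    have := enorm_sub_sq_le (f x - f (y + (1 / 2 : ℝ) • (x - y)))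
      (f y - f (y + (1 / 2 : ℝ) • (x - y)))
    simpa using this
  have hm1 : Measurable (Function.uncurry fun x y : Rd d =>
      ‖f x - f (y + (1 / 2 : ℝ) • (x - y))‖ₑ ^ 2) := by
    simp only [Function.uncurry_def]
    fun_prop
  have hm2 : Measurable (Function.uncurry fun x y : Rd d =>
      ‖f y - f (x + (1 / 2 : ℝ) • (y - x))‖ₑ ^ 2) := by
    simp only [Function.uncurry_def]
    fun_prop
  have hbound : ∫⁻ y in B, ∫⁻ x in B, ‖f x - f (y + (1 / 2 : ℝ) • (x - y))‖ₑ ^ 2 ≤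
      ENNReal.ofReal (2 ^ d * R ^ 2) * I * volume B := by
    refine (setLIntegral_mono' measurableSet_ball key).trans ?_
    rw [lintegral_const, Measure.restrict_apply_univ]
  calc ∫⁻ x in B, ∫⁻ y in B, ‖f x - f y‖ₑ ^ 2
      ≤ ∫⁻ x in B, ∫⁻ y in B, 2 * (‖f x - f (y + (1 / 2 : ℝ) • (x - y))‖ₑ ^ 2 +
        ‖f y - f (x + (1 / 2 : ℝ) • (y - x))‖ₑ ^ 2) :=
        lintegral_mono fun x => lintegral_mono fun y => h4 x y
    _ = 2 * ((∫⁻ x in B, ∫⁻ y in B, ‖f x - f (y + (1 / 2 : ℝ) • (x - y))‖ₑ ^ 2) +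
        ∫⁻ x in B, ∫⁻ y in B, ‖f y - f (x + (1 / 2 : ℝ) • (y - x))‖ₑ ^ 2) := by
        have h5 := hm1.lintegral_prod_right' (ν := volume.restrict B)
        simp only [Function.uncurry_apply_pair] at h5
        rw [← lintegral_add_left h5, ← lintegral_const_mul' _ _ (by norm_num)]
        refine lintegral_congr fun x => ?_
        have h6 : Measurable fun y => ‖f x - f (y + (1 / 2 : ℝ) • (x - y))‖ₑ ^ 2 :=
          hm1.of_uncurry_left
        rw [← lintegral_add_left h6, ← lintegral_const_mul' _ _ (by norm_num)]
    _ ≤ 2 * (ENNReal.ofReal (2 ^ d * R ^ 2) * I * volume B +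
          ENNReal.ofReal (2 ^ d * R ^ 2) * I * volume B) := by
        gcongr
        rw [lintegral_lintegral_swap hm1.aemeasurable]
        exact hbound
    _ = _ := by
        have : (ENNReal.ofReal (2 ^ (d + 2) * R ^ 2)) = 4 * ENNReal.ofReal (2 ^ d * R ^ 2) := by
          rw [show (4 : ℝ≥0∞) = ENNReal.ofReal 4 by norm_num, ← ENNReal.ofReal_mul (by norm_num)]
          congr 1
          ring
        rw [this]
        ring

/-! ### Weak gradients on the whole space and mollification -/

/-- The square integrable functions `f` and `g` on `ℝ^d` satisfy `g = ∇f` in the weak sense. -/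
structure HasWeakGradient {d : ℕ} (f : Rd d → ℂ) (g : Rd d → EuclideanSpace ℂ (Fin d)) : Prop where
  stronglyMeasurable : StronglyMeasurable f
  stronglyMeasurable_grad : StronglyMeasurable g
  memLp : MemLp f 2
  memLp_grad : MemLp g 2
  integral_eq : ∀ φ : Rd d → ℝ, ContDiff ℝ ∞ φ → HasCompactSupport φ → ∀ i : Fin d,
    ∫ x, fderiv ℝ φ x (EuclideanSpace.single i 1) • f x = - ∫ x, φ x • g x i

lemma eLpNorm_two_sq {α F : Type*} [MeasurableSpace α] [NormedAddCommGroup F] (f : α → F)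
    (ν : Measure α) : eLpNorm f 2 ν ^ 2 = ∫⁻ x, ‖f x‖ₑ ^ 2 ∂ν := by
  have := eLpNorm_nnreal_pow_eq_lintegral (f := f) (μ := ν) (p := 2) (by norm_num)
  simp only [NNReal.coe_ofNat, ENNReal.rpow_ofNat, ENNReal.coe_ofNat] at this
  exact this

lemma lintegral_sq_lt_top {α F : Type*} [MeasurableSpace α] [NormedAddCommGroup F] {f : α → F}
    {ν : Measure α} (hf : MemLp f 2 ν) : ∫⁻ x, ‖f x‖ₑ ^ 2 ∂ν < ⊤ := by
  rw [← eLpNorm_two_sq]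
  exact ENNReal.pow_lt_top hf.2

lemma memLp_two_of_lintegral {α F : Type*} [MeasurableSpace α] [NormedAddCommGroup F] {f : α → F}
    {ν : Measure α} (hm : AEStronglyMeasurable f ν) (h : ∫⁻ x, ‖f x‖ₑ ^ 2 ∂ν < ⊤) :
    MemLp f 2 ν := by
  refine ⟨hm, ?_⟩
  rw [← eLpNorm_two_sq] at h
  by_contra hc
  simp [top_le_iff.1 (not_lt.1 hc)] at h

section Mollification

variable {F : Type*} [NormedAddCommGroup F]

/-- Translations are continuous in `L²`. -/
lemma tendsto_lintegral_translate {d : ℕ} {f : Rd d → F} (hf : MemLp f 2) :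
    Tendsto (fun t : Rd d => ∫⁻ x, ‖f (x - t) - f x‖ₑ ^ 2) (𝓝 0) (𝓝 0) := by
  have hmp : ∀ t : Rd d, MeasurePreserving (fun x : Rd d => x - t) volume volume :=
    fun t => measurePreserving_sub_right volume t
  let g : C(Rd d, C(Rd d, Rd d)) :=
    (ContinuousMap.mk (fun p : Rd d × Rd d => p.2 - p.1) (by fun_prop)).curry
  have h1 := (tendsto_const_nhds (x := hf.toLp f) (f := 𝓝 (0 : Rd d))).compMeasurePreservingLp
    (g.continuous.tendsto 0) (fun t => hmp t) (hmp 0) (by norm_num)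
  have h2 := (ENNReal.continuous_pow 2).tendsto 0 |>.comp (tendsto_iff_edist_tendsto_0.1 h1)
  simp only [ne_eq, OfNat.ofNat_ne_zero, not_false_eq_true, zero_pow] at h2
  refine h2.congr fun t => ?_
  simp only [Function.comp_def]
  rw [Lp.edist_def, ← eLpNorm_two_sq]
  congr 1
  refine eLpNorm_congr_ae ?_
  have h3 := Lp.coeFn_compMeasurePreserving (hf.toLp f) (hmp t)
  have h4 := Lp.coeFn_compMeasurePreserving (hf.toLp f) (hmp 0)
  filter_upwards [h3, h4, hf.coeFn_toLp, (hmp t).quasiMeasurePreserving.ae_eq_comp hf.coeFn_toLp]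
    with x h3 h4 h5 h6
  simp only [Function.comp_def] at h6
  rw [Pi.sub_apply]
  have h7 : (g t : Rd d → Rd d) = fun x => x - t := rfl
  have h8 : (g 0 : Rd d → Rd d) = fun x => x - 0 := rfl
  simp only [h7, h8]
  rw [h3, h4]
  simp only [Function.comp_def, sub_zero, h5, h6]

open scoped Convolution
open ContinuousLinearMap (lsmul)

variable [NormedSpace ℝ F] [CompleteSpace F]

/-- Mollification converges in `L²`: Jensen's inequality and continuity of translations. -/
lemma exists_mollify_le {d : ℕ} {f : Rd d → F} (hsm : StronglyMeasurable f) (hf : MemLp f 2)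
    {ε : ℝ≥0∞} (hε : 0 < ε) : ∃ δ : ℝ, 0 < δ ∧ ∀ φ : ContDiffBump (0 : Rd d), φ.rOut ≤ δ →
      ∫⁻ x, ‖(φ.normed volume ⋆[lsmul ℝ ℝ, volume] f) x - f x‖ₑ ^ 2 ≤ ε := by
  obtain ⟨δ, hδ, hball⟩ := Metric.eventually_nhds_iff.1
    ((tendsto_lintegral_translate hf).eventually (ge_mem_nhds hε))
  refine ⟨δ, hδ, fun φ hφ => ?_⟩
  set ρ := φ.normed (volume : Measure (Rd d)) with hρ
  have hρc : Continuous ρ := φ.continuous_normed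
  have hρ0 : ∀ t, 0 ≤ ρ t := φ.nonneg_normed
  have hρi : Integrable ρ := φ.integrable_normed
  have hloc : LocallyIntegrable f := hf.locallyIntegrable (by norm_num)
  set ν := (volume : Measure (Rd d)).withDensity fun t => ENNReal.ofReal (ρ t) with hν
  have hν1 : ν univ = 1 := by
    rw [hν, withDensity_apply _ MeasurableSet.univ, Measure.restrict_univ,
      ← ofReal_integral_eq_lintegral_ofReal hρi (Eventually.of_forall hρ0), φ.integral_normed,
      ENNReal.ofReal_one]
  have hjm : Measurable fun p : Rd d × Rd d => ‖f (p.1 - p.2) - f p.1‖ₑ ^ 2 :=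
    ((hsm.comp_measurable (measurable_fst.sub measurable_snd)).sub
      (hsm.comp_measurable measurable_fst)).enorm.pow_const 2
  have h1 : ∀ x, ‖(ρ ⋆[lsmul ℝ ℝ, volume] f) x - f x‖ₑ ^ 2 ≤
      ∫⁻ t, ‖f (x - t) - f x‖ₑ ^ 2 ∂ν := by
    intro x
    have hex : Integrable fun t => ρ t • f (x - t) :=
      (φ.hasCompactSupport_normed.convolutionExists_left (lsmul ℝ ℝ) hρc hloc) x
    have h2 : (ρ ⋆[lsmul ℝ ℝ, volume] f) x - f x = ∫ t, ρ t • (f (x - t) - f x) := by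
      simp only [smul_sub]
      rw [integral_sub hex (hρi.smul_const _), integral_smul_const, φ.integral_normed, one_smul]
      rfl
    have h3 : StronglyMeasurable fun t => f (x - t) - f x :=
      (hsm.comp_measurable (measurable_const.sub measurable_id)).sub stronglyMeasurable_const
    have h4 : ‖∫ t, ρ t • (f (x - t) - f x)‖ₑ ≤ ∫⁻ t, ‖f (x - t) - f x‖ₑ ∂ν := by
      rw [hν, lintegral_withDensity_eq_lintegral_mul _ hρc.measurable.ennreal_ofReal h3.enorm]
      refine (enorm_integral_le_lintegral_enorm _).trans (le_of_eq (lintegral_congr fun t => ?_))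
      rw [enorm_smul, Pi.mul_apply, Real.enorm_of_nonneg (hρ0 t)]
    rw [h2]
    calc _ ≤ (∫⁻ t, ‖f (x - t) - f x‖ₑ ∂ν) ^ 2 := by gcongr
      _ ≤ _ := (sq_lintegral_le ν h3.enorm.aemeasurable).trans (by rw [hν1, one_mul])
  have : IsFiniteMeasure ν := ⟨by rw [hν1]; exact ENNReal.one_lt_top⟩
  calc _ ≤ ∫⁻ x, ∫⁻ t, ‖f (x - t) - f x‖ₑ ^ 2 ∂ν := lintegral_mono h1
    _ = ∫⁻ t, (∫⁻ x, ‖f (x - t) - f x‖ₑ ^ 2) ∂ν := lintegral_lintegral_swap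
        (f := fun x t => ‖f (x - t) - f x‖ₑ ^ 2) hjm.aemeasurable
    _ ≤ ∫⁻ _t, ε ∂ν := by
        have hm : Measurable fun t => ∫⁻ x, ‖f (x - t) - f x‖ₑ ^ 2 :=
          (hjm.comp measurable_swap).lintegral_prod_right'
        rw [hν, lintegral_withDensity_eq_lintegral_mul volume hρc.measurable.ennreal_ofReal hm,
          lintegral_withDensity_eq_lintegral_mul _ hρc.measurable.ennreal_ofReal measurable_const]
        refine lintegral_mono fun t => ?_
        simp only [Pi.mul_apply]
        by_cases ht : ρ t = 0
        · simp [ht]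
        · gcongr
          refine hball ?_
          have : t ∈ Function.support ρ := ht
          rw [hρ, φ.support_normed_eq] at this
          exact (Metric.mem_ball.1 this).trans_le hφ
    _ = ε := by rw [lintegral_const, hν1, mul_one]

/-- The gradient of a mollification is the mollification of the weak gradient. -/
lemma HasWeakGradient.cgrad_mollify {d : ℕ} {f : Rd d → ℂ} {g : Rd d → EuclideanSpace ℂ (Fin d)}
    (h : HasWeakGradient f g) (φ : ContDiffBump (0 : Rd d)) (x : Rd d) :
    cgrad (φ.normed volume ⋆[lsmul ℝ ℝ, volume] f) x =
      (φ.normed volume ⋆[lsmul ℝ ℝ, volume] g) x := by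
  have hloc : LocallyIntegrable f := h.memLp.locallyIntegrable (by norm_num)
  have hlocg : LocallyIntegrable g := h.memLp_grad.locallyIntegrable (by norm_num)
  set ρ := φ.normed (volume : Measure (Rd d)) with hρ
  have hρs : ContDiff ℝ ∞ ρ := φ.contDiff_normed
  have hρc : HasCompactSupport ρ := φ.hasCompactSupport_normed
  have hD := hρc.hasFDerivAt_convolution_left (lsmul ℝ ℝ) (hρs.of_le (by simp)) hloc x
  ext i
  rw [cgrad_apply, hD.fderiv, convolution_def]
  have hex : Integrable fun t => ((lsmul ℝ ℝ : ℝ →L[ℝ] ℂ →L[ℝ] ℂ).precompL (Rd d))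
      (fderiv ℝ ρ t) (f (x - t)) :=
    ((hρc.fderiv (𝕜 := ℝ)).convolutionExists_left _ (hρs.continuous_fderiv (by simp)) hloc) x
  rw [ContinuousLinearMap.integral_apply hex]
  have hψs : ContDiff ℝ ∞ fun t => ρ (x - t) := hρs.comp (contDiff_const.sub contDiff_id)
  have hψc : HasCompactSupport fun t => ρ (x - t) :=
    hρc.comp_homeomorph (Homeomorph.subLeft x)
  have key := h.integral_eq _ hψs hψc i
  have hd : ∀ t, fderiv ℝ (fun t => ρ (x - t)) t (EuclideanSpace.single i 1) =
      - fderiv ℝ ρ (x - t) (EuclideanSpace.single i 1) := by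
    intro t
    have h1 := ((hρs.differentiable (by simp)) (x - t)).hasFDerivAt.comp t
      ((hasFDerivAt_id t).const_sub x)
    have h2 : fderiv ℝ (fun t => ρ (x - t)) t = _ := h1.fderiv
    rw [h2]
    simp
  simp only [hd, neg_smul, integral_neg, neg_inj] at key
  have h1 : (∫ t, (((lsmul ℝ ℝ : ℝ →L[ℝ] ℂ →L[ℝ] ℂ).precompL (Rd d))
      (fderiv ℝ ρ t) (f (x - t))) (EuclideanSpace.single i 1)) =
      ∫ t, fderiv ℝ ρ (x - t) (EuclideanSpace.single i 1) • f t := by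
    rw [← integral_sub_left_eq_self _ volume x]
    simp [ContinuousLinearMap.precompL_apply]
  rw [h1, key, convolution_eq_swap]
  have hexg : Integrable fun t => (lsmul ℝ ℝ (ρ (x - t))) (g t) := by
    have := (hρc.convolutionExists_left (lsmul ℝ ℝ) hρs.continuous hlocg) x
    exact this.integrable_swap
  have := (((EuclideanSpace.proj i : EuclideanSpace ℂ (Fin d) →L[ℂ] ℂ)).restrictScalars
    ℝ).integral_comp_comm hexg
  simpa using this

/-- Smooth functions are dense in `H¹(ℝ^d)`; the approximation hardly enlarges the support. -/
lemma HasWeakGradient.exists_contDiff {d : ℕ} {f : Rd d → ℂ} {g : Rd d → EuclideanSpace ℂ (Fin d)}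
    (h : HasWeakGradient f g) {ε : ℝ≥0∞} (hε : 0 < ε) {δ : ℝ} (hδ : 0 < δ) :
    ∃ φ : Rd d → ℂ, ContDiff ℝ ∞ φ ∧ Function.support φ ⊆ Metric.thickening δ (Function.support f) ∧
      ∫⁻ x, ‖f x - φ x‖ₑ ^ 2 ≤ ε ∧ ∫⁻ x, ‖g x - cgrad φ x‖ₑ ^ 2 ≤ ε := by
  obtain ⟨δ₁, hδ₁, H₁⟩ := exists_mollify_le h.stronglyMeasurable h.memLp hε
  obtain ⟨δ₂, hδ₂, H₂⟩ := exists_mollify_le h.stronglyMeasurable_grad h.memLp_grad hε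
  set r := min δ (min δ₁ δ₂) with hr
  have hr0 : 0 < r := by positivity
  let φ : ContDiffBump (0 : Rd d) := ⟨r / 2, r, by positivity, by linarith⟩
  refine ⟨φ.normed volume ⋆[lsmul ℝ ℝ, volume] f,
    φ.hasCompactSupport_normed.contDiff_convolution_left (n := ⊤) _ φ.contDiff_normed
      (h.memLp.locallyIntegrable (by norm_num)), ?_, ?_, ?_⟩
  · refine (support_convolution_subset _).trans ?_
    rintro _ ⟨a, ha, b, hb, rfl⟩
    rw [φ.support_normed_eq] at ha
    refine Metric.mem_thickening_iff.2 ⟨b, hb, ?_⟩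
    simp only [dist_add_self_left]
    exact (mem_ball_zero_iff.1 ha).trans_le (min_le_left _ _)
  · refine le_trans (le_of_eq (lintegral_congr fun x => ?_))
      (H₁ φ ((min_le_right _ _).trans (min_le_left _ _)))
    rw [← enorm_neg, neg_sub]
  · refine le_trans (le_of_eq (lintegral_congr fun x => ?_))
      (H₂ φ ((min_le_right _ _).trans (min_le_right _ _)))
    rw [h.cgrad_mollify, ← enorm_neg, neg_sub]

end Mollification

/-! ### Lipschitz functions with compact support -/

lemma cgrad_eq_zero_of_notMem_tsupport {d : ℕ} {f : Rd d → ℂ} {x : Rd d} (hx : x ∉ tsupport f) :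
    cgrad f x = 0 := by
  have : fderiv ℝ f x = 0 := by
    by_contra h
    exact hx (support_fderiv_subset ℝ h)
  ext i
  simp [this]

lemma lineDeriv_eq_fderiv_comp {d : ℕ} {f : Rd d → ℂ} {x : Rd d} (hf : DifferentiableAt ℝ f x)
    (L : ℂ →L[ℝ] ℝ) (v : Rd d) : lineDeriv ℝ (fun y => L (f y)) x v = L (fderiv ℝ f x v) :=
  ((L.hasFDerivAt.comp x hf.hasFDerivAt).hasLineDerivAt v).lineDeriv

/-- A compactly supported Lipschitz function lies in `H¹(ℝ^d)` and its weak gradient is the almost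
everywhere defined classical one. -/
lemma _root_.LipschitzWith.hasWeakGradient {d : ℕ} {f : Rd d → ℂ} {K : ℝ≥0}
    (hf : LipschitzWith K f) (hc : HasCompactSupport f) : HasWeakGradient f (cgrad f) where
  stronglyMeasurable := hf.continuous.stronglyMeasurable
  stronglyMeasurable_grad := (measurable_cgrad f).stronglyMeasurable
  memLp := hf.continuous.memLp_of_hasCompactSupport hc
  memLp_grad := by
    refine memLp_two_of_lintegral (measurable_cgrad f).aestronglyMeasurable ?_
    have h1 : ∀ x, ‖cgrad f x‖ₑ ^ 2 ≤
        (tsupport f).indicator (fun _ => ENNReal.ofReal ((√d * K) ^ 2)) x := by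
      intro x
      by_cases hx : x ∈ tsupport f
      · rw [indicator_of_mem hx, ← ofReal_norm, ← ENNReal.ofReal_pow (norm_nonneg _)]
        gcongr
        refine (norm_cgrad_le f x).trans ?_
        gcongr
        exact norm_fderiv_le_of_lipschitz ℝ hf
      · simp [cgrad_eq_zero_of_notMem_tsupport hx]
    refine (lintegral_mono h1).trans_lt ?_
    rw [lintegral_indicator (isClosed_tsupport f).measurableSet, lintegral_const,
      Measure.restrict_apply_univ]
    exact ENNReal.mul_lt_top ENNReal.ofReal_lt_top hc.measure_lt_top
  integral_eq := by
    intro φ hφ hφc i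
    obtain ⟨K', hK'⟩ := hφ.lipschitzWith_of_hasCompactSupport hφc (by simp)
    set v : Rd d := EuclideanSpace.single i 1
    have hdφ : Continuous fun x => fderiv ℝ φ x v := by
      have := hφ.continuous_fderiv (by simp)
      fun_prop
    have hdφc : HasCompactSupport fun x => fderiv ℝ φ x v :=
      hφc.fderiv_apply (𝕜 := ℝ) v
    have h1 : Integrable fun x => fderiv ℝ φ x v • f x :=
      (hdφ.smul hf.continuous).integrable_of_hasCompactSupport hdφc.smul_right
    have hcg : MemLp (fun x => cgrad f x i) ⊤ := by
      refine memLp_top_of_bound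
        ((EuclideanSpace.proj i : EuclideanSpace ℂ (Fin d) →L[ℂ] ℂ).measurable.comp
          (measurable_cgrad f)).aestronglyMeasurable (K : ℝ) (Eventually.of_forall fun x => ?_)
      rw [cgrad_apply]
      refine ((fderiv ℝ f x).le_opNorm _).trans ?_
      simpa using norm_fderiv_le_of_lipschitz ℝ hf
    have h2 : Integrable fun x => φ x • cgrad f x i :=
      ((hφ.continuous.integrable_of_hasCompactSupport hφc).smul_of_top_left hcg)
    have key : ∀ L : ℂ →L[ℝ] ℝ, L (∫ x, fderiv ℝ φ x v • f x) = L (- ∫ x, φ x • cgrad f x i) := by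
      intro L
      have h3 := (L.lipschitz.comp hf).integral_lineDeriv_mul_eq (μ := volume) hK' hφc v
      have h4 : ∀ᵐ x, lineDeriv ℝ (L ∘ f) x v = L (cgrad f x i) := by
        filter_upwards [hf.ae_differentiableAt] with x hx
        exact lineDeriv_eq_fderiv_comp hx L v
      have h5 : ∀ x, lineDeriv ℝ φ x (-v) = - fderiv ℝ φ x v := fun x => by
        rw [((hφ.differentiable (by simp)) x).lineDeriv_eq_fderiv, map_neg]
      rw [map_neg, ← L.integral_comp_comm h1, ← L.integral_comp_comm h2]
      simp only [h5, Function.comp_def, neg_mul, integral_neg] at h3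
      simp only [map_smul, smul_eq_mul]
      rw [← neg_eq_iff_eq_neg, ← h3]
      refine integral_congr_ae ?_
      filter_upwards [h4] with x hx
      rw [← hx, mul_comm]
      rfl
    exact Complex.ext (key Complex.reCLM) (key Complex.imCLM)

/-- A function that is Lipschitz on an open set and vanishes off a compact subset of it is
Lipschitz. -/
lemma exists_lipschitzWith_of_compact {d : ℕ} {f : Rd d → ℂ} {U Q : Set (Rd d)} {K : ℝ≥0}
    (hU : IsOpen U) (hQ : IsCompact Q) (hQU : Q ⊆ U) (hf : LipschitzOnWith K f U)
    (h0 : ∀ x ∉ Q, f x = 0) : ∃ K' : ℝ≥0, LipschitzWith K' f := by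
  obtain ⟨δ, hδ, hδU⟩ := hQ.exists_thickening_subset_open hU hQU
  obtain ⟨M, hM⟩ := hQ.exists_bound_of_continuousOn (hf.continuousOn.mono hQU)
  have hM0 : ∀ x, ‖f x‖ ≤ max M 0 := fun x => by
    by_cases hx : x ∈ Q
    · exact (hM x hx).trans (le_max_left _ _)
    · simp [h0 x hx]
  have main : ∀ x ∈ Q, ∀ y, dist (f x) (f y) ≤ max (K : ℝ) (max M 0 / δ) * dist x y := by
    intro x hx y
    by_cases hy : y ∈ U
    · refine (hf.dist_le_mul x (hQU hx) y hy).trans ?_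
      gcongr
      exact le_max_left _ _
    · have hd : δ ≤ dist x y := by
        by_contra hlt
        refine hy (hδU (Metric.mem_thickening_iff.2 ⟨x, hx, ?_⟩))
        rw [dist_comm]
        exact not_le.1 hlt
      rw [h0 y fun h => hy (hQU h), dist_zero_right]
      calc ‖f x‖ ≤ max M 0 / δ * δ := by
            rw [div_mul_cancel₀ _ hδ.ne']
            exact hM0 x
        _ ≤ _ := by
            gcongr
            exact le_max_right _ _
  refine ⟨⟨max (K : ℝ) (max M 0 / δ), le_max_of_le_left K.2⟩, LipschitzWith.of_dist_le_mul
    fun x y => ?_⟩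
  by_cases hx : x ∈ Q
  · exact main x hx y
  · by_cases hy : y ∈ Q
    · rw [dist_comm, dist_comm x y]
      exact main y hy x
    · rw [h0 x hx, h0 y hy, dist_self]
      exact mul_nonneg (NNReal.coe_nonneg _) dist_nonneg

/-! ### Averages of Sobolev functions over balls -/

/-- Passage to the limit in an estimate that holds up to an arbitrarily small error. -/
lemma le_of_forall_le_add_mul {X A C : ℝ≥0∞} (hC : C ≠ ⊤) (h : ∀ ε : ℝ≥0∞, 0 < ε → X ≤ A + C * ε) :
    X ≤ A := by
  have h1 : Tendsto (fun ε : ℝ≥0∞ => A + C * ε) (𝓝[>] 0) (𝓝 (A + C * 0)) :=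
    (tendsto_const_nhds.add (ENNReal.Tendsto.const_mul tendsto_id (Or.inr hC))).mono_left
      nhdsWithin_le_nhds
  rw [mul_zero, add_zero] at h1
  exact ge_of_tendsto h1 (eventually_mem_nhdsWithin.mono fun ε hε => h ε hε)

lemma measurable_lintegral_ball {d : ℕ} {h : Rd d → ℝ≥0∞} (hh : Measurable h) :
    Measurable fun p : Rd d × ℝ => ∫⁻ x in Metric.ball p.1 p.2, h x := by
  have h1 : ∀ p : Rd d × ℝ, ∫⁻ x in Metric.ball p.1 p.2, h x =
      ∫⁻ x, {q : (Rd d × ℝ) × Rd d | dist q.2 q.1.1 < q.1.2}.indicator (fun q => h q.2) (p, x) := by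
    intro p
    rw [← lintegral_indicator measurableSet_ball]
    rfl
  simp only [h1]
  refine Measurable.lintegral_prod_right' (f := {q : (Rd d × ℝ) × Rd d |
    dist q.2 q.1.1 < q.1.2}.indicator (fun q => h q.2)) ?_
  refine (hh.comp measurable_snd).indicator ?_
  exact (isOpen_lt (by fun_prop) (by fun_prop)).measurableSet

lemma measurable_lintegral_ball_fixed {d : ℕ} {h : Rd d → ℝ≥0∞} (hh : Measurable h) (R : ℝ) :
    Measurable fun z => ∫⁻ x in Metric.ball z R, h x := by
  have h1 : Measurable fun z : Rd d => (z, R) := by fun_prop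
  have h2 := (measurable_lintegral_ball hh).comp h1
  simp only [Function.comp_def] at h2
  exact h2

lemma measurable_shellEnergy_integrand {d : ℕ} {h : Rd d → ℝ≥0∞} (hh : Measurable h) :
    Measurable fun p : Rd d × ℝ => ENNReal.ofReal (4 * p.2 ^ 2) *
      (ENNReal.ofReal ((p.2 ^ 2) ^ d)⁻¹ * ∫⁻ x in Metric.ball p.1 (p.2 ^ 2), h x) :=
  (by fun_prop : Measurable fun p : Rd d × ℝ => ENNReal.ofReal (4 * p.2 ^ 2)).mul
    ((by fun_prop : Measurable fun p : Rd d × ℝ => ENNReal.ofReal ((p.2 ^ 2) ^ d)⁻¹).mul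
      ((measurable_lintegral_ball hh).comp
        (by fun_prop : Measurable fun p : Rd d × ℝ => (p.1, p.2 ^ 2))))

lemma measurable_shellEnergy {d : ℕ} {h : Rd d → ℝ≥0∞} (hh : Measurable h) (a b : ℝ) :
    Measurable (shellEnergy a b h) := by
  unfold shellEnergy
  exact Measurable.lintegral_prod_right' (ν := volume.restrict (Ioc a b))
    (measurable_shellEnergy_integrand hh)

lemma shellEnergy_mono_right {d : ℕ} {a b : ℝ} {h k : Rd d → ℝ≥0∞} (hhk : ∀ x, h x ≤ k x)
    (z : Rd d) : shellEnergy a b h z ≤ shellEnergy a b k z := by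
  unfold shellEnergy
  gcongr with s x
  exact hhk x

lemma shellEnergy_mono_left {d : ℕ} {a a' b : ℝ} (ha : a ≤ a') (h : Rd d → ℝ≥0∞)
    (z : Rd d) : shellEnergy a' b h z ≤ shellEnergy a b h z :=
  lintegral_mono_set (Ioc_subset_Ioc_left ha)

lemma shellEnergy_add {d : ℕ} {a b : ℝ} {h k : Rd d → ℝ≥0∞} (hh : Measurable h) (z : Rd d) :
    shellEnergy a b (fun x => h x + k x) z = shellEnergy a b h z + shellEnergy a b k z := by
  unfold shellEnergy
  have h1 := (measurable_shellEnergy_integrand hh).comp (measurable_prodMk_left (x := z))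
  simp only [Function.comp_def] at h1
  rw [← lintegral_add_left h1]
  refine lintegral_congr fun s => ?_
  rw [lintegral_add_left hh, mul_add, mul_add]

lemma shellEnergy_const_mul {d : ℕ} {a b : ℝ} {c : ℝ≥0∞} (hc : c ≠ ⊤) (h : Rd d → ℝ≥0∞)
    (z : Rd d) :
    shellEnergy a b (fun x => c * h x) z = c * shellEnergy a b h z := by
  unfold shellEnergy
  rw [← lintegral_const_mul' _ _ hc]
  refine lintegral_congr fun s => ?_
  rw [lintegral_const_mul' _ _ hc]
  ring

lemma shellEnergy_le {d : ℕ} {a b : ℝ} (ha : 0 < a) (h : Rd d → ℝ≥0∞)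
    (z : Rd d) : shellEnergy a b h z ≤ ENNReal.ofReal (4 * b ^ 2) *
      ENNReal.ofReal ((a ^ 2) ^ d)⁻¹ * ENNReal.ofReal (b - a) * ∫⁻ x, h x := by
  have h1 : shellEnergy a b h z ≤ ∫⁻ _s in Ioc a b, ENNReal.ofReal (4 * b ^ 2) *
      (ENNReal.ofReal ((a ^ 2) ^ d)⁻¹ * ∫⁻ x, h x) := by
    refine setLIntegral_mono' measurableSet_Ioc fun s hs => ?_
    have hs0 : 0 < s := ha.trans hs.1
    gcongr
    · exact hs.2
    · exact hs.1.le
    · exact Measure.restrict_le_self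
  refine h1.trans (le_of_eq ?_)
  rw [lintegral_const, Measure.restrict_apply_univ, Real.volume_Ioc]
  ring

lemma enorm_setAverage_sq_le {d : ℕ} {f : Rd d → ℂ} (hf : StronglyMeasurable f) (z : Rd d) {R : ℝ}
    (hR : 0 < R) : ‖⨍ x in Metric.ball z R, f x‖ₑ ^ 2 ≤
      (volume (Metric.ball z R))⁻¹ * ∫⁻ x in Metric.ball z R, ‖f x‖ₑ ^ 2 := by
  set V := volume (Metric.ball z R) with hV
  have hV0 : V ≠ 0 := (Metric.measure_ball_pos _ _ hR).ne'
  have hVt : V ≠ ⊤ := measure_ball_lt_top.ne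
  have h3 : ‖((volume : Measure (Rd d)).real (Metric.ball z R))⁻¹‖ₑ = V⁻¹ := by
    rw [← ofReal_norm, Real.norm_of_nonneg (by positivity), ENNReal.ofReal_inv_of_pos,
      measureReal_def, ENNReal.ofReal_toReal hVt]
    exact ENNReal.toReal_pos hV0 hVt
  rw [setAverage_eq, enorm_smul, mul_pow, h3]
  calc _ ≤ V⁻¹ ^ 2 * (V * ∫⁻ x in Metric.ball z R, ‖f x‖ₑ ^ 2) := by
        gcongr
        refine (sq_enorm_integral_le _ hf.aestronglyMeasurable).trans ?_
        rw [Measure.restrict_apply_univ]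
    _ = _ := by
        rw [sq, mul_assoc, ← mul_assoc _ V, ENNReal.inv_mul_cancel hV0 hVt, one_mul]

lemma setAverage_sub {d : ℕ} {f φ : Rd d → ℂ} (hf : MemLp f 2) (hφ : Continuous φ) (z : Rd d)
    (R : ℝ) : ⨍ x in Metric.ball z R, (f x - φ x) =
      (⨍ x in Metric.ball z R, f x) - ⨍ x in Metric.ball z R, φ x := by
  simp only [setAverage_eq]
  have h1 : IntegrableOn f (Metric.ball z R) :=
    (hf.locallyIntegrable (by norm_num)).integrableOn_isCompact (isCompact_closedBall z R)
      |>.mono_set Metric.ball_subset_closedBall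
  have h2 : IntegrableOn φ (Metric.ball z R) :=
    (hφ.continuousOn.integrableOn_compact (isCompact_closedBall z R)).mono_set
      Metric.ball_subset_closedBall
  rw [integral_sub h1 h2, smul_sub]

/-- The change of the averages over concentric balls is controlled by the energy of the gradient in
the shells between them. -/
lemma HasWeakGradient.average_sub_sq_le {d : ℕ} {f : Rd d → ℂ} {g : Rd d → EuclideanSpace ℂ (Fin d)}
    (h : HasWeakGradient f g) (z : Rd d) {a b : ℝ} (ha : 0 < a) (hab : a ≤ b) :
    ‖(⨍ x in Metric.ball z (b ^ 2), f x) - ⨍ x in Metric.ball z (a ^ 2), f x‖ₑ ^ 2 ≤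
      8 * ((volume (Metric.ball (0 : Rd d) 1))⁻¹ *
        (ENNReal.ofReal (b - a) * shellEnergy a b (fun x => ‖g x‖ₑ ^ 2) z)) := by
  have hb : 0 < b := ha.trans_le hab
  set V := volume (Metric.ball (0 : Rd d) 1) with hV
  have hV0 : V ≠ 0 := (Metric.measure_ball_pos _ _ one_pos).ne'
  set Va := volume (Metric.ball z (a ^ 2))
  have hVa : Va ≠ 0 := (Metric.measure_ball_pos _ _ (by positivity)).ne'
  set Vb := volume (Metric.ball z (b ^ 2))
  have hVb : Vb ≠ 0 := (Metric.measure_ball_pos _ _ (by positivity)).ne'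
  set C₀ := ENNReal.ofReal (4 * b ^ 2) * ENNReal.ofReal ((a ^ 2) ^ d)⁻¹ * ENNReal.ofReal (b - a)
    with hC₀
  have hC₀t : C₀ ≠ ⊤ := by finiteness
  refine le_of_forall_le_add_mul
    (C := 8 * (V⁻¹ * (ENNReal.ofReal (b - a) * C₀)) + 4 * (Vb⁻¹ + Va⁻¹)) (by finiteness) ?_
  intro ε hε
  obtain ⟨φ, hφ, -, hfφ, hgφ⟩ := h.exists_contDiff hε one_pos
  have hsub : StronglyMeasurable fun x => f x - φ x :=
    h.stronglyMeasurable.sub hφ.continuous.stronglyMeasurable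
  have hmg : Measurable fun x => ‖g x‖ₑ ^ 2 :=
    h.stronglyMeasurable_grad.measurable.enorm.pow_const 2
  have havg : ∀ r : ℝ, 0 < r → ‖⨍ x in Metric.ball z r, (f x - φ x)‖ₑ ^ 2 ≤
      (volume (Metric.ball z r))⁻¹ * ε := fun r hr => by
    refine (enorm_setAverage_sq_le hsub z hr).trans ?_
    gcongr
    exact (setLIntegral_le_lintegral _ _).trans hfφ
  have e1 : (⨍ x in Metric.ball z (b ^ 2), f x) - ⨍ x in Metric.ball z (a ^ 2), f x =
      ((⨍ x in Metric.ball z (b ^ 2), φ x) - ⨍ x in Metric.ball z (a ^ 2), φ x) +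
      (⨍ x in Metric.ball z (b ^ 2), (f x - φ x)) +
      -(⨍ x in Metric.ball z (a ^ 2), (f x - φ x)) := by
    rw [setAverage_sub h.memLp hφ.continuous, setAverage_sub h.memLp hφ.continuous]
    ring
  have hsh : shellEnergy a b (fun x => ‖cgrad φ x‖ₑ ^ 2) z ≤
      2 * shellEnergy a b (fun x => ‖g x‖ₑ ^ 2) z + 2 * (C₀ * ε) := by
    calc _ ≤ shellEnergy a b (fun x => 2 * (‖g x‖ₑ ^ 2 + ‖g x - cgrad φ x‖ₑ ^ 2)) z := by
          refine shellEnergy_mono_right (fun x => ?_) z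
          have := enorm_sub_sq_le (g x) (g x - cgrad φ x)
          rwa [sub_sub_cancel] at this
      _ = 2 * shellEnergy a b (fun x => ‖g x‖ₑ ^ 2) z +
          2 * shellEnergy a b (fun x => ‖g x - cgrad φ x‖ₑ ^ 2) z := by
          rw [shellEnergy_const_mul (by norm_num), shellEnergy_add hmg, mul_add]
      _ ≤ _ := by
          gcongr
          refine (shellEnergy_le ha _ z).trans ?_
          gcongr
  rw [e1]
  calc _ ≤ (‖(⨍ x in Metric.ball z (b ^ 2), φ x) - ⨍ x in Metric.ball z (a ^ 2), φ x‖ₑ +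
        ‖⨍ x in Metric.ball z (b ^ 2), (f x - φ x)‖ₑ +
        ‖⨍ x in Metric.ball z (a ^ 2), (f x - φ x)‖ₑ) ^ 2 := by
        gcongr
        refine (enorm_add_le _ _).trans ?_
        rw [enorm_neg]
        gcongr
        exact enorm_add_le _ _
    _ ≤ 4 * (V⁻¹ * (ENNReal.ofReal (b - a) * (2 * shellEnergy a b (fun x => ‖g x‖ₑ ^ 2) z +
          2 * (C₀ * ε))) + Vb⁻¹ * ε + Va⁻¹ * ε) := by
        refine (add_sq_le_three _ _ _).trans ?_
        gcongr
        · refine (average_sub_sq_le_of_contDiff (hφ.of_le (by simp)) z ha hab).trans ?_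
          gcongr
        · exact havg _ (by positivity)
        · exact havg _ (by positivity)
    _ = _ := by ring

/-- The Poincaré inequality, in the form that bounds the `L²` norm on a ball by the gradient and
the average. -/
lemma lintegral_ball_le_of_contDiff {d : ℕ} {f : Rd d → ℂ} (hf : ContDiff ℝ 1 f) (z : Rd d) {R : ℝ}
    (hR : 0 < R) :
    ∫⁻ x in Metric.ball z R, ‖f x‖ₑ ^ 2 ≤
      2 * (ENNReal.ofReal (2 ^ (d + 2) * R ^ 2) * ∫⁻ x in Metric.ball z R, ‖cgrad f x‖ₑ ^ 2) +
      2 * (volume (Metric.ball z R) * ‖⨍ x in Metric.ball z R, f x‖ₑ ^ 2) := by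
  set A := ⨍ x in Metric.ball z R, f x with hA
  set B := Metric.ball z R with hB
  have hV0 : volume B ≠ 0 := (Metric.measure_ball_pos _ _ hR).ne'
  have hVt : volume B ≠ ⊤ := measure_ball_lt_top.ne
  have hfc := hf.continuous
  have hint : IntegrableOn f B :=
    (hfc.continuousOn.integrableOn_compact (isCompact_closedBall z R)).mono_set
      Metric.ball_subset_closedBall
  have h1 : ∀ x, ‖f x - A‖ₑ ^ 2 ≤ (volume B)⁻¹ * ∫⁻ y in B, ‖f x - f y‖ₑ ^ 2 := by
    intro x
    have hc : IntegrableOn (fun _ => f x) B := integrableOn_const hVt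
    have h2 : f x - A = ⨍ y in B, (f x - f y) := by
      rw [hA, setAverage_eq, setAverage_eq, integral_sub hc hint, smul_sub,
        setIntegral_const, smul_smul, inv_mul_cancel₀, one_smul]
      exact (ENNReal.toReal_pos hV0 hVt).ne'
    rw [h2]
    exact enorm_setAverage_sq_le
      (by fun_prop : Continuous fun y => f x - f y).stronglyMeasurable z hR
  have hP := poincare_of_contDiff hf z hR
  calc ∫⁻ x in B, ‖f x‖ₑ ^ 2 ≤ ∫⁻ x in B, 2 * (‖f x - A‖ₑ ^ 2 + ‖A‖ₑ ^ 2) := by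
        refine lintegral_mono fun x => ?_
        have := enorm_add_sq_le (f x - A) A
        rwa [sub_add_cancel] at this
    _ = 2 * (∫⁻ x in B, ‖f x - A‖ₑ ^ 2) + 2 * (volume B * ‖A‖ₑ ^ 2) := by
        rw [lintegral_const_mul' _ _ (by norm_num), lintegral_add_right _ measurable_const,
          lintegral_const, Measure.restrict_apply_univ, mul_add, mul_comm (volume B)]
    _ ≤ 2 * ((volume B)⁻¹ * (ENNReal.ofReal (2 ^ (d + 2) * R ^ 2) * volume B *
          ∫⁻ x in B, ‖cgrad f x‖ₑ ^ 2)) + 2 * (volume B * ‖A‖ₑ ^ 2) := by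
        gcongr
        refine (lintegral_mono h1).trans ?_
        rw [lintegral_const_mul' _ _ (by finiteness)]
        gcongr
    _ = _ := by
        rw [mul_comm _ (volume B), mul_assoc (volume B), ← mul_assoc _ (volume B),
          ENNReal.inv_mul_cancel hV0 hVt, one_mul]

/-- The Poincaré inequality for `H¹` functions, by approximation with smooth ones. -/
lemma HasWeakGradient.lintegral_ball_le {d : ℕ} {f : Rd d → ℂ} {g : Rd d → EuclideanSpace ℂ (Fin d)}
    (h : HasWeakGradient f g) (z : Rd d) {R : ℝ} (hR : 0 < R) :
    ∫⁻ x in Metric.ball z R, ‖f x‖ₑ ^ 2 ≤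
      8 * (ENNReal.ofReal (2 ^ (d + 2) * R ^ 2) * ∫⁻ x in Metric.ball z R, ‖g x‖ₑ ^ 2) +
      8 * (volume (Metric.ball z R) * ‖⨍ x in Metric.ball z R, f x‖ₑ ^ 2) := by
  set B := Metric.ball z R with hB
  have hV0 : volume B ≠ 0 := (Metric.measure_ball_pos _ _ hR).ne'
  have hVt : volume B ≠ ⊤ := measure_ball_lt_top.ne
  refine le_of_forall_le_add_mul
    (C := 2 + 8 * ENNReal.ofReal (2 ^ (d + 2) * R ^ 2) + 8) (by finiteness) ?_
  intro ε hε
  obtain ⟨φ, hφ, -, hfφ, hgφ⟩ := h.exists_contDiff hε one_pos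
  have hsub : StronglyMeasurable fun x => f x - φ x :=
    h.stronglyMeasurable.sub hφ.continuous.stronglyMeasurable
  have hsplit : ∀ {F : Type} [NormedAddCommGroup F] (u v : Rd d → F), StronglyMeasurable u →
      ∫⁻ x, ‖u x - v x‖ₑ ^ 2 ≤ ε →
      ∫⁻ x in B, ‖v x‖ₑ ^ 2 ≤ 2 * (∫⁻ x in B, ‖u x‖ₑ ^ 2) + 2 * ε := by
    intro F _ u v hu hε
    calc ∫⁻ x in B, ‖v x‖ₑ ^ 2 ≤ ∫⁻ x in B, 2 * (‖u x‖ₑ ^ 2 + ‖u x - v x‖ₑ ^ 2) := by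
          refine lintegral_mono fun x => ?_
          have := enorm_sub_sq_le (u x) (u x - v x)
          rwa [sub_sub_cancel] at this
      _ = 2 * (∫⁻ x in B, ‖u x‖ₑ ^ 2) + 2 * ∫⁻ x in B, ‖u x - v x‖ₑ ^ 2 := by
          rw [lintegral_const_mul' _ _ (by norm_num), lintegral_add_left (hu.enorm.pow_const 2),
            mul_add]
      _ ≤ _ := by
          gcongr
          exact (setLIntegral_le_lintegral _ _).trans hε
  have h1 := hsplit φ f hφ.continuous.stronglyMeasurable (by
    refine le_trans (le_of_eq (lintegral_congr fun x => ?_)) hfφ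
    rw [← enorm_neg, neg_sub])
  have h2 := hsplit g (cgrad φ) h.stronglyMeasurable_grad hgφ
  have h3 : volume B * ‖⨍ x in B, φ x‖ₑ ^ 2 ≤ 2 * (volume B * ‖⨍ x in B, f x‖ₑ ^ 2) + 2 * ε := by
    have h4 : ‖⨍ x in B, (f x - φ x)‖ₑ ^ 2 ≤ (volume B)⁻¹ * ε := by
      refine (enorm_setAverage_sq_le hsub z hR).trans ?_
      gcongr
      exact (setLIntegral_le_lintegral _ _).trans hfφ
    have h5 := enorm_sub_sq_le (⨍ x in B, f x) (⨍ x in B, (f x - φ x))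
    rw [setAverage_sub h.memLp hφ.continuous, sub_sub_cancel,
      ← setAverage_sub h.memLp hφ.continuous] at h5
    calc _ ≤ volume B * (2 * (‖⨍ x in B, f x‖ₑ ^ 2 + (volume B)⁻¹ * ε)) := by
          gcongr
          refine h5.trans ?_
          gcongr
      _ = 2 * (volume B * ‖⨍ x in B, f x‖ₑ ^ 2) + 2 * (volume B * (volume B)⁻¹ * ε) := by ring
      _ = _ := by rw [ENNReal.mul_inv_cancel hV0 hVt, one_mul]
  have h6 := lintegral_ball_le_of_contDiff (hφ.of_le (by simp)) z hR
  calc _ ≤ _ := h1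
    _ ≤ 2 * (2 * (ENNReal.ofReal (2 ^ (d + 2) * R ^ 2) *
          (2 * (∫⁻ x in B, ‖g x‖ₑ ^ 2) + 2 * ε)) +
        2 * (2 * (volume B * ‖⨍ x in B, f x‖ₑ ^ 2) + 2 * ε)) + 2 * ε := by
        gcongr
        refine h6.trans ?_
        gcongr
    _ = _ := by ring

/-! ### Traces with respect to an upper regular measure -/

/-- A finite measure `m` carried by `D` with `m (B(y, r)) ≤ C r^(d-1)` for all centres `y` and all
small radii. The radii stop at `1 / 2` because a ball that meets `D` is compared with a ball of
twice the radius centred on `D`, and the bounds on a `(d-1)`-set concern radii up to `1`. -/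
structure UpperRegular {d : ℕ} (m : Measure (Rd d)) (D : Set (Rd d)) (C : ℝ) : Prop where
  isFinite : IsFiniteMeasure m
  compl_eq_zero : m Dᶜ = 0
  nonneg : 0 ≤ C
  ball_le : ∀ y : Rd d, ∀ r : ℝ, 0 < r → r ≤ 1 / 2 →
    m (Metric.ball y r) ≤ ENNReal.ofReal (C * r ^ (d - 1))

/-- Tonelli's theorem for integrals over balls with variable centre. -/
lemma lintegral_lintegral_ball {d : ℕ} (m : Measure (Rd d)) [SFinite m] {h : Rd d → ℝ≥0∞}
    (hh : Measurable h) (r : ℝ) :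
    ∫⁻ z, (∫⁻ x in Metric.ball z r, h x) ∂m = ∫⁻ x, m (Metric.ball x r) * h x := by
  set s : Set (Rd d × Rd d) := {q | dist q.2 q.1 < r} with hs
  have hsm : MeasurableSet s := (isOpen_lt (by fun_prop) (by fun_prop)).measurableSet
  have h1 : ∀ z, ∫⁻ x in Metric.ball z r, h x = ∫⁻ x, s.indicator (fun q => h q.2) (z, x) := by
    intro z
    rw [← lintegral_indicator measurableSet_ball]
    rfl
  simp only [h1]
  rw [lintegral_lintegral_swap (f := fun z x => s.indicator (fun q => h q.2) (z, x))
    ((hh.comp measurable_snd).indicator hsm).aemeasurable]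
  refine lintegral_congr fun x => ?_
  have h2 : ∀ z, s.indicator (fun q => h q.2) (z, x) =
      (Metric.ball x r).indicator (fun _ => h x) z := by
    intro z
    simp only [indicator, hs, mem_ofPred_eq, Metric.mem_ball, dist_comm]
  simp only [h2]
  rw [lintegral_indicator measurableSet_ball, lintegral_const, Measure.restrict_apply_univ,
    mul_comm]

lemma UpperRegular.lintegral_ball_le {d : ℕ} {m : Measure (Rd d)} {D : Set (Rd d)} {C : ℝ}
    (hm : UpperRegular m D C) {h : Rd d → ℝ≥0∞} (hh : Measurable h) {r : ℝ} (hr : 0 < r)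
    (hr1 : r ≤ 1 / 2) :
    ∫⁻ z, (∫⁻ x in Metric.ball z r, h x) ∂m ≤
      ENNReal.ofReal (C * r ^ (d - 1)) * ∫⁻ x in Metric.thickening r D, h x := by
  have := hm.isFinite
  rw [lintegral_lintegral_ball m hh, ← lintegral_const_mul' _ _ ENNReal.ofReal_ne_top,
    ← lintegral_indicator Metric.isOpen_thickening.measurableSet]
  refine lintegral_mono fun x => ?_
  by_cases hx : x ∈ Metric.thickening r D
  · rw [indicator_of_mem hx]
    gcongr
    exact hm.ball_le x r hr hr1
  · have : m (Metric.ball x r) = 0 := by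
      have hsub : Metric.ball x r ⊆ Dᶜ := fun z hz hzD => hx ?_
      · exact measure_mono_null hsub hm.compl_eq_zero
      exact Metric.mem_thickening_iff.2 ⟨z, hzD, Metric.mem_ball'.1 hz⟩
    simp [this]

/-- The weight `s² s^(-2d)` in the shell energy and the bound `C s^(2(d-1))` on the measure of balls
of radius `s²` cancel, so that a constant is integrated over `0 < s ≤ b`. -/
lemma UpperRegular.lintegral_shellEnergy_le {d : ℕ} (hd : 1 ≤ d) {m : Measure (Rd d)}
    {D : Set (Rd d)} {C : ℝ} (hm : UpperRegular m D C) {h : Rd d → ℝ≥0∞} (hh : Measurable h)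
    {b : ℝ} (hb : 0 < b) (hb1 : b ^ 2 ≤ 1 / 2) :
    ∫⁻ z, shellEnergy 0 b h z ∂m ≤
      ENNReal.ofReal (4 * C * b) * ∫⁻ x in Metric.thickening (b ^ 2) D, h x := by
  have := hm.isFinite
  set I := ∫⁻ x in Metric.thickening (b ^ 2) D, h x with hI
  unfold shellEnergy
  rw [lintegral_lintegral_swap (f := fun z s => ENNReal.ofReal (4 * s ^ 2) *
    (ENNReal.ofReal ((s ^ 2) ^ d)⁻¹ * ∫⁻ x in Metric.ball z (s ^ 2), h x))
    (measurable_shellEnergy_integrand hh).aemeasurable]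
  have h1 : ∀ s ∈ Ioc 0 b, ∫⁻ z, (ENNReal.ofReal (4 * s ^ 2) *
      (ENNReal.ofReal ((s ^ 2) ^ d)⁻¹ * ∫⁻ x in Metric.ball z (s ^ 2), h x)) ∂m ≤
      ENNReal.ofReal (4 * C) * I := by
    intro s hs
    have hs0 : 0 < s := hs.1
    have hsb : s ^ 2 ≤ b ^ 2 := by gcongr; exact hs.2
    rw [lintegral_const_mul' _ _ ENNReal.ofReal_ne_top,
      lintegral_const_mul' _ _ ENNReal.ofReal_ne_top]
    calc _ ≤ ENNReal.ofReal (4 * s ^ 2) * (ENNReal.ofReal ((s ^ 2) ^ d)⁻¹ *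
          (ENNReal.ofReal (C * (s ^ 2) ^ (d - 1)) * I)) := by
          gcongr
          refine (hm.lintegral_ball_le hh (by positivity) (hsb.trans hb1)).trans ?_
          gcongr
          exact lintegral_mono_set (Metric.thickening_mono hsb D)
      _ = ENNReal.ofReal (4 * C) * I := by
          rw [← mul_assoc, ← mul_assoc, ← ENNReal.ofReal_mul (by positivity),
            ← ENNReal.ofReal_mul (by positivity)]
          congr 2
          obtain ⟨k, rfl⟩ : ∃ k, d = k + 1 := ⟨d - 1, by omega⟩
          simp only [Nat.add_sub_cancel]
          field_simp
          ring
  refine (setLIntegral_mono' measurableSet_Ioc h1).trans (le_of_eq ?_)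
  rw [lintegral_const, Measure.restrict_apply_univ, Real.volume_Ioc, mul_comm, ← mul_assoc,
    ← ENNReal.ofReal_mul (by linarith)]
  congr 2
  ring

lemma HasWeakGradient.sub {d : ℕ} {f f' : Rd d → ℂ} {g g' : Rd d → EuclideanSpace ℂ (Fin d)}
    (h : HasWeakGradient f g) (h' : HasWeakGradient f' g') :
    HasWeakGradient (fun x => f x - f' x) (fun x => g x - g' x) where
  stronglyMeasurable := h.stronglyMeasurable.sub h'.stronglyMeasurable
  stronglyMeasurable_grad := h.stronglyMeasurable_grad.sub h'.stronglyMeasurable_grad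
  memLp := h.memLp.sub h'.memLp
  memLp_grad := h.memLp_grad.sub h'.memLp_grad
  integral_eq := by
    intro φ hφ hφc i
    have hi1 : ∀ {u : Rd d → ℂ}, MemLp u 2 →
        Integrable fun x => fderiv ℝ φ x (EuclideanSpace.single i 1) • u x := fun hu =>
      (hu.locallyIntegrable (by norm_num)).integrable_smul_left_of_hasCompactSupport
        (by have := hφ.continuous_fderiv (by simp); fun_prop) (hφc.fderiv_apply (𝕜 := ℝ) _)
    have hi2 : ∀ {v : Rd d → EuclideanSpace ℂ (Fin d)}, MemLp v 2 →
        Integrable fun x => φ x • v x i := fun hv =>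
      (((EuclideanSpace.proj i : EuclideanSpace ℂ (Fin d) →L[ℂ] ℂ).comp_memLp'
        hv).locallyIntegrable (by norm_num)).integrable_smul_left_of_hasCompactSupport
        hφ.continuous hφc
    simp only [smul_sub, PiLp.sub_apply]
    rw [integral_sub (hi1 h.memLp) (hi1 h'.memLp), integral_sub (hi2 h.memLp_grad)
      (hi2 h'.memLp_grad), h.integral_eq φ hφ hφc i, h'.integral_eq φ hφ hφc i]
    ring

/-- The maximal function of small averages is square integrable with respect to `m`; this is the
trace inequality that makes vanishing traces stable under `H¹` limits. -/
lemma UpperRegular.exists_maximal_bound {d : ℕ} (hd : 1 ≤ d) {m : Measure (Rd d)}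
    {D : Set (Rd d)} {C : ℝ} (hm : UpperRegular m D C) :
    ∃ C₁ : ℝ≥0∞, C₁ ≠ ⊤ ∧ ∀ (f : Rd d → ℂ) (g : Rd d → EuclideanSpace ℂ (Fin d)),
      HasWeakGradient f g → ∃ S : Rd d → ℝ≥0∞, Measurable S ∧
        (∀ z r, 0 < r → r ≤ 1 / 4 → ‖⨍ x in Metric.ball z r, f x‖ₑ ^ 2 ≤ S z) ∧
        ∫⁻ z, S z ∂m ≤ C₁ * ((∫⁻ x, ‖f x‖ₑ ^ 2) + ∫⁻ x, ‖g x‖ₑ ^ 2) := by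
  have := hm.isFinite
  set V := volume (Metric.ball (0 : Rd d) 1) with hV
  have hV0 : V ≠ 0 := (Metric.measure_ball_pos _ _ one_pos).ne'
  set W := volume (Metric.ball (0 : Rd d) ((1 / 2) ^ 2)) with hW
  have hW0 : W ≠ 0 := (Metric.measure_ball_pos _ _ (by norm_num)).ne'
  have hWz : ∀ z : Rd d, volume (Metric.ball z ((1 / 2) ^ 2)) = W := fun z =>
    Measure.addHaar_ball_center _ _ _
  obtain ⟨c₁, hc₁⟩ : ∃ c₁ : ℝ≥0∞, c₁ = 2 * W⁻¹ := ⟨_, rfl⟩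
  obtain ⟨c₂, hc₂⟩ : ∃ c₂ : ℝ≥0∞, c₂ = 16 * (V⁻¹ * ENNReal.ofReal (1 / 2)) := ⟨_, rfl⟩
  have hc₁t : c₁ ≠ ⊤ := by rw [hc₁]; finiteness
  have hc₂t : c₂ ≠ ⊤ := by rw [hc₂]; finiteness
  refine ⟨c₁ * ENNReal.ofReal (C * ((1 / 2) ^ 2) ^ (d - 1)) +
    c₂ * ENNReal.ofReal (4 * C * (1 / 2)), by finiteness, fun f g h => ?_⟩
  have hmf : Measurable fun x => ‖f x‖ₑ ^ 2 := h.stronglyMeasurable.measurable.enorm.pow_const 2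
  have hmg : Measurable fun x => ‖g x‖ₑ ^ 2 :=
    h.stronglyMeasurable_grad.measurable.enorm.pow_const 2
  have hm1 : Measurable fun z => ∫⁻ x in Metric.ball z ((1 / 2) ^ 2), ‖f x‖ₑ ^ 2 :=
    measurable_lintegral_ball_fixed hmf _
  have hm2 : Measurable fun z => shellEnergy 0 (1 / 2) (fun x => ‖g x‖ₑ ^ 2) z :=
    measurable_shellEnergy hmg _ _
  -- compare the average over `B(z, r)` with the one over the ball of the fixed radius `1 / 4`
  refine ⟨fun z => c₁ * (∫⁻ x in Metric.ball z ((1 / 2) ^ 2), ‖f x‖ₑ ^ 2) +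
    c₂ * shellEnergy 0 (1 / 2) (fun x => ‖g x‖ₑ ^ 2) z,
    (hm1.const_mul _).add (hm2.const_mul _), ?_, ?_⟩
  · intro z r hr hr4
    have h1 := h.average_sub_sq_le z (a := √r) (b := 1 / 2) (Real.sqrt_pos.2 hr) (by
      rw [Real.sqrt_le_left (by norm_num)]
      linarith)
    rw [Real.sq_sqrt hr.le] at h1
    have h2 := enorm_setAverage_sq_le h.stronglyMeasurable z (R := (1 / 2) ^ 2) (by norm_num)
    rw [hWz] at h2
    have h3 := enorm_sub_sq_le (⨍ x in Metric.ball z ((1 / 2) ^ 2), f x)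
      ((⨍ x in Metric.ball z ((1 / 2) ^ 2), f x) - ⨍ x in Metric.ball z r, f x)
    rw [sub_sub_cancel, mul_add] at h3
    refine h3.trans ?_
    simp only [hc₁, hc₂]
    refine add_le_add ?_ ?_
    · rw [mul_assoc]
      exact mul_le_mul' le_rfl h2
    · calc _ ≤ 2 * (8 * (V⁻¹ * (ENNReal.ofReal (1 / 2) *
            shellEnergy 0 (1 / 2) (fun x => ‖g x‖ₑ ^ 2) z))) := by
            refine mul_le_mul' le_rfl (h1.trans ?_)
            refine mul_le_mul' le_rfl (mul_le_mul' le_rfl (mul_le_mul' ?_ ?_))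
            · exact ENNReal.ofReal_le_ofReal (by linarith [Real.sqrt_nonneg r])
            · exact shellEnergy_mono_left (Real.sqrt_nonneg r) _ _
        _ = _ := by ring
  · rw [lintegral_add_left (hm1.const_mul _), lintegral_const_mul _ hm1, lintegral_const_mul _ hm2,
      add_mul, mul_assoc, mul_assoc]
    refine add_le_add (mul_le_mul' le_rfl ?_) (mul_le_mul' le_rfl ?_)
    · refine (hm.lintegral_ball_le hmf (by norm_num) (by norm_num)).trans ?_
      exact mul_le_mul' le_rfl ((setLIntegral_le_lintegral _ _).trans le_self_add)
    · refine (hm.lintegral_shellEnergy_le hd hmg (by norm_num) (by norm_num)).trans ?_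
      exact mul_le_mul' le_rfl ((setLIntegral_le_lintegral _ _).trans le_add_self)

/-- Vanishing of the trace `m`-almost everywhere is preserved under limits in `H¹(ℝ^d)`. -/
lemma UpperRegular.ae_hasTraceAt_zero_of_approx {d : ℕ} (hd : 1 ≤ d) {m : Measure (Rd d)}
    {D : Set (Rd d)} {C : ℝ} (hm : UpperRegular m D C) {f : Rd d → ℂ}
    {g : Rd d → EuclideanSpace ℂ (Fin d)} (h : HasWeakGradient f g)
    (happ : ∀ ε : ℝ≥0∞, 0 < ε → ∃ f' g', HasWeakGradient f' g' ∧
      (∫⁻ x, ‖f x - f' x‖ₑ ^ 2) + (∫⁻ x, ‖g x - g' x‖ₑ ^ 2) ≤ ε ∧ ∀ᵐ z ∂m, HasTraceAt f' z 0) :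
    ∀ᵐ z ∂m, HasTraceAt f z 0 := by
  have := hm.isFinite
  obtain ⟨C₁, hC₁, hmax⟩ := hm.exists_maximal_bound hd
  have hpos : ∀ n : ℕ, (0 : ℝ≥0∞) < ((n : ℝ≥0∞) + 1)⁻¹ := fun n =>
    ENNReal.inv_pos.2 (by finiteness)
  choose f' g' hfg' hε htr using fun n : ℕ => happ _ (hpos n)
  choose S hS hSz hSi using fun n => hmax _ _ (h.sub (hfg' n))
  -- the maximal functions `S n` of `f - f' n` tend to zero in the mean
  have hS0 : ∀ᵐ z ∂m, ⨅ n, S n z = 0 := by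
    have h1 : ∫⁻ z, ⨅ n, S n z ∂m ≤ 0 := by
      refine le_of_forall_le_add_mul hC₁ fun ε hε0 => ?_
      obtain ⟨n, hn⟩ := ENNReal.exists_inv_nat_lt hε0.ne'
      calc ∫⁻ z, ⨅ n, S n z ∂m ≤ ∫⁻ z, S n z ∂m := lintegral_mono fun z => iInf_le _ n
        _ ≤ C₁ * ((n : ℝ≥0∞) + 1)⁻¹ := (hSi n).trans (by gcongr; exact hε n)
        _ ≤ C₁ * ε := by
            gcongr
            exact (ENNReal.inv_le_inv.2 le_self_add).trans hn.le
        _ ≤ _ := le_add_self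
    exact (lintegral_eq_zero_iff (Measurable.iInf hS)).1 (le_antisymm h1 zero_le)
  filter_upwards [hS0, ae_all_iff.2 htr] with z hz htrz
  have hav : Tendsto (fun r : ℝ => ‖⨍ x in Metric.ball z r, f x‖ₑ ^ 2) (𝓝[>] 0) (𝓝 0) := by
    refine ENNReal.tendsto_nhds_zero.2 fun ε hε => ?_
    have hε4 : 0 < ε / 4 := ENNReal.div_pos hε.ne' (by norm_num)
    obtain ⟨n, hn⟩ := iInf_lt_iff.1 (hz.symm ▸ hε4 : ⨅ n, S n z < ε / 4)
    have h1 : Tendsto (fun r : ℝ => ‖⨍ x in Metric.ball z r, f' n x‖ₑ ^ 2) (𝓝[>] 0) (𝓝 0) := by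
      have := ((ENNReal.continuous_pow 2).comp continuous_enorm).tendsto (0 : ℂ) |>.comp (htrz n)
      simpa [Function.comp_def] using this
    have hr4 : ∀ᶠ r : ℝ in 𝓝[>] 0, r ≤ 1 / 4 :=
      (eventually_le_nhds (by norm_num : (0 : ℝ) < 1 / 4)).filter_mono nhdsWithin_le_nhds
    filter_upwards [ENNReal.tendsto_nhds_zero.1 h1 _ hε4, hr4, eventually_mem_nhdsWithin]
      with r hr1 hr4 hr0
    have hloc : ∀ {u : Rd d → ℂ}, MemLp u 2 → IntegrableOn u (Metric.ball z r) := fun hu =>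
      ((hu.locallyIntegrable (by norm_num)).integrableOn_isCompact
        (isCompact_closedBall z r)).mono_set Metric.ball_subset_closedBall
    have h2 : ⨍ x in Metric.ball z r, f x = (⨍ x in Metric.ball z r, f' n x) +
        ⨍ x in Metric.ball z r, (f x - f' n x) := by
      simp only [setAverage_eq]
      rw [integral_sub (hloc h.memLp) (hloc (hfg' n).memLp), smul_sub]
      ring
    rw [h2]
    calc _ ≤ 2 * (ε / 4 + ε / 4) := by
          refine (enorm_add_sq_le _ _).trans ?_
          gcongr
          exact (hSz n z r hr0 hr4).trans hn.le
      _ = ε := by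
          rw [← two_mul, ← mul_assoc, show (2 : ℝ≥0∞) * 2 = 4 by norm_num,
            ENNReal.mul_div_cancel (by norm_num) (by norm_num)]
  unfold HasTraceAt
  rw [tendsto_zero_iff_norm_tendsto_zero]
  have h5 := ((ENNReal.continuous_rpow_const (y := 1 / 2)).tendsto 0).comp hav
  have h6 := (ENNReal.tendsto_toReal (by simp)).comp h5
  simp only [Function.comp_def, ← ENNReal.rpow_natCast, ← ENNReal.rpow_mul] at h6
  norm_num at h6
  exact h6

/-- A Hardy type inequality: if the trace of `f` vanishes on a `(d-1)`-regular set `D`, then `f` is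
small near `D` in the mean. The radius is written as `b²`, in accordance with the parametrisation in
`shellEnergy`. -/
lemma UpperRegular.exists_lintegral_thickening_le {d : ℕ} (hd : 1 ≤ d) {m : Measure (Rd d)}
    {D : Set (Rd d)} {C : ℝ} (hm : UpperRegular m D C) {c : ℝ} (hc : 0 < c)
    (hlow : ∀ z ∈ D, ∀ r : ℝ, 0 < r → r ≤ 1 →
      ENNReal.ofReal (c * r ^ (d - 1)) ≤ m (Metric.ball z r)) :
    ∃ K : ℝ, 0 ≤ K ∧ ∀ (f : Rd d → ℂ) (g : Rd d → EuclideanSpace ℂ (Fin d)),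
      HasWeakGradient f g → (∀ᵐ z ∂m, HasTraceAt f z 0) → ∀ b : ℝ, 0 < b → b ^ 2 ≤ 1 / 2 →
        ∫⁻ x in Metric.thickening (b ^ 2 / 2) D, ‖f x‖ₑ ^ 2 ≤
          ENNReal.ofReal (K * (b ^ 2) ^ 2) *
            ∫⁻ x in Metric.thickening (b ^ 2) D, ‖g x‖ₑ ^ 2 := by
  have := hm.isFinite
  have hC := hm.nonneg
  set V := volume (Metric.ball (0 : Rd d) 1) with hV
  have hV0 : V ≠ 0 := (Metric.measure_ball_pos _ _ one_pos).ne'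
  have hVt : V ≠ ⊤ := measure_ball_lt_top.ne
  refine ⟨(8 * 2 ^ (d + 2) * C + 256 * C) * 2 ^ (d - 1) / c, by positivity,
    fun f g h htr b hb hb1 => ?_⟩
  set R := b ^ 2 with hR
  have hR0 : 0 < R := by positivity
  have hmf : Measurable fun x => ‖f x‖ₑ ^ 2 := h.stronglyMeasurable.measurable.enorm.pow_const 2
  have hmg : Measurable fun x => ‖g x‖ₑ ^ 2 :=
    h.stronglyMeasurable_grad.measurable.enorm.pow_const 2
  set I := ∫⁻ x in Metric.thickening R D, ‖g x‖ₑ ^ 2 with hI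
  have hball : ∀ z : Rd d, volume (Metric.ball z R) = ENNReal.ofReal (R ^ d) * V := fun z => by
    rw [Measure.addHaar_ball_of_pos _ _ hR0, finrank_euclideanSpace, Fintype.card_fin]
  -- the averages over `B(z, R)` are bounded by letting the smaller radius tend to zero
  have h1 : ∀ᵐ z ∂m, ∫⁻ x in Metric.ball z R, ‖f x‖ₑ ^ 2 ≤
      8 * (ENNReal.ofReal (2 ^ (d + 2) * R ^ 2) * ∫⁻ x in Metric.ball z R, ‖g x‖ₑ ^ 2) +
      ENNReal.ofReal (64 * R ^ d * b) * shellEnergy 0 b (fun x => ‖g x‖ₑ ^ 2) z := by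
    filter_upwards [htr] with z hz
    have h2 : ‖⨍ x in Metric.ball z R, f x‖ₑ ^ 2 ≤ 8 * (V⁻¹ *
        (ENNReal.ofReal b * shellEnergy 0 b (fun x => ‖g x‖ₑ ^ 2) z)) := by
      have ht : Tendsto (fun r : ℝ => ‖(⨍ x in Metric.ball z R, f x) -
          ⨍ x in Metric.ball z r, f x‖ₑ ^ 2) (𝓝[>] 0) (𝓝 (‖⨍ x in Metric.ball z R, f x‖ₑ ^ 2)) := by
        have := ((ENNReal.continuous_pow 2).comp continuous_enorm).tendsto _ |>.comp
          (tendsto_const_nhds (x := ⨍ x in Metric.ball z R, f x) |>.sub hz)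
        simpa [Function.comp_def] using this
      refine le_of_tendsto ht ?_
      have hrR : ∀ᶠ r : ℝ in 𝓝[>] 0, r ≤ R :=
        (eventually_le_nhds hR0).filter_mono nhdsWithin_le_nhds
      filter_upwards [hrR, eventually_mem_nhdsWithin] with r hrR hr0
      have hr0 : 0 < r := hr0
      have h3 := h.average_sub_sq_le z (a := √r) (b := b) (Real.sqrt_pos.2 hr0)
        (by rwa [Real.sqrt_le_left hb.le])
      rw [Real.sq_sqrt hr0.le] at h3
      refine h3.trans ?_
      gcongr
      · linarith [Real.sqrt_nonneg r]
      · exact shellEnergy_mono_left (Real.sqrt_nonneg r) _ _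
    refine (h.lintegral_ball_le z hR0).trans ?_
    refine add_le_add le_rfl ?_
    calc _ ≤ 8 * (ENNReal.ofReal (R ^ d) * V * (8 * (V⁻¹ *
          (ENNReal.ofReal b * shellEnergy 0 b (fun x => ‖g x‖ₑ ^ 2) z)))) := by
          rw [hball]
          exact mul_le_mul' le_rfl (mul_le_mul' le_rfl h2)
      _ = (V * V⁻¹) * (64 * ENNReal.ofReal (R ^ d) * ENNReal.ofReal b *
          shellEnergy 0 b (fun x => ‖g x‖ₑ ^ 2) z) := by ring
      _ = _ := by
          rw [ENNReal.mul_inv_cancel hV0 hVt, one_mul, ENNReal.ofReal_mul (by positivity),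
            ENNReal.ofReal_mul (by norm_num), show ENNReal.ofReal 64 = 64 by norm_num]
  -- the upper bound on `m` controls the integral of this estimate over `D`
  have hup : ∫⁻ z, (∫⁻ x in Metric.ball z R, ‖f x‖ₑ ^ 2) ∂m ≤
      ENNReal.ofReal ((8 * 2 ^ (d + 2) * C + 256 * C) * (R ^ (d - 1) * R ^ 2)) * I := by
    have hm1 : Measurable fun z => ∫⁻ x in Metric.ball z R, ‖g x‖ₑ ^ 2 :=
      measurable_lintegral_ball_fixed hmg R
    refine (lintegral_mono_ae h1).trans ?_
    have hm2 : Measurable fun z => shellEnergy 0 b (fun x => ‖g x‖ₑ ^ 2) z :=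
      measurable_shellEnergy hmg _ _
    rw [lintegral_add_left ((hm1.const_mul _).const_mul _), lintegral_const_mul _ (hm1.const_mul _),
      lintegral_const_mul _ hm1, lintegral_const_mul _ hm2]
    calc _ ≤ 8 * (ENNReal.ofReal (2 ^ (d + 2) * R ^ 2) * (ENNReal.ofReal (C * R ^ (d - 1)) * I)) +
          ENNReal.ofReal (64 * R ^ d * b) * (ENNReal.ofReal (4 * C * b) * I) := by
          exact add_le_add (mul_le_mul' le_rfl (mul_le_mul' le_rfl
            (hm.lintegral_ball_le hmg hR0 hb1)))
            (mul_le_mul' le_rfl (hm.lintegral_shellEnergy_le hd hmg hb hb1))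
      _ = (ENNReal.ofReal (8 * (2 ^ (d + 2) * R ^ 2 * (C * R ^ (d - 1)))) +
          ENNReal.ofReal (64 * R ^ d * b * (4 * C * b))) * I := by
          rw [ENNReal.ofReal_mul (by norm_num : (0 : ℝ) ≤ 8),
            ENNReal.ofReal_mul (by positivity : (0 : ℝ) ≤ 2 ^ (d + 2) * R ^ 2),
            ENNReal.ofReal_mul (by positivity : (0 : ℝ) ≤ 64 * R ^ d * b),
            show ENNReal.ofReal 8 = 8 by norm_num]
          ring
      _ = _ := by
          rw [← ENNReal.ofReal_add (by positivity) (by positivity)]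
          congr 2
          obtain ⟨k, rfl⟩ : ∃ k, d = k + 1 := ⟨d - 1, by omega⟩
          simp only [Nat.add_sub_cancel, hR]
          ring
  -- by the lower bound on `m`, each point near `D` lies in sufficiently many of the balls
  have hlo : ENNReal.ofReal (c * (R / 2) ^ (d - 1)) *
      ∫⁻ x in Metric.thickening (R / 2) D, ‖f x‖ₑ ^ 2 ≤
      ∫⁻ z, (∫⁻ x in Metric.ball z R, ‖f x‖ₑ ^ 2) ∂m := by
    rw [lintegral_lintegral_ball m hmf, ← lintegral_const_mul' _ _ ENNReal.ofReal_ne_top,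
      ← lintegral_indicator Metric.isOpen_thickening.measurableSet]
    refine lintegral_mono fun x => ?_
    by_cases hx : x ∈ Metric.thickening (R / 2) D
    · rw [indicator_of_mem hx]
      gcongr
      obtain ⟨z, hzD, hz⟩ := Metric.mem_thickening_iff.1 hx
      refine (hlow z hzD (R / 2) (by positivity) (by linarith)).trans (measure_mono ?_)
      refine Metric.ball_subset_ball' ?_
      rw [dist_comm]
      linarith
    · simp [indicator_of_notMem hx]
  have hcp : 0 < c * (R / 2) ^ (d - 1) := by positivity
  have hfin := hlo.trans hup
  rw [mul_comm, ← ENNReal.le_div_iff_mul_le (Or.inl (by simpa using hcp))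
    (Or.inl ENNReal.ofReal_ne_top), mul_comm, mul_div_assoc,
    ← ENNReal.ofReal_div_of_pos hcp] at hfin
  refine hfin.trans (le_of_eq ?_)
  rw [mul_comm]
  congr 2
  rw [div_pow]
  field_simp

/-! ### Approximation by smooth functions vanishing near `D` -/

lemma exists_cutoff {d : ℕ} (D : Set (Rd d)) {R : ℝ} (hR : 0 < R) :
    ∃ η : Rd d → ℝ, LipschitzWith (R / 2).toNNReal⁻¹ η ∧ (∀ x, 0 ≤ η x) ∧ (∀ x, η x ≤ 1) ∧
      (∀ x ∈ Metric.thickening (R / 2) D, η x = 0) ∧ ∀ x ∉ Metric.thickening R D, η x = 1 := by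
  have hR2 : 0 < R / 2 := by positivity
  set θ := thickenedIndicator hR2 (Metric.thickening (R / 2) D) with hθ
  have hθ1 : ∀ x, (θ x : ℝ) ≤ 1 := fun x => by
    exact_mod_cast thickenedIndicator_le_one hR2 (Metric.thickening (R / 2) D) x
  refine ⟨fun x => 1 - θ x, LipschitzWith.of_dist_le_mul fun x y => ?_, fun x => ?_, fun x => ?_,
    fun x hx => ?_, fun x hx => ?_⟩
  · have := (lipschitzWith_thickenedIndicator hR2 (Metric.thickening (R / 2) D)).dist_le_mul x y
    rw [dist_sub_left]
    exact this
  · linarith [hθ1 x]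
  · show 1 - (θ x : ℝ) ≤ 1
    linarith [(θ x).coe_nonneg]
  · have : θ x = 1 := thickenedIndicator_one hR2 _ hx
    simp [this]
  · have : θ x = 0 := thickenedIndicator_zero hR2 _ fun h => hx (by
      have := Metric.thickening_thickening_subset (R / 2) (R / 2) D h
      rwa [add_halves] at this)
    simp [this]

lemma exists_lipschitzWith_smul {d : ℕ} {η : Rd d → ℝ} {ψ : Rd d → ℂ} {K K' : ℝ≥0}
    (hη : LipschitzWith K η) (hη1 : ∀ x, |η x| ≤ 1) (hψ : LipschitzWith K' ψ)
    (hc : HasCompactSupport ψ) : ∃ K'' : ℝ≥0, LipschitzWith K'' fun x => η x • ψ x := by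
  obtain ⟨M, hM⟩ := hψ.continuous.bounded_above_of_compact_support hc
  have hM0 : 0 ≤ M := (norm_nonneg _).trans (hM 0)
  refine ⟨K' + K * M.toNNReal, LipschitzWith.of_dist_le_mul fun x y => ?_⟩
  have h1 := hη.dist_le_mul x y
  have h2 := hψ.dist_le_mul x y
  have e : η x • ψ x - η y • ψ y = η x • (ψ x - ψ y) + (η x - η y) • ψ y := by
    rw [smul_sub, sub_smul]
    abel
  rw [dist_eq_norm] at h1 h2 ⊢
  rw [e]
  calc _ ≤ |η x| * ‖ψ x - ψ y‖ + ‖η x - η y‖ * ‖ψ y‖ := by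
        refine (norm_add_le _ _).trans ?_
        rw [norm_smul, norm_smul, Real.norm_eq_abs]
    _ ≤ 1 * (K' * dist x y) + (K * dist x y) * M := by
        gcongr
        · exact hη1 x
        · exact hM y
    _ = _ := by
        push_cast
        rw [Real.coe_toNNReal _ hM0]
        ring

/-- The integrals of an integrable function over shrinking neighbourhoods of a closed null set tend
to zero. -/
lemma tendsto_lintegral_thickening {d : ℕ} {D : Set (Rd d)} (hD : IsClosed D)
    (hD0 : volume D = 0) {h : Rd d → ℝ≥0∞} (hh : ∫⁻ x, h x < ⊤) :
    Tendsto (fun r : ℝ => ∫⁻ x in Metric.thickening r D, h x) (𝓝[>] 0) (𝓝 0) := by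
  set ν := (volume : Measure (Rd d)).withDensity h with hν
  have h1 : ∀ r : ℝ, ∫⁻ x in Metric.thickening r D, h x = ν (Metric.thickening r D) := fun r => by
    rw [hν, withDensity_apply _ Metric.isOpen_thickening.measurableSet]
  simp only [h1]
  have h2 : ν D = 0 := by
    rw [hν, withDensity_apply _ hD.measurableSet]
    exact setLIntegral_measure_zero _ _ hD0
  rw [← h2]
  refine tendsto_measure_thickening_of_isClosed ⟨1, one_pos, ?_⟩ hD
  rw [← h1]
  exact ((setLIntegral_le_lintegral _ _).trans_lt hh).ne

lemma exists_smooth_eq_one_on {d : ℕ} {Ω : Set (Rd d)} (hΩ : Bornology.IsBounded Ω) :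
    ∃ χ : Rd d → ℝ, ContDiff ℝ ∞ χ ∧ HasCompactSupport χ ∧ ∀ x ∈ Ω, χ =ᶠ[𝓝 x] 1 := by
  obtain ⟨r, hr⟩ := hΩ.subset_ball (0 : Rd d)
  let φ : ContDiffBump (0 : Rd d) := ⟨|r| + 1, |r| + 2, by positivity, by linarith⟩
  refine ⟨φ, φ.contDiff, φ.hasCompactSupport, fun x hx => ?_⟩
  refine φ.eventuallyEq_one_of_mem_ball ?_
  have := Metric.mem_ball.1 (hr hx)
  exact Metric.mem_ball.2 (by show dist x 0 < |r| + 1; linarith [le_abs_self r])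

/-- Multiplication by a cutoff function at distance `R` from `D`. The error is governed by `f / R`
and `g` near `D`. -/
lemma HasWeakGradient.exists_lipschitz_approx {d : ℕ} {f : Rd d → ℂ}
    {g : Rd d → EuclideanSpace ℂ (Fin d)} (h : HasWeakGradient f g) {Ω D : Set (Rd d)}
    (hΩ : IsOpen Ω) (hΩb : Bornology.IsBounded Ω) {R : ℝ} (hR : 0 < R) {ε : ℝ≥0∞} (hε : 0 < ε) :
    ∃ w : Rd d → ℂ, (∃ K, LipschitzWith K w) ∧ HasCompactSupport w ∧
      (∀ x ∈ Metric.thickening (R / 2) D, w x = 0) ∧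
      ∫⁻ x in Ω, ‖f x - w x‖ₑ ^ 2 ≤
        6 * ε + 4 * ∫⁻ x in Metric.thickening R D, ‖f x‖ₑ ^ 2 ∧
      ∫⁻ x in Ω, ‖g x - cgrad w x‖ₑ ^ 2 ≤
        12 * ε + 8 * (∫⁻ x in Metric.thickening R D, ‖g x‖ₑ ^ 2) +
        ENNReal.ofReal (32 * d / R ^ 2) * ((∫⁻ x in Metric.thickening R D, ‖f x‖ₑ ^ 2) + ε) := by
  obtain ⟨φ, hφ, -, hfφ, hgφ⟩ := h.exists_contDiff hε one_pos
  obtain ⟨η, hηL, hη0, hη1, hηD, hηc⟩ := exists_cutoff D hR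
  obtain ⟨χ, hχ, hχc, hχ1⟩ := exists_smooth_eq_one_on hΩb
  set ψ : Rd d → ℂ := fun x => χ x • φ x with hψ
  have hψs : ContDiff ℝ ∞ ψ := hχ.smul hφ
  have hψc : HasCompactSupport ψ := hχc.smul_right
  obtain ⟨Kψ, hKψ⟩ := hψs.lipschitzWith_of_hasCompactSupport hψc (by simp)
  set T := Metric.thickening R D with hT
  have hTm : MeasurableSet T := Metric.isOpen_thickening.measurableSet
  have hψφ : ∀ x ∈ Ω, ψ =ᶠ[𝓝 x] φ := fun x hx => by
    filter_upwards [hχ1 x hx] with y hy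
    simp [hψ, hy]
  have hmf : Measurable fun x => ‖f x‖ₑ ^ 2 := h.stronglyMeasurable.measurable.enorm.pow_const 2
  have hmg : Measurable fun x => ‖g x‖ₑ ^ 2 :=
    h.stronglyMeasurable_grad.measurable.enorm.pow_const 2
  have hmfφ : Measurable fun x => ‖f x - φ x‖ₑ ^ 2 :=
    (h.stronglyMeasurable.sub hφ.continuous.stronglyMeasurable).measurable.enorm.pow_const 2
  have hmgφ : Measurable fun x => ‖g x - cgrad φ x‖ₑ ^ 2 :=
    (h.stronglyMeasurable_grad.sub (measurable_cgrad
      φ).stronglyMeasurable).measurable.enorm.pow_const 2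
  have h2t : (2 : ℝ≥0∞) ≠ ⊤ := ENNReal.ofNat_ne_top
  have h4t : (4 : ℝ≥0∞) ≠ ⊤ := ENNReal.ofNat_ne_top
  have hη1' : ∀ x, ‖1 - η x‖ₑ ≤ 1 := fun x => by
    rw [← ofReal_norm, Real.norm_of_nonneg (by linarith [hη1 x])]
    exact ENNReal.ofReal_le_one.2 (by linarith [hη0 x])
  have hsq : ∀ {F : Type} [NormedAddCommGroup F] [NormedSpace ℝ F] (u v : Rd d → F) (x : Rd d),
      ‖(1 - η x) • v x‖ₑ ^ 2 ≤
        T.indicator (fun y => 2 * (‖u y‖ₑ ^ 2 + ‖u y - v y‖ₑ ^ 2)) x := by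
    intro F _ _ u v x
    by_cases hx : x ∈ T
    · rw [indicator_of_mem hx]
      calc ‖(1 - η x) • v x‖ₑ ^ 2 ≤ (1 * ‖v x‖ₑ) ^ 2 := by
            rw [enorm_smul]
            gcongr
            exact hη1' x
        _ ≤ _ := by
            have := enorm_sub_sq_le (u x) (u x - v x)
            rwa [sub_sub_cancel, ← one_mul ‖v x‖ₑ] at this
    · simp [hηc x hx]
  have hwL : ∃ K, LipschitzWith K fun x => η x • ψ x := exists_lipschitzWith_smul hηL
    (fun x => by rw [abs_of_nonneg (hη0 x)]; exact hη1 x) hKψ hψc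
  have hwc : HasCompactSupport fun x => η x • ψ x := hψc.mono fun x hx h0 => hx (by simp [h0])
  have hw0 : ∀ x ∈ Metric.thickening (R / 2) D, η x • ψ x = 0 := fun x hx => by
    rw [hηD x hx, zero_smul]
  refine ⟨fun x => η x • ψ x, hwL, hwc, hw0, ?_, ?_⟩
  · calc ∫⁻ x in Ω, ‖f x - η x • ψ x‖ₑ ^ 2
        ≤ ∫⁻ x in Ω, (2 * ‖f x - φ x‖ₑ ^ 2 +
          2 * T.indicator (fun x => 2 * (‖f x‖ₑ ^ 2 + ‖f x - φ x‖ₑ ^ 2)) x) := by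
          refine setLIntegral_mono' hΩ.measurableSet fun x hx => ?_
          have e : f x - η x • ψ x = (f x - φ x) + (1 - η x) • φ x := by
            rw [(hψφ x hx).self_of_nhds, sub_smul, one_smul]
            abel
          rw [e, ← mul_add]
          refine (enorm_add_sq_le _ _).trans ?_
          gcongr
          exact hsq f φ x
      _ ≤ ∫⁻ x, (2 * ‖f x - φ x‖ₑ ^ 2 +
          2 * T.indicator (fun x => 2 * (‖f x‖ₑ ^ 2 + ‖f x - φ x‖ₑ ^ 2)) x) :=
          setLIntegral_le_lintegral _ _
      _ = 2 * (∫⁻ x, ‖f x - φ x‖ₑ ^ 2) +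
          2 * (2 * ((∫⁻ x in T, ‖f x‖ₑ ^ 2) + ∫⁻ x in T, ‖f x - φ x‖ₑ ^ 2)) := by
          rw [lintegral_add_left (hmfφ.const_mul _), lintegral_const_mul' _ _ h2t,
            lintegral_const_mul' _ _ h2t, lintegral_indicator hTm,
            lintegral_const_mul' _ _ h2t, lintegral_add_left hmf]
      _ ≤ 2 * ε + 2 * (2 * ((∫⁻ x in T, ‖f x‖ₑ ^ 2) + ε)) := by
          gcongr
          exact (setLIntegral_le_lintegral _ _).trans hfφ
      _ = _ := by ring
  · have hdη : ∀ᵐ x ∂(volume.restrict Ω), DifferentiableAt ℝ η x :=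
      ae_restrict_of_ae hηL.ae_differentiableAt
    have hmem : ∀ᵐ x ∂(volume.restrict Ω), x ∈ Ω := ae_restrict_mem hΩ.measurableSet
    set c : ℝ≥0∞ := ENNReal.ofReal (4 * d / R ^ 2) with hc
    have hct : c ≠ ⊤ := ENNReal.ofReal_ne_top
    have hrest : ∀ x ∈ Ω, DifferentiableAt ℝ η x →
        ‖cgrad (fun y => η y • ψ y) x - η x • cgrad φ x‖ₑ ^ 2 ≤
        T.indicator (fun x => c * (2 * (‖f x‖ₑ ^ 2 + ‖f x - φ x‖ₑ ^ 2))) x := by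
      intro x hx hd
      have h1 := norm_cgrad_smul_le hd ((hψs.differentiable (by simp)) x)
      have h2 : cgrad ψ x = cgrad φ x := by
        unfold cgrad
        rw [(hψφ x hx).fderiv_eq]
      rw [h2, (hψφ x hx).self_of_nhds] at h1
      by_cases hxT : x ∈ T
      · rw [indicator_of_mem hxT]
        have h3 : ‖fderiv ℝ η x‖ ≤ 2 / R := by
          refine (norm_fderiv_le_of_lipschitz ℝ hηL).trans (le_of_eq ?_)
          rw [NNReal.coe_inv, Real.coe_toNNReal _ (by positivity), inv_div]
        have h4 : ‖cgrad (fun y => η y • ψ y) x - η x • cgrad φ x‖ₑ ^ 2 ≤ c * ‖φ x‖ₑ ^ 2 := by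
          rw [hc, ← ofReal_norm, ← ofReal_norm, ← ENNReal.ofReal_pow (norm_nonneg _),
            ← ENNReal.ofReal_pow (norm_nonneg _), ← ENNReal.ofReal_mul (by positivity)]
          refine ENNReal.ofReal_le_ofReal ?_
          calc _ ≤ (√d * (2 / R) * ‖φ x‖) ^ 2 := by
                gcongr
                refine h1.trans ?_
                gcongr
            _ = _ := by
                rw [mul_pow, mul_pow, Real.sq_sqrt (Nat.cast_nonneg d)]
                ring
        refine h4.trans ?_
        gcongr
        have := enorm_sub_sq_le (f x) (f x - φ x)
        rwa [sub_sub_cancel] at this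
      · -- off the thickening, `η` attains its maximum `1`
        have h3 : fderiv ℝ η x = 0 := by
          refine IsLocalMax.fderiv_eq_zero (Eventually.of_forall fun y => ?_)
          rw [hηc x hxT]
          exact hη1 y
        rw [h3, norm_zero, mul_zero, zero_mul] at h1
        rw [norm_le_zero_iff.1 h1]
        simp
    have hm₁ : Measurable fun x => 2 * (‖g x‖ₑ ^ 2 + ‖g x - cgrad φ x‖ₑ ^ 2) :=
      (hmg.add hmgφ).const_mul 2
    have hm₂ : Measurable fun x => ‖g x - cgrad φ x‖ₑ ^ 2 +
        T.indicator (fun x => 2 * (‖g x‖ₑ ^ 2 + ‖g x - cgrad φ x‖ₑ ^ 2)) x :=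
      hmgφ.add (hm₁.indicator hTm)
    calc ∫⁻ x in Ω, ‖g x - cgrad (fun y => η y • ψ y) x‖ₑ ^ 2
        ≤ ∫⁻ x in Ω, 4 * (‖g x - cgrad φ x‖ₑ ^ 2 +
          T.indicator (fun x => 2 * (‖g x‖ₑ ^ 2 + ‖g x - cgrad φ x‖ₑ ^ 2)) x +
          T.indicator (fun x => c * (2 * (‖f x‖ₑ ^ 2 + ‖f x - φ x‖ₑ ^ 2))) x) := by
          refine lintegral_mono_ae ?_
          filter_upwards [hdη, hmem] with x hxd hxΩ
          have e : g x - cgrad (fun y => η y • ψ y) x = (g x - cgrad φ x) +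
              (1 - η x) • cgrad φ x - (cgrad (fun y => η y • ψ y) x - η x • cgrad φ x) := by
            rw [sub_smul, one_smul]
            abel
          rw [e]
          calc _ ≤ (‖g x - cgrad φ x‖ₑ + ‖(1 - η x) • cgrad φ x‖ₑ +
                ‖cgrad (fun y => η y • ψ y) x - η x • cgrad φ x‖ₑ) ^ 2 := by
                gcongr
                refine enorm_sub_le.trans ?_
                gcongr
                exact enorm_add_le _ _
            _ ≤ _ := by
                refine (add_sq_le_three _ _ _).trans ?_
                gcongr
                · exact hsq g (cgrad φ) x
                · exact hrest x hxΩ hxd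
      _ ≤ ∫⁻ x, 4 * (‖g x - cgrad φ x‖ₑ ^ 2 +
          T.indicator (fun x => 2 * (‖g x‖ₑ ^ 2 + ‖g x - cgrad φ x‖ₑ ^ 2)) x +
          T.indicator (fun x => c * (2 * (‖f x‖ₑ ^ 2 + ‖f x - φ x‖ₑ ^ 2))) x) :=
          setLIntegral_le_lintegral _ _
      _ = 4 * ((∫⁻ x, ‖g x - cgrad φ x‖ₑ ^ 2) +
          2 * ((∫⁻ x in T, ‖g x‖ₑ ^ 2) + ∫⁻ x in T, ‖g x - cgrad φ x‖ₑ ^ 2) +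
          c * (2 * ((∫⁻ x in T, ‖f x‖ₑ ^ 2) + ∫⁻ x in T, ‖f x - φ x‖ₑ ^ 2))) := by
          rw [lintegral_const_mul' _ _ h4t, lintegral_add_left hm₂, lintegral_add_left hmgφ,
            lintegral_indicator hTm, lintegral_indicator hTm, lintegral_const_mul' _ _ h2t,
            lintegral_const_mul' _ _ hct, lintegral_const_mul' _ _ h2t,
            lintegral_add_left hmf, lintegral_add_left hmg]
      _ ≤ 4 * (ε + 2 * ((∫⁻ x in T, ‖g x‖ₑ ^ 2) + ε) +
          c * (2 * ((∫⁻ x in T, ‖f x‖ₑ ^ 2) + ε))) := by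
          gcongr
          · exact (setLIntegral_le_lintegral _ _).trans hgφ
          · exact (setLIntegral_le_lintegral _ _).trans hfφ
      _ = _ := by
          have : ENNReal.ofReal (32 * d / R ^ 2) = 8 * c := by
            rw [hc, show (8 : ℝ≥0∞) = ENNReal.ofReal 8 by norm_num,
              ← ENNReal.ofReal_mul (by norm_num)]
            congr 1
            ring
          rw [this]
          ring

lemma lintegral_enorm_sub_sq_le {d : ℕ} {F : Type*} [NormedAddCommGroup F] {ν : Measure (Rd d)}
    {u v w : Rd d → F} (hu : StronglyMeasurable u) (hw : StronglyMeasurable w) :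
    ∫⁻ x, ‖u x - v x‖ₑ ^ 2 ∂ν ≤
      2 * (∫⁻ x, ‖u x - w x‖ₑ ^ 2 ∂ν) + 2 * ∫⁻ x, ‖w x - v x‖ₑ ^ 2 ∂ν := by
  have hm : Measurable fun x => 2 * ‖u x - w x‖ₑ ^ 2 := ((hu.sub hw).enorm.pow_const 2).const_mul 2
  rw [← lintegral_const_mul' _ _ ENNReal.ofNat_ne_top, ← lintegral_const_mul' _ _
    ENNReal.ofNat_ne_top, ← lintegral_add_left hm]
  refine lintegral_mono fun x => ?_
  have := enorm_add_sq_le (u x - w x) (w x - v x)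
  rwa [sub_add_sub_cancel, mul_add] at this

/-- An `H¹` function obeying the Hardy type inequality near `D` is approximated in `H¹(Ω)` by test
functions whose supports keep a positive distance to `D`. -/
lemma HasWeakGradient.exists_testFunction_approx {d : ℕ} {f : Rd d → ℂ}
    {g : Rd d → EuclideanSpace ℂ (Fin d)} (h : HasWeakGradient f g) {Ω D : Set (Rd d)}
    (hΩ : IsOpen Ω) (hΩb : Bornology.IsBounded Ω) (hD : IsClosed D) (hD0 : volume D = 0)
    {K : ℝ} (hK : 0 ≤ K) (hardy : ∀ b : ℝ, 0 < b → b ^ 2 ≤ 1 / 2 →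
      ∫⁻ x in Metric.thickening (b ^ 2 / 2) D, ‖f x‖ₑ ^ 2 ≤
        ENNReal.ofReal (K * (b ^ 2) ^ 2) * ∫⁻ x in Metric.thickening (b ^ 2) D, ‖g x‖ₑ ^ 2)
    {ε : ℝ≥0∞} (hε : 0 < ε) :
    ∃ φ : Rd d → ℂ, ContDiff ℝ ∞ φ ∧ HasCompactSupport φ ∧
      (∃ δ : ℝ, 0 < δ ∧ ∀ x ∈ tsupport φ, ∀ y ∈ D, δ ≤ dist x y) ∧
      ∫⁻ x in Ω, ‖f x - φ x‖ₑ ^ 2 ≤ ε ∧ ∫⁻ x in Ω, ‖g x - cgrad φ x‖ₑ ^ 2 ≤ ε := by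
  set J : ℝ → ℝ≥0∞ := fun r => ∫⁻ x in Metric.thickening r D, ‖g x‖ₑ ^ 2 with hJ
  -- `M` collects the constants in front of the energy near `D`, and `N` those in front of the
  -- error `ε'` of the smooth approximations
  obtain ⟨M, hM⟩ : ∃ M : ℝ≥0∞, M = 8 + ENNReal.ofReal (128 * d * K) + 4 * ENNReal.ofReal K :=
    ⟨_, rfl⟩
  have hMt : M ≠ ⊤ := by rw [hM]; finiteness
  have hε2 : 0 < ε / 2 := ENNReal.div_pos hε.ne' ENNReal.ofNat_ne_top
  obtain ⟨b, hb0, hb1, hbM⟩ : ∃ b : ℝ, 0 < b ∧ b ^ 2 ≤ 1 / 2 ∧ 2 * (M * J (b ^ 2)) ≤ ε / 2 := by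
    have h1 := tendsto_lintegral_thickening hD hD0 (lintegral_sq_lt_top h.memLp_grad)
    have h2 : Tendsto (fun r => 2 * (M * J r)) (𝓝[>] 0) (𝓝 (2 * (M * 0))) :=
      ENNReal.Tendsto.const_mul (ENNReal.Tendsto.const_mul h1 (Or.inr hMt))
        (Or.inr ENNReal.ofNat_ne_top)
    rw [mul_zero, mul_zero] at h2
    have h3 : ∀ᶠ r : ℝ in 𝓝[>] 0, r ≤ 1 / 2 :=
      (eventually_le_nhds (by norm_num)).filter_mono nhdsWithin_le_nhds
    obtain ⟨r, hr1, hr2, hr0⟩ := ((ENNReal.tendsto_nhds_zero.1 h2 _ hε2).and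
      (h3.and eventually_mem_nhdsWithin)).exists
    have hr0 : 0 < r := hr0
    exact ⟨√r, Real.sqrt_pos.2 hr0, by rwa [Real.sq_sqrt hr0.le], by rwa [Real.sq_sqrt hr0.le]⟩
  obtain ⟨R, hR⟩ : ∃ R : ℝ, R = b ^ 2 / 2 := ⟨_, rfl⟩
  have hR0 : 0 < R := by rw [hR]; positivity
  obtain ⟨c, hc⟩ : ∃ c : ℝ≥0∞, c = ENNReal.ofReal (32 * d / R ^ 2) := ⟨_, rfl⟩
  have hct : c ≠ ⊤ := by rw [hc]; finiteness
  obtain ⟨N, hN⟩ : ∃ N : ℝ≥0∞, N = 26 + 2 * c := ⟨_, rfl⟩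
  have hNt : N ≠ ⊤ := by rw [hN]; finiteness
  obtain ⟨ε', hε'⟩ : ∃ ε' : ℝ≥0∞, ε' = ε / 2 / N := ⟨_, rfl⟩
  have hε'0 : 0 < ε' := by rw [hε']; exact ENNReal.div_pos hε2.ne' hNt
  have hNε : N * ε' ≤ ε / 2 := by rw [hε']; exact ENNReal.mul_div_le
  have hfin : 2 * (M * J (b ^ 2)) + N * ε' ≤ ε := by
    calc _ ≤ ε / 2 + ε / 2 := add_le_add hbM hNε
      _ = ε := ENNReal.add_halves ε
  obtain ⟨w, ⟨Kw, hwL⟩, hwc, hw0, hwf, hwg⟩ := h.exists_lipschitz_approx (D := D) hΩ hΩb hR0 hε'0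
  have hw := hwL.hasWeakGradient hwc
  obtain ⟨φ, hφ, hφs, hφf, hφg⟩ := hw.exists_contDiff hε'0 (δ := R / 4) (by positivity)
  have hX := hardy b hb0 hb1
  rw [← hR] at hX
  set X := ∫⁻ x in Metric.thickening R D, ‖f x‖ₑ ^ 2 with hXdef
  have hJR : ∫⁻ x in Metric.thickening R D, ‖g x‖ₑ ^ 2 ≤ J (b ^ 2) :=
    lintegral_mono_set (Metric.thickening_mono (by rw [hR]; linarith) D)
  have hXJ : X ≤ ENNReal.ofReal K * J (b ^ 2) := by
    refine hX.trans (mul_le_mul' (ENNReal.ofReal_le_ofReal ?_) le_rfl)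
    have : (b ^ 2) ^ 2 ≤ 1 := pow_le_one₀ (by positivity) (by linarith)
    exact mul_le_of_le_one_right hK this
  -- the Hardy inequality absorbs the factor `R⁻²` from the gradient of the cutoff
  have hcX : c * X ≤ ENNReal.ofReal (128 * d * K) * J (b ^ 2) := by
    calc c * X ≤ c * (ENNReal.ofReal (K * (b ^ 2) ^ 2) * J (b ^ 2)) := mul_le_mul' le_rfl hX
      _ = _ := by
          rw [hc, ← mul_assoc, ← ENNReal.ofReal_mul (by positivity)]
          congr 2
          rw [hR]
          field_simp
          ring
  have hsupp : Function.support φ ⊆ {x | ∀ y ∈ D, R / 4 ≤ dist x y} := by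
    intro x hx y hy
    obtain ⟨z, hz, hxz⟩ := Metric.mem_thickening_iff.1 (hφs hx)
    have hzD : R / 2 ≤ dist z y := by
      by_contra hlt
      exact hz (hw0 z (Metric.mem_thickening_iff.2 ⟨y, hy, not_le.1 hlt⟩))
    have := dist_triangle_left z y x
    linarith
  have hclosed : IsClosed {x : Rd d | ∀ y ∈ D, R / 4 ≤ dist x y} := by
    have : {x : Rd d | ∀ y ∈ D, R / 4 ≤ dist x y} = ⋂ y ∈ D, {x | R / 4 ≤ dist x y} := by
      ext x
      simp
    rw [this]
    exact isClosed_biInter fun y _ => isClosed_le continuous_const (by fun_prop)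
  have hbdd : Bornology.IsBounded (Function.support φ) :=
    ((hwc.isCompact.isBounded.subset (subset_tsupport w)).thickening).subset hφs
  refine ⟨φ, hφ, HasCompactSupport.of_support_subset_isCompact
    (Metric.isCompact_of_isClosed_isBounded isClosed_closure hbdd.closure) subset_closure,
    ⟨R / 4, by positivity, fun x hx => closure_minimal hsupp hclosed hx⟩, ?_, ?_⟩
  · calc _ ≤ _ := lintegral_enorm_sub_sq_le h.stronglyMeasurable hw.stronglyMeasurable
      _ ≤ 2 * (6 * ε' + 4 * X) + 2 * ε' :=
          add_le_add (mul_le_mul' le_rfl hwf)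
            (mul_le_mul' le_rfl ((setLIntegral_le_lintegral _ _).trans hφf))
      _ ≤ 2 * (6 * ε' + 4 * (ENNReal.ofReal K * J (b ^ 2))) + 2 * ε' := by gcongr
      _ = 2 * (4 * ENNReal.ofReal K * J (b ^ 2)) + 14 * ε' := by ring
      _ ≤ 2 * (M * J (b ^ 2)) + N * ε' := by
          gcongr
          · rw [hM]
            exact le_add_self
          · rw [hN]
            exact le_add_right (by norm_num)
      _ ≤ ε := hfin
  · calc _ ≤ _ := lintegral_enorm_sub_sq_le h.stronglyMeasurable_grad hw.stronglyMeasurable_grad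
      _ ≤ 2 * (12 * ε' + 8 * J (b ^ 2) + c * (X + ε')) + 2 * ε' := by
          refine add_le_add (mul_le_mul' le_rfl (hwg.trans ?_))
            (mul_le_mul' le_rfl ((setLIntegral_le_lintegral _ _).trans hφg))
          rw [← hc]
          gcongr
      _ = 2 * (8 * J (b ^ 2) + c * X) + (26 + 2 * c) * ε' := by ring
      _ ≤ 2 * (8 * J (b ^ 2) + ENNReal.ofReal (128 * d * K) * J (b ^ 2)) + (26 + 2 * c) * ε' := by
          gcongr
      _ ≤ 2 * (M * J (b ^ 2)) + N * ε' := by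
          rw [← add_mul, ← hN]
          gcongr
          rw [hM]
          exact le_self_add
      _ ≤ ε := hfin

/-! ### Folding along a bi-Lipschitz boundary chart -/

/-- Lebesgue measure is a multiple of the Hausdorff measure, for which this bound is known. -/
lemma volume_lipschitzOn_image_le {d : ℕ} {f : Rd d → Rd d} {K : ℝ≥0} {s : Set (Rd d)}
    (hf : LipschitzOnWith K f s) : volume (f '' s) ≤ (K : ℝ≥0∞) ^ d * volume s := by
  have h1 := hf.hausdorffMeasure_image_le (d := (d : ℝ)) (Nat.cast_nonneg d)
  have h2 := Measure.isAddLeftInvariant_eq_smul (volume : Measure (Rd d))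
    (Measure.hausdorffMeasure (d : ℝ))
  have h3 : ∀ t : Set (Rd d), volume t =
      (Measure.addHaarScalarFactor (volume : Measure (Rd d)) (Measure.hausdorffMeasure (d : ℝ)) :
        ℝ≥0∞) * Measure.hausdorffMeasure (d : ℝ) t := fun t => by
    conv_lhs => rw [h2]
    rfl
  rw [ENNReal.rpow_natCast] at h1
  rw [h3, h3 s]
  calc _ ≤ _ := mul_le_mul' le_rfl h1
    _ = _ := by ring

/-- The fold `(z', z_d) ↦ (z', -|z_d|)` of the space onto the lower half space. -/
noncomputable def fold {d : ℕ} (z : Rd d) : Rd d :=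
  WithLp.toLp 2 fun i => if (i : ℕ) + 1 = d then -|z i| else z i

lemma fold_apply {d : ℕ} (z : Rd d) (i : Fin d) :
    fold z i = if (i : ℕ) + 1 = d then -|z i| else z i := rfl

lemma dist_fold_le {d : ℕ} (z w : Rd d) : dist (fold z) (fold w) ≤ dist z w := by
  rw [EuclideanSpace.dist_eq, EuclideanSpace.dist_eq]
  refine Real.sqrt_le_sqrt (Finset.sum_le_sum fun i _ => ?_)
  gcongr
  simp only [fold_apply]
  split_ifs
  · rw [Real.dist_eq, Real.dist_eq, neg_sub_neg, abs_sub_comm]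
    exact abs_abs_sub_abs_le _ _
  · exact le_rfl

lemma continuous_fold {d : ℕ} : Continuous (fold : Rd d → Rd d) :=
  (LipschitzWith.of_dist_le_mul (K := 1) fun z w => by simpa using dist_fold_le z w).continuous

lemma norm_fold {d : ℕ} (z : Rd d) : ‖fold z‖ = ‖z‖ := by
  rw [EuclideanSpace.norm_eq, EuclideanSpace.norm_eq]
  congr 1
  refine Finset.sum_congr rfl fun i _ => ?_
  simp only [fold_apply]
  split_ifs <;> simp

lemma fold_mem_cube_iff {d : ℕ} {z : Rd d} : fold z ∈ cube d ↔ z ∈ cube d := by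
  refine forall_congr' fun i => ?_
  simp only [fold_apply, mem_Ioo, ← abs_lt]
  split_ifs <;> simp

lemma fold_eq_self {d : ℕ} {z : Rd d} (hz : ∀ i : Fin d, (i : ℕ) + 1 = d → z i ≤ 0) :
    fold z = z := by
  ext i
  rw [fold_apply]
  split_ifs with h
  · rw [abs_of_nonpos (hz i h), neg_neg]
  · rfl

lemma dist_fold_eq {d : ℕ} {z w : Rd d} (hz : ∀ i : Fin d, (i : ℕ) + 1 = d → 0 < z i)
    (hw : ∀ i : Fin d, (i : ℕ) + 1 = d → 0 < w i) : dist (fold z) (fold w) = dist z w := by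
  rw [EuclideanSpace.dist_eq, EuclideanSpace.dist_eq]
  congr 1
  refine Finset.sum_congr rfl fun i _ => ?_
  simp only [fold_apply]
  split_ifs with h
  · rw [abs_of_pos (hz i h), abs_of_pos (hw i h), dist_neg_neg]
  · rfl

lemma isCompact_fold_preimage {d : ℕ} {Q : Set (Rd d)} (hQ : IsCompact Q) :
    IsCompact (fold ⁻¹' Q) := by
  refine Metric.isCompact_of_isClosed_isBounded (hQ.isClosed.preimage continuous_fold) ?_
  obtain ⟨r, hr⟩ := hQ.isBounded.exists_norm_le
  exact isBounded_iff_forall_norm_le.2 ⟨r, fun z hz => (norm_fold z).symm ▸ hr _ hz⟩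

lemma volume_midPlate {d : ℕ} (hd : 1 ≤ d) : volume (midPlate d) = 0 := by
  set i : Fin d := ⟨d - 1, by omega⟩ with hi
  have hid : (i : ℕ) + 1 = d := by simp only [hi]; omega
  have h1 := Measure.addHaar_submodule (volume : Measure (Rd d))
    (LinearMap.ker (EuclideanSpace.proj i : Rd d →L[ℝ] ℝ).toLinearMap) (by
      intro htop
      have : EuclideanSpace.single i (1 : ℝ) ∈
        LinearMap.ker (EuclideanSpace.proj i : Rd d →L[ℝ] ℝ).toLinearMap := htop ▸ trivial
      simp at this)
  refine measure_mono_null (fun z hz => ?_) h1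
  simpa using hz.2 i hid

/-- A Lipschitz retraction `S` of the open set `U` onto its part in `Ω ∪ ∂Ω`, obtained by folding
along the boundary, together with the properties that make `v ↦ v ∘ S` an extension operator. The
last one ensures that `v ∘ S` vanishes off a compact subset of `U` whenever `v` does. -/
structure IsBoundaryFold {d : ℕ} (S : Rd d → Rd d) (Ω U : Set (Rd d)) (L : ℝ≥0) (K : ℝ≥0∞) :
    Prop where
  lipschitz : LipschitzOnWith L S U
  eq_self : ∀ x ∈ U, x ∈ Ω ∨ x ∈ frontier Ω → S x = x
  lintegral_le : ∀ h : Rd d → ℝ≥0∞, Measurable h → ∫⁻ x in U, h (S x) ≤ K * ∫⁻ x in Ω, h x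
  exists_compact : ∀ Q ⊆ U, IsCompact Q → ∃ Q' ⊆ U, IsCompact Q' ∧ ∀ x ∈ U, S x ∈ Q → x ∈ Q'

/-- A change of variables inequality for maps that do not shrink distances too much. -/
lemma lintegral_comp_le_of_expanding {d : ℕ} {S : Rd d → Rd d} {P Ω : Set (Rd d)}
    (hP : MeasurableSet P) (hS : ContinuousOn S P) (hPΩ : ∀ x ∈ P, S x ∈ Ω)
    {M : ℝ≥0} (hM : ∀ x ∈ P, ∀ y ∈ P, dist x y ≤ M * dist (S x) (S y))
    {h : Rd d → ℝ≥0∞} (hh : Measurable h) :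
    ∫⁻ x in P, h (S x) ≤ (M : ℝ≥0∞) ^ d * ∫⁻ x in Ω, h x := by
  have hSm : AEMeasurable S (volume.restrict P) := hS.aemeasurable hP
  rw [← lintegral_map' hh.aemeasurable hSm, ← smul_eq_mul, ← lintegral_smul_measure]
  refine lintegral_mono' (Measure.le_iff.2 fun E hE => ?_) le_rfl
  rw [Measure.map_apply_of_aemeasurable hSm hE, Measure.smul_apply, Measure.restrict_apply hE,
    Measure.restrict_apply' hP]
  have hinj : InjOn S P := fun x hx y hy hxy => by
    have := hM x hx y hy
    rw [hxy, dist_self, mul_zero] at this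
    exact dist_le_zero.1 this
  set s := S ⁻¹' E ∩ P with hs
  have hsP : s ⊆ P := inter_subset_right
  have hG : LipschitzOnWith M (Function.invFunOn S P) (S '' s) := by
    refine LipschitzOnWith.of_dist_le_mul ?_
    rintro _ ⟨x, hx, rfl⟩ _ ⟨y, hy, rfl⟩
    rw [hinj.leftInvOn_invFunOn (hsP hx), hinj.leftInvOn_invFunOn (hsP hy)]
    exact hM x (hsP hx) y (hsP hy)
  have himg : Function.invFunOn S P '' (S '' s) = s := by
    rw [image_image]
    exact (image_congr fun x hx => hinj.leftInvOn_invFunOn (hsP hx)).trans (image_id' s)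
  have h1 := volume_lipschitzOn_image_le hG
  rw [himg] at h1
  refine h1.trans ?_
  rw [smul_eq_mul]
  gcongr
  rintro _ ⟨x, hx, rfl⟩
  exact ⟨hx.1, hPΩ x hx.2⟩

/-- A boundary chart `Φ` gives the fold `S = Φ⁻¹ ∘ fold ∘ Φ`. On the part of `U` outside the closure
of `Ω` it is bi-Lipschitz, which bounds the change of variables there; it is the identity on the
rest, and the boundary is a null set. -/
lemma exists_isBoundaryFold {d : ℕ} (hd : 1 ≤ d) {Ω U : Set (Rd d)} {Φ : Rd d → Rd d}
    (hΩ : IsOpen Ω) (hU : IsOpen U) (hΦ : IsBiLipschitzOn Φ U) (hcube : Φ '' U = cube d)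
    (hlow : Φ '' (Ω ∩ U) = lowerCube d) (hmid : Φ '' (frontier Ω ∩ U) = midPlate d) :
    ∃ S L K, K ≠ ⊤ ∧ IsBoundaryFold S Ω U L K := by
  obtain ⟨c, C, hc, hC, hΦ⟩ := hΦ
  have hinj : InjOn Φ U := fun x hx y hy hxy => by
    have := (hΦ x hx y hy).1
    rw [hxy, dist_self] at this
    have h0 := dist_nonneg (x := x) (y := y)
    have : dist x y ≤ 0 := by nlinarith
    exact dist_le_zero.1 this
  set Ψ := Function.invFunOn Φ U with hΨ
  have hΨU : ∀ z ∈ cube d, Ψ z ∈ U := fun z hz => by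
    rw [← hcube] at hz
    exact Function.invFunOn_mem hz
  have hΦΨ : ∀ z ∈ cube d, Φ (Ψ z) = z := fun z hz => by
    rw [← hcube] at hz
    exact Function.invFunOn_eq hz
  have hΨΦ : ∀ x ∈ U, Ψ (Φ x) = x := fun x hx => hinj.leftInvOn_invFunOn hx
  have hΦc : ∀ x ∈ U, Φ x ∈ cube d := fun x hx => hcube ▸ mem_image_of_mem Φ hx
  have hΨL : LipschitzOnWith c⁻¹.toNNReal Ψ (cube d) := by
    refine LipschitzOnWith.of_dist_le_mul fun z hz w hw => ?_
    have := (hΦ _ (hΨU z hz) _ (hΨU w hw)).1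
    rw [hΦΨ z hz, hΦΨ w hw] at this
    rw [Real.coe_toNNReal _ (by positivity), inv_mul_eq_div, le_div_iff₀ hc]
    linarith
  have hΦL : LipschitzOnWith C.toNNReal Φ U := by
    refine LipschitzOnWith.of_dist_le_mul fun x hx y hy => ?_
    rw [Real.coe_toNNReal _ hC.le]
    exact (hΦ x hx y hy).2
  have hfold : ∀ x ∈ U, fold (Φ x) ∈ cube d := fun x hx => fold_mem_cube_iff.2 (hΦc x hx)
  set i : Fin d := ⟨d - 1, by omega⟩ with hi
  have hid : ∀ j : Fin d, (j : ℕ) + 1 = d ↔ j = i := fun j => by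
    rw [hi, Fin.ext_iff]
    simp only
    omega
  have hiff : ∀ (p : ℝ → Prop) (z : Rd d), (∀ j : Fin d, (j : ℕ) + 1 = d → p (z j)) ↔ p (z i) := by
    intro p z
    simp [hid]
  have hΩlow : ∀ x ∈ U, Φ x i < 0 → x ∈ Ω := fun x hx hneg => by
    have : Φ x ∈ Φ '' (Ω ∩ U) := hlow ▸ ⟨hΦc x hx, (hiff (· < 0) _).2 hneg⟩
    obtain ⟨y, hy, hyx⟩ := this
    exact hinj hy.2 hx hyx ▸ hy.1
  have hfmid : ∀ x ∈ U, Φ x i = 0 → x ∈ frontier Ω := fun x hx h0 => by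
    have : Φ x ∈ Φ '' (frontier Ω ∩ U) := hmid ▸ ⟨hΦc x hx, (hiff (· = 0) _).2 h0⟩
    obtain ⟨y, hy, hyx⟩ := this
    exact hinj hy.2 hx hyx ▸ hy.1
  have hself : ∀ x ∈ U, x ∈ Ω ∨ x ∈ frontier Ω → Ψ (fold (Φ x)) = x := by
    intro x hx hor
    have : Φ x i ≤ 0 := by
      rcases hor with h | h
      · have : Φ x ∈ lowerCube d := hlow ▸ mem_image_of_mem Φ ⟨h, hx⟩
        exact ((hiff (· < 0) _).1 this.2).le
      · have : Φ x ∈ midPlate d := hmid ▸ mem_image_of_mem Φ ⟨h, hx⟩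
        exact ((hiff (· = 0) _).1 this.2).le
    rw [fold_eq_self ((hiff (· ≤ 0) _).2 this), hΨΦ x hx]
  have hSL : LipschitzOnWith (c⁻¹.toNNReal * C.toNNReal) (fun x => Ψ (fold (Φ x))) U := by
    refine LipschitzOnWith.of_dist_le_mul fun x hx y hy => ?_
    push_cast
    rw [mul_assoc]
    refine (hΨL.dist_le_mul _ (hfold x hx) _ (hfold y hy)).trans ?_
    gcongr
    exact (dist_fold_le _ _).trans (hΦL.dist_le_mul x hx y hy)
  set P : Set (Rd d) := U ∩ Φ ⁻¹' {z | 0 < z i} with hP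
  have hPo : IsOpen P := hΦL.continuousOn.isOpen_inter_preimage hU
    (isOpen_lt continuous_const (by fun_prop))
  have hnull : volume (frontier Ω ∩ U) = 0 := by
    have h1 : frontier Ω ∩ U = Ψ '' midPlate d := by
      rw [← hmid, image_image]
      exact ((image_congr fun x hx => hΨΦ x hx.2).trans (image_id' _)).symm
    rw [h1]
    refine le_antisymm ((volume_lipschitzOn_image_le (hΨL.mono fun z hz => hz.1)).trans ?_) zero_le
    rw [volume_midPlate hd, mul_zero]
  refine ⟨fun x => Ψ (fold (Φ x)), c⁻¹.toNNReal * C.toNNReal,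
    1 + ((c⁻¹.toNNReal * C.toNNReal : ℝ≥0) : ℝ≥0∞) ^ d, by finiteness,
    hSL, hself, fun h hh => ?_, fun Q hQU hQ => ?_⟩
  · have hcov : U ⊆ (Ω ∩ U) ∪ ((frontier Ω ∩ U) ∪ P) := by
      intro x hx
      rcases lt_trichotomy (Φ x i) 0 with h0 | h0 | h0
      · exact Or.inl ⟨hΩlow x hx h0, hx⟩
      · exact Or.inr (Or.inl ⟨hfmid x hx h0, hx⟩)
      · exact Or.inr (Or.inr ⟨hx, h0⟩)
    have hA : ∫⁻ x in Ω ∩ U, h (Ψ (fold (Φ x))) ≤ ∫⁻ x in Ω, h x := by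
      rw [setLIntegral_congr_fun (hΩ.inter hU).measurableSet
        (fun x hx => by rw [hself x hx.2 (Or.inl hx.1)] : EqOn _ h _)]
      exact lintegral_mono_set inter_subset_left
    have hB : ∫⁻ x in frontier Ω ∩ U, h (Ψ (fold (Φ x))) = 0 := setLIntegral_measure_zero _ _ hnull
    have hCc := lintegral_comp_le_of_expanding (S := fun x => Ψ (fold (Φ x)))
      (M := c⁻¹.toNNReal * C.toNNReal) hPo.measurableSet
      (hSL.continuousOn.mono inter_subset_left) (by
        intro x hx
        refine hΩlow _ (hΨU _ (hfold x hx.1)) ?_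
        have h0 : 0 < Φ x i := hx.2
        rw [hΦΨ _ (hfold x hx.1), fold_apply, if_pos ((hid i).2 rfl), abs_of_pos h0]
        linarith) (by
        intro x hx y hy
        have h1 := (hΦ x hx.1 y hy.1).1
        have h2 := hΦL.dist_le_mul _ (hΨU _ (hfold x hx.1)) _ (hΨU _ (hfold y hy.1))
        rw [hΦΨ _ (hfold x hx.1), hΦΨ _ (hfold y hy.1), dist_fold_eq
          ((hiff (0 < ·) _).2 hx.2) ((hiff (0 < ·) _).2 hy.2)] at h2
        push_cast
        rw [Real.coe_toNNReal c⁻¹ (by positivity), mul_assoc, inv_mul_eq_div, le_div_iff₀ hc]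
        linarith) hh
    calc _ ≤ _ := lintegral_mono_set hcov
      _ ≤ _ := (lintegral_union_le _ _ _).trans (add_le_add hA (lintegral_union_le _ _ _))
      _ ≤ _ := by
          rw [hB, zero_add, add_mul, one_mul]
          gcongr
  · have hΦQ : IsCompact (Φ '' Q) := hQ.image_of_continuousOn (hΦL.continuousOn.mono hQU)
    have hsub : fold ⁻¹' (Φ '' Q) ⊆ cube d := by
      rintro z ⟨x, hx, hxz⟩
      rw [← fold_mem_cube_iff, ← hxz]
      exact hΦc x (hQU hx)
    refine ⟨Ψ '' (fold ⁻¹' (Φ '' Q)), ?_, (isCompact_fold_preimage hΦQ).image_of_continuousOn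
      (hΨL.continuousOn.mono hsub), fun x hx hSx => ?_⟩
    · rintro _ ⟨z, hz, rfl⟩
      exact hΨU z (hsub hz)
    · refine ⟨Φ x, ?_, hΨΦ x hx⟩
      exact ⟨_, hSx, hΦΨ _ (hfold x hx)⟩

/-! ### Local extension operators -/

/-- The squared `H¹(Ω)` norm of `f`, computed with the classical gradient. -/
noncomputable def energy {d : ℕ} (Ω : Set (Rd d)) (f : Rd d → ℂ) : ℝ≥0∞ :=
  (∫⁻ x in Ω, ‖f x‖ₑ ^ 2) + ∫⁻ x in Ω, ‖cgrad f x‖ₑ ^ 2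

/-- Multiplication by a bounded function with bounded derivative is bounded in `H¹(Ω)`. -/
lemma exists_energy_smul_le {d : ℕ} {η : Rd d → ℝ} (hη : Differentiable ℝ η) {M : ℝ}
    (hM : ∀ x, |η x| ≤ M) (hM' : ∀ x, ‖fderiv ℝ η x‖ ≤ M) (Ω : Set (Rd d)) :
    ∃ C : ℝ≥0∞, C ≠ ⊤ ∧ ∀ φ : Rd d → ℂ, Differentiable ℝ φ →
      energy Ω (fun x => η x • φ x) ≤ C * energy Ω φ := by
  have hM0 : 0 ≤ M := (abs_nonneg _).trans (hM 0)
  obtain ⟨A, hA⟩ : ∃ A : ℝ≥0∞, A = ENNReal.ofReal M := ⟨_, rfl⟩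
  obtain ⟨B, hB⟩ : ∃ B : ℝ≥0∞, B = ENNReal.ofReal (√d * M) := ⟨_, rfl⟩
  have hAt : A ≠ ⊤ := by rw [hA]; finiteness
  have hBt : B ≠ ⊤ := by rw [hB]; finiteness
  refine ⟨A ^ 2 + 2 * (A ^ 2 + B ^ 2), by finiteness, fun φ hφ => ?_⟩
  have h1 : ∀ x, ‖η x • φ x‖ₑ ^ 2 ≤ A ^ 2 * ‖φ x‖ₑ ^ 2 := fun x => by
    rw [enorm_smul, mul_pow, hA]
    gcongr
    rw [← ofReal_norm]
    exact ENNReal.ofReal_le_ofReal (hM x)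
  have h2 : ∀ x, ‖cgrad (fun y => η y • φ y) x‖ₑ ^ 2 ≤
      2 * (A ^ 2 * ‖cgrad φ x‖ₑ ^ 2) + 2 * (B ^ 2 * ‖φ x‖ₑ ^ 2) := fun x => by
    have h3 : ‖cgrad (fun y => η y • φ y) x - η x • cgrad φ x‖ₑ ≤ B * ‖φ x‖ₑ := by
      rw [hB, ← ofReal_norm, ← ofReal_norm, ← ENNReal.ofReal_mul (by positivity)]
      refine ENNReal.ofReal_le_ofReal ((norm_cgrad_smul_le (hη x) (hφ x)).trans ?_)
      gcongr
      exact hM' x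
    have h4 : ‖η x • cgrad φ x‖ₑ ≤ A * ‖cgrad φ x‖ₑ := by
      rw [enorm_smul, hA, ← ofReal_norm]
      gcongr
      exact hM x
    have h5 := enorm_add_sq_le (η x • cgrad φ x)
      (cgrad (fun y => η y • φ y) x - η x • cgrad φ x)
    rw [add_sub_cancel, mul_add] at h5
    refine h5.trans ?_
    rw [← mul_pow, ← mul_pow]
    gcongr
  unfold energy
  have hmeas : Measurable fun x => 2 * (A ^ 2 * ‖cgrad φ x‖ₑ ^ 2) :=
    (((measurable_cgrad φ).enorm.pow_const 2).const_mul _).const_mul _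
  calc _ ≤ (∫⁻ x in Ω, A ^ 2 * ‖φ x‖ₑ ^ 2) + ∫⁻ x in Ω,
        (2 * (A ^ 2 * ‖cgrad φ x‖ₑ ^ 2) + 2 * (B ^ 2 * ‖φ x‖ₑ ^ 2)) :=
        add_le_add (lintegral_mono h1) (lintegral_mono h2)
    _ = A ^ 2 * (∫⁻ x in Ω, ‖φ x‖ₑ ^ 2) + (2 * (A ^ 2 * ∫⁻ x in Ω, ‖cgrad φ x‖ₑ ^ 2) +
        2 * (B ^ 2 * ∫⁻ x in Ω, ‖φ x‖ₑ ^ 2)) := by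
        have hA2 : A ^ 2 ≠ ⊤ := by finiteness
        have hB2 : B ^ 2 ≠ ⊤ := by finiteness
        rw [lintegral_add_left hmeas, lintegral_const_mul' _ _ hA2,
          lintegral_const_mul' _ _ ENNReal.ofNat_ne_top, lintegral_const_mul' _ _ hA2,
          lintegral_const_mul' _ _ ENNReal.ofNat_ne_top, lintegral_const_mul' _ _ hB2]
    _ ≤ A ^ 2 * ((∫⁻ x in Ω, ‖φ x‖ₑ ^ 2) + ∫⁻ x in Ω, ‖cgrad φ x‖ₑ ^ 2) +
        (2 * (A ^ 2 * ((∫⁻ x in Ω, ‖φ x‖ₑ ^ 2) + ∫⁻ x in Ω, ‖cgrad φ x‖ₑ ^ 2)) +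
        2 * (B ^ 2 * ((∫⁻ x in Ω, ‖φ x‖ₑ ^ 2) + ∫⁻ x in Ω, ‖cgrad φ x‖ₑ ^ 2))) := by
        gcongr
        · exact le_self_add
        · exact le_add_self
        · exact le_self_add
    _ = _ := by ring

/-- For test functions `φ` vanishing near `D`, the functions `η φ` extend from `Ω` to compactly
supported Lipschitz functions on `ℝ^d` that vanish near `D`, with control of the energy. -/
def IsExtension {d : ℕ} (Ω D : Set (Rd d)) (η : Rd d → ℝ) (C : ℝ≥0∞) : Prop :=
  ∀ φ : Rd d → ℂ, ContDiff ℝ ∞ φ → HasCompactSupport φ → (∀ y ∈ D, φ =ᶠ[𝓝 y] 0) →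
    ∃ E : Rd d → ℂ, (∃ K, LipschitzWith K E) ∧ HasCompactSupport E ∧ (∀ x ∈ Ω, E x = η x • φ x) ∧
      (∀ y ∈ D, E =ᶠ[𝓝 y] 0) ∧ energy univ E ≤ C * energy Ω φ

/-- At a point of the chart, the derivative of `g ∘ S` is bounded by that of `g`, although `S` need
not be differentiable. -/
lemma norm_fderiv_comp_le {d : ℕ} {S : Rd d → Rd d} {U : Set (Rd d)} {L : ℝ≥0} (hU : IsOpen U)
    (hS : LipschitzOnWith L S U) {g E : Rd d → ℂ} (hg : ContDiff ℝ 1 g)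
    (hE : ∀ x ∈ U, E x = g (S x)) {x : Rd d} (hx : x ∈ U) :
    ‖fderiv ℝ E x‖ ≤ L * ‖fderiv ℝ g (S x)‖ := by
  have hstrict : HasStrictFDerivAt g (fderiv ℝ g (S x)) (S x) :=
    hg.contDiffAt.hasStrictFDerivAt (by norm_num)
  have h1 : ∀ N : ℝ≥0, ‖fderiv ℝ g (S x)‖₊ < N → ‖fderiv ℝ E x‖ ≤ N * L := by
    intro N hN
    obtain ⟨s, hs, hL⟩ := hstrict.exists_lipschitzOnWith_of_nnnorm_lt N hN
    refine norm_fderiv_le_of_lip' ℝ (by positivity) ?_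
    have hcont : ContinuousAt S x := hS.continuousOn.continuousAt (hU.mem_nhds hx)
    filter_upwards [hcont hs, hU.mem_nhds hx] with y hy hyU
    rw [hE x hx, hE y hyU, ← dist_eq_norm, ← dist_eq_norm, mul_assoc]
    refine (hL.dist_le_mul _ hy _ (mem_of_mem_nhds hs)).trans ?_
    gcongr
    exact hS.dist_le_mul y hyU x hx
  have h2 : Tendsto (fun N : ℝ≥0 => (N : ℝ) * L) (𝓝[>] ‖fderiv ℝ g (S x)‖₊)
      (𝓝 ((‖fderiv ℝ g (S x)‖₊ : ℝ) * L)) :=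
    ((NNReal.continuous_coe.tendsto _).mul_const _).mono_left nhdsWithin_le_nhds
  rw [mul_comm]
  exact ge_of_tendsto h2 (eventually_mem_nhdsWithin.mono fun N hN => h1 N hN)

lemma exists_bound_of_contDiff {d : ℕ} {η : Rd d → ℝ} (hη : ContDiff ℝ ∞ η)
    (hc : HasCompactSupport η) : ∃ M : ℝ, (∀ x, |η x| ≤ M) ∧ ∀ x, ‖fderiv ℝ η x‖ ≤ M := by
  obtain ⟨M₁, hM₁⟩ := hη.continuous.bounded_above_of_compact_support hc
  obtain ⟨M₂, hM₂⟩ := (hη.continuous_fderiv (by simp)).bounded_above_of_compact_support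
    (hc.fderiv (𝕜 := ℝ))
  exact ⟨max M₁ M₂, fun x => (hM₁ x).trans (le_max_left _ _),
    fun x => (hM₂ x).trans (le_max_right _ _)⟩

/-- Extension by folding, for functions supported in a boundary chart. -/
lemma IsBoundaryFold.exists_isExtension {d : ℕ} {S : Rd d → Rd d} {Ω U D : Set (Rd d)} {L : ℝ≥0}
    {K : ℝ≥0∞} (hS : IsBoundaryFold S Ω U L K) (hK : K ≠ ⊤) (hU : IsOpen U)
    (hDΩ : D ⊆ frontier Ω) {η : Rd d → ℝ} (hη : ContDiff ℝ ∞ η) (hηc : HasCompactSupport η)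
    (hηU : tsupport η ⊆ U) : ∃ C : ℝ≥0∞, C ≠ ⊤ ∧ IsExtension Ω D η C := by
  classical
  obtain ⟨M, hM, hM'⟩ := exists_bound_of_contDiff hη hηc
  obtain ⟨C₁, hC₁, hen⟩ := exists_energy_smul_le (hη.differentiable (by simp)) hM hM' Ω
  obtain ⟨Q', hQ'U, hQ', hSQ⟩ := hS.exists_compact (tsupport η) hηU hηc
  obtain ⟨B, hB⟩ : ∃ B : ℝ≥0∞, B = ENNReal.ofReal (√d * L) ^ 2 := ⟨_, rfl⟩
  have hBt : B ≠ ⊤ := by rw [hB]; finiteness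
  refine ⟨(1 + B) * K * C₁, by finiteness, fun φ hφ hφc hφD => ?_⟩
  set g : Rd d → ℂ := fun x => η x • φ x with hg
  have hgs : ContDiff ℝ ∞ g := hη.smul hφ
  have hgc : HasCompactSupport g := hφc.mono fun x hx h0 => hx (by simp [hg, h0])
  obtain ⟨Kg, hKg⟩ := hgs.lipschitzWith_of_hasCompactSupport hgc (by simp)
  -- the support of `g ∘ S` is compact in `U`, so that `g ∘ S` extends by zero
  set E : Rd d → ℂ := fun x => if x ∈ U then g (S x) else 0 with hE
  have hEU : ∀ x ∈ U, E x = g (S x) := fun x hx => if_pos hx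
  have hE0 : ∀ x ∉ Q', E x = 0 := by
    intro x hx
    by_cases hxU : x ∈ U
    · have : S x ∉ tsupport η := fun h => hx (hSQ x hxU h)
      rw [hEU x hxU, hg]
      simp [image_eq_zero_of_notMem_tsupport this]
    · exact if_neg hxU
  have hE0' : ∀ x ∉ Q', E =ᶠ[𝓝 x] 0 := fun x hx => by
    filter_upwards [hQ'.isClosed.isOpen_compl.mem_nhds hx] with y hy using hE0 y hy
  have hEL : ∃ K', LipschitzWith K' E := by
    refine exists_lipschitzWith_of_compact (K := Kg * L) hU hQ' hQ'U (fun x hx y hy => ?_) hE0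
    rw [hEU x hx, hEU y hy]
    exact hKg.comp_lipschitzOnWith hS.lipschitz hx hy
  refine ⟨E, hEL, HasCompactSupport.intro hQ' hE0, fun x hx => ?_, fun y hy => ?_, ?_⟩
  · by_cases hxU : x ∈ U
    · rw [hEU x hxU, hS.eq_self x hxU (Or.inl hx)]
    · have : x ∉ tsupport η := fun h => hxU (hηU h)
      rw [hE, image_eq_zero_of_notMem_tsupport this]
      simp [hxU]
  · by_cases hyU : y ∈ U
    · have hcont : ContinuousAt S y := hS.lipschitz.continuousOn.continuousAt (hU.mem_nhds hyU)
      have hSy : S y = y := hS.eq_self y hyU (Or.inr (hDΩ hy))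
      have h1 : ∀ᶠ x in 𝓝 y, φ (S x) = 0 := by
        have := hφD y hy
        rw [← hSy] at this
        exact hcont this
      filter_upwards [h1, hU.mem_nhds hyU] with x hx hxU
      rw [hEU x hxU, hg]
      simp [hx]
    · exact hE0' y fun h => hyU (hQ'U h)
  · have hfun : ∫⁻ x, ‖E x‖ₑ ^ 2 ≤ K * ∫⁻ x in Ω, ‖g x‖ₑ ^ 2 := by
      refine le_trans ?_ (hS.lintegral_le _ (hgs.continuous.measurable.enorm.pow_const 2))
      rw [← lintegral_indicator hU.measurableSet]
      refine lintegral_mono fun x => ?_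
      by_cases hxU : x ∈ U
      · rw [indicator_of_mem hxU, hEU x hxU]
      · rw [indicator_of_notMem hxU, hE0 x fun h => hxU (hQ'U h)]
        simp
    have hgrad : ∫⁻ x, ‖cgrad E x‖ₑ ^ 2 ≤ K * ∫⁻ x in Ω, B * ‖cgrad g x‖ₑ ^ 2 := by
      refine le_trans ?_ (hS.lintegral_le _ (((measurable_cgrad g).enorm.pow_const 2).const_mul B))
      rw [← lintegral_indicator hU.measurableSet]
      refine lintegral_mono fun x => ?_
      by_cases hxU : x ∈ U
      · rw [indicator_of_mem hxU, hB, ← mul_pow]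
        gcongr
        rw [← ofReal_norm, ← ofReal_norm, ← ENNReal.ofReal_mul (by positivity)]
        refine ENNReal.ofReal_le_ofReal ((norm_cgrad_le E x).trans ?_)
        rw [mul_assoc]
        gcongr
        refine (norm_fderiv_comp_le hU hS.lipschitz (hgs.of_le (by simp)) hEU hxU).trans ?_
        gcongr
        exact norm_fderiv_le_cgrad g _
      · have : cgrad E x = 0 := by
          refine cgrad_eq_zero_of_notMem_tsupport ?_
          rw [notMem_tsupport_iff_eventuallyEq]
          exact hE0' x fun h => hxU (hQ'U h)
        rw [this]
        simp
    rw [lintegral_const_mul' _ _ hBt] at hgrad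
    calc energy univ E ≤ K * (∫⁻ x in Ω, ‖g x‖ₑ ^ 2) + K * (B * ∫⁻ x in Ω, ‖cgrad g x‖ₑ ^ 2) := by
          rw [energy, setLIntegral_univ, setLIntegral_univ]
          exact add_le_add hfun hgrad
      _ ≤ K * ((1 + B) * energy Ω g) := by
          rw [← mul_add, energy]
          gcongr
          calc _ ≤ (1 * ∫⁻ x in Ω, ‖g x‖ₑ ^ 2) + B * (∫⁻ x in Ω, ‖cgrad g x‖ₑ ^ 2) +
                (B * (∫⁻ x in Ω, ‖g x‖ₑ ^ 2) + 1 * ∫⁻ x in Ω, ‖cgrad g x‖ₑ ^ 2) := by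
                rw [one_mul]
                exact le_self_add
            _ = _ := by ring
      _ ≤ K * ((1 + B) * (C₁ * energy Ω φ)) := by
          gcongr
          exact hen φ (hφ.differentiable (by simp))
      _ = _ := by ring

/-- Extension by zero, for functions that vanish near the part of the boundary off `D`. -/
lemma exists_isExtension_zero {d : ℕ} {Ω D : Set (Rd d)} (hΩ : IsOpen Ω) (hDΩ : D ⊆ frontier Ω)
    {η : Rd d → ℝ} (hη : ContDiff ℝ ∞ η) {M : ℝ} (hM : ∀ x, |η x| ≤ M)
    (hM' : ∀ x, ‖fderiv ℝ η x‖ ≤ M) (hη0 : ∀ y ∈ frontier Ω, y ∉ D → η =ᶠ[𝓝 y] 0) :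
    ∃ C : ℝ≥0∞, C ≠ ⊤ ∧ IsExtension Ω D η C := by
  classical
  obtain ⟨C₁, hC₁, hen⟩ := exists_energy_smul_le (hη.differentiable (by simp)) hM hM' Ω
  refine ⟨C₁, hC₁, fun φ hφ hφc hφD => ?_⟩
  set g : Rd d → ℂ := fun x => η x • φ x with hg
  have hgs : ContDiff ℝ ∞ g := hη.smul hφ
  set E : Rd d → ℂ := Ω.indicator g with hE
  have hin : ∀ x ∈ Ω, E =ᶠ[𝓝 x] g := fun x hx => by
    filter_upwards [hΩ.mem_nhds hx] with y hy using indicator_of_mem hy g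
  have hout : ∀ x ∉ Ω, E =ᶠ[𝓝 x] 0 := by
    intro x hx
    by_cases hxc : x ∈ closure Ω
    · have hxf : x ∈ frontier Ω := ⟨hxc, by rwa [hΩ.interior_eq]⟩
      have h1 : g =ᶠ[𝓝 x] 0 := by
        by_cases hxD : x ∈ D
        · filter_upwards [hφD x hxD] with y hy
          simp [hg, hy]
        · filter_upwards [hη0 x hxf hxD] with y hy
          simp [hg, hy]
      filter_upwards [h1] with y hy
      simp [hE, indicator, hy]
    · filter_upwards [isClosed_closure.isOpen_compl.mem_nhds hxc] with y hy
      exact indicator_of_notMem (fun h => hy (subset_closure h)) g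
  have hEs : ContDiff ℝ ∞ E := contDiff_iff_contDiffAt.2 fun x => by
    by_cases hx : x ∈ Ω
    · exact hgs.contDiffAt.congr_of_eventuallyEq (hin x hx)
    · exact (contDiff_const (c := (0 : ℂ))).contDiffAt.congr_of_eventuallyEq (hout x hx)
  have hEc : HasCompactSupport E := hφc.mono fun x hx h0 => hx (by simp [hE, hg, indicator, h0])
  refine ⟨E, hEs.lipschitzWith_of_hasCompactSupport hEc (by simp), hEc,
    fun x hx => (hin x hx).self_of_nhds, fun y hy => hout y ?_, ?_⟩
  · have := hDΩ hy
    rw [hΩ.frontier_eq] at this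
    exact this.2
  · refine le_trans (le_of_eq ?_) (hen φ (hφ.differentiable (by simp)))
    rw [energy, energy, setLIntegral_univ, setLIntegral_univ,
      ← lintegral_indicator hΩ.measurableSet, ← lintegral_indicator hΩ.measurableSet]
    congr 1
    · refine lintegral_congr fun x => ?_
      by_cases hx : x ∈ Ω
      · rw [indicator_of_mem hx, (hin x hx).self_of_nhds]
      · rw [indicator_of_notMem hx, (hout x hx).self_of_nhds]
        simp
    · refine lintegral_congr fun x => ?_
      by_cases hx : x ∈ Ω
      · rw [indicator_of_mem hx]
        unfold cgrad
        rw [(hin x hx).fderiv_eq]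
      · rw [indicator_of_notMem hx, cgrad_eq_zero_of_notMem_tsupport
          (notMem_tsupport_iff_eventuallyEq.2 (hout x hx))]
        simp

/-- On a domain satisfying the geometric assumptions there is a finite smooth partition of unity
each member of which admits an extension operator: the members supported in boundary charts by
folding, and the remaining one, which vanishes near the closure of `frontier Ω \ D`, by zero. -/
lemma GeometricAssumption.exists_partition {d : ℕ} (hd : 1 ≤ d) {Ω D : Set (Rd d)}
    (h : GeometricAssumption Ω D) :
    ∃ (ι : Type) (_ : Fintype ι) (η : ι → Rd d → ℝ) (C : ι → ℝ≥0∞),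
      (∀ i, C i ≠ ⊤ ∧ IsExtension Ω D (η i) (C i)) ∧ ∀ x ∈ Ω, ∑ i, η i x = 1 := by
  classical
  obtain ⟨N, hN⟩ : ∃ N, N = closure (frontier Ω \ D) := ⟨_, rfl⟩
  have hcl : IsCompact (closure Ω) := h.isBounded.isCompact_closure
  have hNc : IsCompact N := by
    rw [hN]
    refine hcl.of_isClosed_subset isClosed_closure (closure_minimal ?_ isClosed_closure)
    exact fun x hx => frontier_subset_closure hx.1
  obtain ⟨R, hR⟩ := h.isBounded.closure.subset_ball 0
  have hchart : ∀ x ∈ N, ∃ U : Set (Rd d), IsOpen U ∧ x ∈ U ∧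
      ∃ S L K, K ≠ ⊤ ∧ IsBoundaryFold S Ω U L K := by
    intro x hx
    obtain ⟨U, Φ, hU, hxU, hbi, hcube, -, hlow, hmid⟩ := h.charts x (hN ▸ hx)
    exact ⟨U, hU, hxU, exists_isBoundaryFold hd h.isOpen hU hbi hcube hlow hmid⟩
  choose! U hU hxU hfold using hchart
  obtain ⟨s, hsN, hs⟩ := hNc.elim_nhds_subcover U fun x hx => (hU x hx).mem_nhds (hxU x hx)
  -- intersecting with a ball makes the members of the partition compactly supported
  let V : Option s → Set (Rd d) := fun i =>
    (i.elim Nᶜ fun x => U x) ∩ Metric.ball 0 R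
  have hV : ∀ i, IsOpen (V i) := by
    rintro (_ | x)
    · exact hNc.isClosed.isOpen_compl.inter Metric.isOpen_ball
    · exact (hU x (hsN x x.2)).inter Metric.isOpen_ball
  have hcov : closure Ω ⊆ ⋃ i, V i := by
    intro x hx
    by_cases hxN : x ∈ N
    · obtain ⟨y, hy, hxy⟩ := mem_iUnion₂.1 (hs hxN)
      exact mem_iUnion.2 ⟨some ⟨y, hy⟩, hxy, hR hx⟩
    · exact mem_iUnion.2 ⟨none, hxN, hR hx⟩
  obtain ⟨f, hf⟩ := SmoothPartitionOfUnity.exists_isSubordinate (modelWithCornersSelf ℝ (Rd d))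
    isClosed_closure V hV hcov
  have hsmooth : ∀ i, ContDiff ℝ ∞ (f i) := fun i => (f i).contMDiff.contDiff
  have hcomp : ∀ i, HasCompactSupport (f i) := fun i =>
    (isCompact_closedBall (0 : Rd d) R).of_isClosed_subset (isClosed_tsupport _)
      ((hf i).trans (inter_subset_right.trans Metric.ball_subset_closedBall))
  have hext : ∀ i, ∃ C : ℝ≥0∞, C ≠ ⊤ ∧ IsExtension Ω D (f i) C := by
    rintro (_ | x)
    · obtain ⟨M, hM, hM'⟩ := exists_bound_of_contDiff (hsmooth none) (hcomp none)
      refine exists_isExtension_zero h.isOpen h.D_subset (hsmooth none) hM hM' fun y hy hyD => ?_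
      rw [← notMem_tsupport_iff_eventuallyEq]
      intro hyt
      refine (hf none hyt).1 ?_
      rw [hN]
      exact subset_closure ⟨hy, hyD⟩
    · obtain ⟨S, L, K, hK, hS⟩ := hfold x (hsN x x.2)
      exact hS.exists_isExtension hK (hU x (hsN x x.2)) h.D_subset (hsmooth _) (hcomp _)
        ((hf (some x)).trans inter_subset_left)
  choose C hC hCext using hext
  refine ⟨Option s, inferInstance, fun i => f i, C, fun i => ⟨hC i, hCext i⟩, fun x hx => ?_⟩
  rw [← finsum_eq_sum_of_fintype]
  exact f.sum_eq_one (subset_closure hx)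

/-! ### The Sobolev spaces as graphs in `L² × L²` -/

/-- Integration against a test function is an inner product in `L²`. -/
lemma exists_inner_eq_integral {d : ℕ} {E : Type*} [NormedAddCommGroup E] [InnerProductSpace ℂ E]
    (Ω : Set (Rd d)) {ψ : Rd d → ℝ} (hψ : Continuous ψ) (hc : HasCompactSupport ψ) (e : E) :
    ∃ w : Lp E 2 (volume.restrict Ω), ∀ u : Lp E 2 (volume.restrict Ω),
      ∫ x in Ω, ψ x • inner ℂ e (u x) = inner ℂ w u := by
  have hm : MemLp (fun x => (ψ x : ℂ) • e) 2 (volume.restrict Ω) :=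
    (Continuous.memLp_of_hasCompactSupport (by fun_prop)
      (hc.mono fun x hx h0 => hx (by simp [h0])))
  refine ⟨hm.toLp _, fun u => ?_⟩
  rw [L2.inner_def]
  refine integral_congr_ae ?_
  filter_upwards [hm.coeFn_toLp] with x hx
  rw [hx]
  exact (inner_smul_real_left _ _ _).symm

/-- The identity defining weak gradients, tested with a single function, is linear and continuous
on `L²(Ω) × L²(Ω; ℂ^d)`. -/
lemma exists_inner_iff {d : ℕ} (Ω : Set (Rd d)) {φ : Rd d → ℝ} (hφ : ContDiff ℝ ∞ φ)
    (hc : HasCompactSupport φ) (i : Fin d) : ∃ (w : L2 Ω) (w' : L2Vec Ω), ∀ u g,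
      (∫ x in Ω, fderiv ℝ φ x (EuclideanSpace.single i 1) • u x = - ∫ x in Ω, φ x • g x i) ↔
        inner ℂ w u + inner ℂ w' g = 0 := by
  obtain ⟨w, hw⟩ := exists_inner_eq_integral Ω
    (ψ := fun x => fderiv ℝ φ x (EuclideanSpace.single i 1))
    ((hφ.continuous_fderiv (by simp)).clm_apply continuous_const)
    ((hc.fderiv (𝕜 := ℝ)).mono fun x hx h0 => hx (by simp [h0])) (1 : ℂ)
  obtain ⟨w', hw'⟩ := exists_inner_eq_integral Ω hφ.continuous hc
    (EuclideanSpace.single i (1 : ℂ))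
  refine ⟨w, w', fun u g => ?_⟩
  rw [← hw, ← hw', add_eq_zero_iff_eq_neg]
  simp [EuclideanSpace.inner_single_left]

/-- The graph of the weak gradient. -/
def weakGradGraph {d : ℕ} (Ω : Set (Rd d)) : AddSubgroup (L2 Ω × L2Vec Ω) where
  carrier := {p | IsWeakGrad Ω p.1 p.2}
  zero_mem' := fun φ hφ hc _ i => by
    obtain ⟨w, w', h⟩ := exists_inner_iff Ω hφ hc i
    rw [h]
    simp
  add_mem' := fun {p q} hp hq φ hφ hc hs i => by
    obtain ⟨w, w', h⟩ := exists_inner_iff Ω hφ hc i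
    have h1 := (h _ _).1 (hp φ hφ hc hs i)
    have h2 := (h _ _).1 (hq φ hφ hc hs i)
    rw [h, Prod.fst_add, Prod.snd_add, inner_add_right, inner_add_right, add_add_add_comm, h1, h2,
      add_zero]
  neg_mem' := fun {p} hp φ hφ hc hs i => by
    obtain ⟨w, w', h⟩ := exists_inner_iff Ω hφ hc i
    have h1 := (h _ _).1 (hp φ hφ hc hs i)
    rw [h, Prod.fst_neg, Prod.snd_neg, inner_neg_right, inner_neg_right, ← neg_add, h1, neg_zero]

lemma isClosed_weakGradGraph {d : ℕ} (Ω : Set (Rd d)) :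
    IsClosed (weakGradGraph Ω : Set (L2 Ω × L2Vec Ω)) := by
  have : (weakGradGraph Ω : Set (L2 Ω × L2Vec Ω)) = {p | IsWeakGrad Ω p.1 p.2} := rfl
  rw [this]
  unfold IsWeakGrad
  simp only [ofPred_forall]
  refine isClosed_iInter fun φ => isClosed_iInter fun hφ => isClosed_iInter fun hc =>
    isClosed_iInter fun _ => isClosed_iInter fun i => ?_
  obtain ⟨w, w', h⟩ := exists_inner_iff Ω hφ hc i
  simp only [h]
  exact isClosed_eq (by fun_prop) continuous_const

lemma weakGrad_eq {d : ℕ} {Ω : Set (Rd d)} (hΩ : IsOpen Ω) {u : L2 Ω} {g : L2Vec Ω}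
    (h : IsWeakGrad Ω u g) : weakGrad Ω u = g := by
  have hex : ∃ g, IsWeakGrad Ω u g := ⟨g, h⟩
  rw [weakGrad, dif_pos hex]
  exact hex.choose_spec.unique hΩ h

lemma isWeakGrad_weakGrad {d : ℕ} {Ω : Set (Rd d)} {u : L2 Ω} (hu : u ∈ weakH1 Ω) :
    IsWeakGrad Ω u (weakGrad Ω u) := by
  have hex : ∃ g, IsWeakGrad Ω u g := hu
  rw [weakGrad, dif_pos hex]
  exact hex.choose_spec

lemma IsWeakGrad.h1Norm_eq {d : ℕ} {Ω : Set (Rd d)} (hΩ : IsOpen Ω) {u : L2 Ω} {g : L2Vec Ω}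
    (h : IsWeakGrad Ω u g) : h1Norm Ω u = √(‖u‖ ^ 2 + ‖g‖ ^ 2) := by
  rw [h1Norm, weakGrad_eq hΩ h]

lemma IsWeakGrad.norm_le_h1Norm {d : ℕ} {Ω : Set (Rd d)} (hΩ : IsOpen Ω) {u : L2 Ω} {g : L2Vec Ω}
    (h : IsWeakGrad Ω u g) : ‖(u, g)‖ ≤ h1Norm Ω u := by
  rw [h.h1Norm_eq hΩ, Prod.norm_def, max_le_iff]
  exact ⟨Real.le_sqrt_of_sq_le (le_add_of_nonneg_right (by positivity)),
    Real.le_sqrt_of_sq_le (le_add_of_nonneg_left (by positivity))⟩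

lemma IsWeakGrad.h1Norm_le {d : ℕ} {Ω : Set (Rd d)} (hΩ : IsOpen Ω) {u : L2 Ω} {g : L2Vec Ω}
    (h : IsWeakGrad Ω u g) : h1Norm Ω u ≤ 2 * ‖(u, g)‖ := by
  rw [h.h1Norm_eq hΩ, Real.sqrt_le_left (by positivity), mul_pow]
  have h1 : ‖u‖ ^ 2 ≤ ‖(u, g)‖ ^ 2 := by gcongr; exact norm_fst_le (u, g)
  have h2 : ‖g‖ ^ 2 ≤ ‖(u, g)‖ ^ 2 := by gcongr; exact norm_snd_le (u, g)
  nlinarith [sq_nonneg ‖(u, g)‖]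

lemma IsWeakGrad.hasWeakGradient {d : ℕ} {u : L2 (univ : Set (Rd d))} {g : L2Vec univ}
    (h : IsWeakGrad univ u g) : HasWeakGradient u g where
  stronglyMeasurable := Lp.stronglyMeasurable u
  stronglyMeasurable_grad := Lp.stronglyMeasurable g
  memLp := by simpa only [Measure.restrict_univ] using Lp.memLp u
  memLp_grad := by simpa only [Measure.restrict_univ] using Lp.memLp g
  integral_eq := fun φ hφ hc i => by
    simpa only [Measure.restrict_univ] using h φ hφ hc (subset_univ _) i

lemma HasWeakGradient.isWeakGrad {d : ℕ} {f : Rd d → ℂ} {g : Rd d → EuclideanSpace ℂ (Fin d)}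
    (h : HasWeakGradient f g) {Ω : Set (Rd d)} {u : L2 Ω} {v : L2Vec Ω}
    (hu : u =ᵐ[volume.restrict Ω] f) (hv : v =ᵐ[volume.restrict Ω] g) : IsWeakGrad Ω u v := by
  intro φ hφ hc hs i
  have h0 : ∀ x ∉ Ω, φ x = 0 := fun x hx => image_eq_zero_of_notMem_tsupport fun h => hx (hs h)
  have h1 : ∀ x ∉ Ω, fderiv ℝ φ x = 0 := fun x hx => by
    by_contra hne
    exact hx (hs (support_fderiv_subset ℝ hne))
  have e1 : ∫ x in Ω, fderiv ℝ φ x (EuclideanSpace.single i 1) • u x =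
      ∫ x, fderiv ℝ φ x (EuclideanSpace.single i 1) • f x := by
    refine (integral_congr_ae (g := fun x => fderiv ℝ φ x (EuclideanSpace.single i 1) • f x)
      (hu.mono fun x hx => by simp only [hx])).trans ?_
    exact setIntegral_eq_integral_of_forall_compl_eq_zero fun x hx => by rw [h1 x hx]; simp
  have e2 : ∫ x in Ω, φ x • v x i = ∫ x, φ x • g x i := by
    refine (integral_congr_ae (g := fun x => φ x • g x i)
      (hv.mono fun x hx => by simp only [hx])).trans ?_
    exact setIntegral_eq_integral_of_forall_compl_eq_zero fun x hx => by rw [h0 x hx, zero_smul]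
  rw [e1, e2]
  exact h.integral_eq φ hφ hc i

/-! ### Restriction to `Ω` -/

/-- The restriction of square integrable vector fields on `ℝ^d` to `Ω`. -/
noncomputable def restrVec {d : ℕ} (Ω : Set (Rd d)) (g : L2Vec (univ : Set (Rd d))) : L2Vec Ω :=
  MemLp.toLp g ((Lp.memLp g).mono_measure (Measure.restrict_mono (subset_univ Ω) le_rfl))

lemma coeFn_restr {d : ℕ} (Ω : Set (Rd d)) (f : L2 (univ : Set (Rd d))) :
    restr Ω f =ᵐ[volume.restrict Ω] f := MemLp.coeFn_toLp _

lemma coeFn_restrVec {d : ℕ} (Ω : Set (Rd d)) (g : L2Vec (univ : Set (Rd d))) :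
    restrVec Ω g =ᵐ[volume.restrict Ω] g := MemLp.coeFn_toLp _

lemma restr_add {d : ℕ} (Ω : Set (Rd d)) (f f' : L2 (univ : Set (Rd d))) :
    restr Ω (f + f') = restr Ω f + restr Ω f' := by
  have hle := Measure.restrict_mono (μ := volume) (subset_univ Ω) le_rfl
  refine Lp.ext ?_
  filter_upwards [coeFn_restr Ω (f + f'), coeFn_restr Ω f, coeFn_restr Ω f',
    (Lp.coeFn_add f f').filter_mono (ae_mono hle), Lp.coeFn_add (restr Ω f) (restr Ω f')]
    with x h1 h2 h3 h4 h5
  rw [h1, h4, h5, Pi.add_apply, Pi.add_apply, h2, h3]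

lemma restrVec_add {d : ℕ} (Ω : Set (Rd d)) (g g' : L2Vec (univ : Set (Rd d))) :
    restrVec Ω (g + g') = restrVec Ω g + restrVec Ω g' := by
  have hle := Measure.restrict_mono (μ := volume) (subset_univ Ω) le_rfl
  refine Lp.ext ?_
  filter_upwards [coeFn_restrVec Ω (g + g'), coeFn_restrVec Ω g, coeFn_restrVec Ω g',
    (Lp.coeFn_add g g').filter_mono (ae_mono hle), Lp.coeFn_add (restrVec Ω g) (restrVec Ω g')]
    with x h1 h2 h3 h4 h5
  rw [h1, h4, h5, Pi.add_apply, Pi.add_apply, h2, h3]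

lemma norm_restr_le {d : ℕ} (Ω : Set (Rd d)) (f : L2 (univ : Set (Rd d))) :
    ‖restr Ω f‖ ≤ ‖f‖ := by
  rw [restr, Lp.norm_toLp, Lp.norm_def]
  exact ENNReal.toReal_mono (Lp.eLpNorm_ne_top _)
    (eLpNorm_mono_measure _ (Measure.restrict_mono (subset_univ Ω) le_rfl))

lemma norm_restrVec_le {d : ℕ} (Ω : Set (Rd d)) (g : L2Vec (univ : Set (Rd d))) :
    ‖restrVec Ω g‖ ≤ ‖g‖ := by
  rw [restrVec, Lp.norm_toLp, Lp.norm_def]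
  exact ENNReal.toReal_mono (Lp.eLpNorm_ne_top _)
    (eLpNorm_mono_measure _ (Measure.restrict_mono (subset_univ Ω) le_rfl))

/-- The restriction map `L²(ℝ^d) × L²(ℝ^d; ℂ^d) → L²(Ω) × L²(Ω; ℂ^d)`. -/
noncomputable def restrHom {d : ℕ} (Ω : Set (Rd d)) :
    NormedAddGroupHom (L2 (univ : Set (Rd d)) × L2Vec (univ : Set (Rd d))) (L2 Ω × L2Vec Ω) where
  toFun p := (restr Ω p.1, restrVec Ω p.2)
  map_add' p q := Prod.ext (restr_add Ω p.1 q.1) (restrVec_add Ω p.2 q.2)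
  bound' := ⟨1, fun p => by
    rw [one_mul]
    exact max_le_max (norm_restr_le Ω p.1) (norm_restrVec_le Ω p.2)⟩

lemma IsWeakGrad.restr {d : ℕ} {f : L2 (univ : Set (Rd d))} {g : L2Vec univ}
    (h : IsWeakGrad univ f g) (Ω : Set (Rd d)) : IsWeakGrad Ω (restr Ω f) (restrVec Ω g) :=
  h.hasWeakGradient.isWeakGrad (coeFn_restr Ω f) (coeFn_restrVec Ω g)

lemma IsWeakGrad.h1Norm_restr_le {d : ℕ} {f : L2 (univ : Set (Rd d))} {g : L2Vec univ}
    (h : IsWeakGrad univ f g) {Ω : Set (Rd d)} (hΩ : IsOpen Ω) :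
    h1Norm Ω (MixedSobolev.restr Ω f) ≤ h1Norm univ f := by
  rw [(h.restr Ω).h1Norm_eq hΩ, h.h1Norm_eq isOpen_univ]
  gcongr
  · exact norm_restr_le Ω f
  · exact norm_restrVec_le Ω g

/-! ### The graph of `H¹_D(ℝ^d)` -/

lemma HasTraceAt.congr_ae {d : ℕ} {f f' : Rd d → ℂ} {z : Rd d} {c : ℂ} (h : HasTraceAt f z c)
    (hf : f =ᵐ[volume] f') : HasTraceAt f' z c := by
  refine h.congr fun r => ?_
  exact integral_congr_ae
    (hf.filter_mono (Measure.ae_mono' (Measure.smul_absolutelyContinuous.trans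
      Measure.absolutelyContinuous_restrict)))

lemma HasTraceAt.add {d : ℕ} {f f' : Rd d → ℂ} {z : Rd d} {c c' : ℂ} (h : HasTraceAt f z c)
    (h' : HasTraceAt f' z c') (hf : LocallyIntegrable f) (hf' : LocallyIntegrable f') :
    HasTraceAt (f + f') z (c + c') := by
  refine (Tendsto.add h h').congr fun r => ?_
  have hi : ∀ u : Rd d → ℂ, LocallyIntegrable u → IntegrableOn u (Metric.ball z r) := fun u hu =>
    (hu.integrableOn_isCompact (isCompact_closedBall z r)).mono_set Metric.ball_subset_closedBall
  rw [setAverage_eq, setAverage_eq, setAverage_eq, ← smul_add, ← integral_add (hi f hf) (hi f' hf')]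
  rfl

lemma HasTraceAt.neg {d : ℕ} {f : Rd d → ℂ} {z : Rd d} {c : ℂ} (h : HasTraceAt f z c) :
    HasTraceAt (-f) z (-c) := by
  refine (Tendsto.neg h).congr fun r => ?_
  rw [setAverage_eq, setAverage_eq, ← smul_neg, ← integral_neg]
  rfl

lemma hasTraceAt_zero_of_eventuallyEq {d : ℕ} {f : Rd d → ℂ} {z : Rd d} (h : f =ᶠ[𝓝 z] 0) :
    HasTraceAt f z 0 := by
  obtain ⟨ρ, hρ, hball⟩ := Metric.eventually_nhds_iff_ball.1 h
  refine tendsto_const_nhds.congr' ?_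
  filter_upwards [Ioo_mem_nhdsGT hρ] with r hr
  rw [setAverage_eq, setIntegral_congr_fun (g := fun _ => (0 : ℂ)) Metric.isOpen_ball.measurableSet
    fun x hx => hball x (Metric.ball_subset_ball hr.2.le hx)]
  simp

/-- The Hausdorff measure on `D` in codimension one. -/
noncomputable def surfaceMeasure {d : ℕ} (D : Set (Rd d)) : Measure (Rd d) :=
  (Measure.hausdorffMeasure ((d : ℝ) - 1)).restrict D

lemma ae_eq_of_ae_restrict_univ {d : ℕ} {F : Type*} {u v : Rd d → F}
    (h : u =ᵐ[volume.restrict univ] v) : u =ᵐ[volume] v := by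
  rwa [Measure.restrict_univ] at h

lemma locallyIntegrable_coe {d : ℕ} (u : L2 (univ : Set (Rd d))) :
    LocallyIntegrable (u : Rd d → ℂ) := by
  have h : MemLp u 2 volume := by simpa only [Measure.restrict_univ] using Lp.memLp u
  exact h.locallyIntegrable (by norm_num)

/-- The graph of the weak gradient on `H¹_D(ℝ^d)`. -/
noncomputable def traceGraph {d : ℕ} (D : Set (Rd d)) :
    AddSubgroup (L2 (univ : Set (Rd d)) × L2Vec (univ : Set (Rd d))) where
  carrier := {p | IsWeakGrad univ p.1 p.2 ∧ ∀ᵐ z ∂surfaceMeasure D, HasTraceAt p.1 z 0}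
  zero_mem' := by
    refine ⟨(weakGradGraph univ).zero_mem, ae_of_all _ fun z => ?_⟩
    exact (hasTraceAt_zero_of_eventuallyEq (f := 0) (Eventually.of_forall fun _ => rfl)).congr_ae
      (ae_eq_of_ae_restrict_univ (Lp.coeFn_zero _ _ _)).symm
  add_mem' := fun {p q} hp hq => by
    refine ⟨(weakGradGraph univ).add_mem hp.1 hq.1, ?_⟩
    filter_upwards [hp.2, hq.2] with z h1 h2
    have := h1.add h2 (locallyIntegrable_coe p.1) (locallyIntegrable_coe q.1)
    rw [add_zero] at this
    exact this.congr_ae (ae_eq_of_ae_restrict_univ (Lp.coeFn_add p.1 q.1)).symm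
  neg_mem' := fun {p} hp => by
    refine ⟨(weakGradGraph univ).neg_mem hp.1, ?_⟩
    filter_upwards [hp.2] with z h1
    have := h1.neg
    rw [neg_zero] at this
    exact this.congr_ae (ae_eq_of_ae_restrict_univ (Lp.coeFn_neg p.1)).symm

lemma mem_H1DWhole_iff {d : ℕ} {D : Set (Rd d)} {f : L2 (univ : Set (Rd d))} :
    f ∈ H1DWhole D ↔ ∃ g, (f, g) ∈ traceGraph D :=
  ⟨fun h => h.1.imp fun _ hg => ⟨hg, h.2⟩, fun ⟨g, hg⟩ => ⟨⟨g, hg.1⟩, hg.2⟩⟩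

lemma enorm_sq_eq_lintegral {α F : Type*} [MeasurableSpace α] [NormedAddCommGroup F]
    {ν : Measure α} (u : Lp F 2 ν) : ‖u‖ₑ ^ 2 = ∫⁻ x, ‖u x‖ₑ ^ 2 ∂ν := by
  rw [Lp.enorm_def, eLpNorm_two_sq]

lemma enorm_sub_sq_eq_lintegral {α F : Type*} [MeasurableSpace α] [NormedAddCommGroup F]
    {ν : Measure α} (u v : Lp F 2 ν) : ‖u - v‖ₑ ^ 2 = ∫⁻ x, ‖u x - v x‖ₑ ^ 2 ∂ν := by
  rw [enorm_sq_eq_lintegral]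
  refine lintegral_congr_ae ?_
  filter_upwards [Lp.coeFn_sub u v] with x hx
  rw [hx, Pi.sub_apply]

/-- `H¹_D(ℝ^d)` is complete. -/
lemma UpperRegular.isClosed_traceGraph {d : ℕ} (hd : 1 ≤ d) {D : Set (Rd d)} {C : ℝ}
    (hm : UpperRegular (surfaceMeasure D) D C) :
    IsClosed (traceGraph D : Set (L2 (univ : Set (Rd d)) × L2Vec (univ : Set (Rd d)))) := by
  refine isClosed_of_closure_subset fun p hp => ?_
  have hp1 : IsWeakGrad univ p.1 p.2 := by
    have h1 : ∀ q ∈ traceGraph D, q ∈ weakGradGraph univ := fun q hq => hq.1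
    exact closure_minimal h1 (isClosed_weakGradGraph univ) hp
  refine ⟨hp1, hm.ae_hasTraceAt_zero_of_approx hd hp1.hasWeakGradient fun ε hε => ?_⟩
  have hδ : 0 < min 1 (ε / 2) := lt_min one_pos (ENNReal.half_pos hε.ne')
  obtain ⟨q, hq, hpq⟩ := EMetric.mem_closure_iff.1 hp _ hδ
  have key : ∀ t : ℝ≥0∞, t ≤ edist p q → t ^ 2 ≤ ε / 2 := fun t ht => by
    rw [sq]
    calc t * t ≤ 1 * (ε / 2) := mul_le_mul' (ht.trans (hpq.le.trans (min_le_left _ _)))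
          (ht.trans (hpq.le.trans (min_le_right _ _)))
      _ = ε / 2 := one_mul _
  refine ⟨q.1, q.2, hq.1.hasWeakGradient, ?_, hq.2⟩
  have e1 : ∫⁻ x, ‖p.1 x - q.1 x‖ₑ ^ 2 = ‖p.1 - q.1‖ₑ ^ 2 := by
    rw [enorm_sub_sq_eq_lintegral, setLIntegral_univ]
  have e2 : ∫⁻ x, ‖p.2 x - q.2 x‖ₑ ^ 2 = ‖p.2 - q.2‖ₑ ^ 2 := by
    rw [enorm_sub_sq_eq_lintegral, setLIntegral_univ]
  rw [e1, e2, ← ENNReal.add_halves ε]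
  refine add_le_add (key _ ?_) (key _ ?_)
  · rw [← edist_eq_enorm_sub]
    exact le_max_left _ _
  · rw [← edist_eq_enorm_sub]
    exact le_max_right _ _

/-! ### The geometry of `D` -/

/-- The surface measure on `D` is upper regular: a ball with arbitrary centre that meets `D` lies in
a ball of twice the radius centred on `D`. -/
lemma exists_upperRegular {d : ℕ} (hd : 1 ≤ d) {D : Set (Rd d)} (hD : IsCompact D)
    (h : D = ∅ ∨ IsLSet ((d : ℝ) - 1) D) :
    ∃ C : ℝ, UpperRegular (surfaceMeasure D) D C := by
  have hDm : MeasurableSet D := hD.measurableSet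
  have hcompl : surfaceMeasure D Dᶜ = 0 := by
    rw [surfaceMeasure, Measure.restrict_apply hDm.compl, compl_inter_self, measure_empty]
  rcases h with rfl | ⟨-, -, c, C, hc, hC, h⟩
  · have h0 : surfaceMeasure (∅ : Set (Rd d)) = 0 := Measure.restrict_empty
    exact ⟨0, ⟨by rw [h0]; infer_instance, hcompl, le_rfl, by simp [h0]⟩⟩
  · have hcast : ((d : ℝ) - 1) = ((d - 1 : ℕ) : ℝ) := by rw [Nat.cast_sub hd, Nat.cast_one]
    have hball : ∀ z ∈ D, ∀ r, 0 < r → r ≤ 1 →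
        surfaceMeasure D (Metric.ball z r) ≤ ENNReal.ofReal (C * r ^ (d - 1)) := by
      intro z hz r hr hr1
      rw [surfaceMeasure, Measure.restrict_apply Metric.isOpen_ball.measurableSet, inter_comm,
        ← Real.rpow_natCast, ← hcast]
      exact (h z hz r hr hr1).2
    refine ⟨C * 2 ^ (d - 1), ⟨⟨?_⟩, hcompl, by positivity, fun y r hr hr1 => ?_⟩⟩
    · have hfin : surfaceMeasure D D < ⊤ := by
        refine hD.measure_lt_top_of_nhdsWithin fun z hz => ?_
        refine ⟨Metric.ball z 1, mem_nhdsWithin_of_mem_nhds (Metric.ball_mem_nhds z one_pos), ?_⟩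
        exact (hball z hz 1 one_pos le_rfl).trans_lt ENNReal.ofReal_lt_top
      rw [← measure_add_measure_compl hDm, hcompl, add_zero]
      exact hfin
    · by_cases hne : (Metric.ball y r ∩ D).Nonempty
      · obtain ⟨z, hzy, hz⟩ := hne
        refine (measure_mono (Metric.ball_subset_ball' (ε₂ := 2 * r) ?_)).trans
          ((hball z hz (2 * r) (by positivity) (by linarith)).trans_eq ?_)
        · rw [dist_comm]
          linarith [Metric.mem_ball.1 hzy]
        · rw [mul_pow, mul_assoc]
      · refine (le_of_eq ?_).trans zero_le
        refine measure_mono_null (fun x hx hxD => hne ⟨x, hx, hxD⟩) hcompl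

lemma exists_le_surfaceMeasure_ball {d : ℕ} (hd : 1 ≤ d) {D : Set (Rd d)}
    (h : D = ∅ ∨ IsLSet ((d : ℝ) - 1) D) : ∃ c : ℝ, 0 < c ∧ ∀ z ∈ D, ∀ r : ℝ, 0 < r → r ≤ 1 →
      ENNReal.ofReal (c * r ^ (d - 1)) ≤ surfaceMeasure D (Metric.ball z r) := by
  rcases h with rfl | ⟨-, -, c, C, hc, hC, h⟩
  · exact ⟨1, one_pos, fun z hz => hz.elim⟩
  · have hcast : ((d : ℝ) - 1) = ((d - 1 : ℕ) : ℝ) := by rw [Nat.cast_sub hd, Nat.cast_one]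
    refine ⟨c, hc, fun z hz r hr hr1 => ?_⟩
    rw [surfaceMeasure, Measure.restrict_apply Metric.isOpen_ball.measurableSet, inter_comm,
      ← Real.rpow_natCast, ← hcast]
    exact (h z hz r hr hr1).1

/-- A set of finite measure in codimension one is a null set. -/
lemma volume_eq_zero_of_surfaceMeasure {d : ℕ} {D : Set (Rd d)} (hD : surfaceMeasure D D ≠ ⊤) :
    volume D = 0 := by
  rw [surfaceMeasure, Measure.restrict_apply_self] at hD
  have h1 : Measure.hausdorffMeasure (d : ℝ) D = 0 :=
    (Measure.hausdorffMeasure_zero_or_top (sub_one_lt (d : ℝ)) D).resolve_right hD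
  rw [Measure.isAddLeftInvariant_eq_smul (volume : Measure (Rd d))
    (Measure.hausdorffMeasure (d : ℝ)), Measure.smul_apply, h1, smul_zero]

/-! ### Extension of test functions -/

/-- The graph of the weak gradient on `C_D^∞(Ω)`. -/
noncomputable def smoothGraph {d : ℕ} (Ω D : Set (Rd d)) : AddSubgroup (L2 Ω × L2Vec Ω) where
  carrier := {p | p.1 ∈ smoothD Ω D ∧ IsWeakGrad Ω p.1 p.2}
  zero_mem' := by
    refine ⟨⟨0, contDiff_const, HasCompactSupport.zero, ⟨1, one_pos, ?_⟩, Lp.coeFn_zero _ _ _⟩,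
      (weakGradGraph Ω).zero_mem⟩
    simp [tsupport]
  add_mem' := by
    rintro p q ⟨⟨φ, hφ, hφc, ⟨δ, hδ, hφD⟩, hpφ⟩, hp⟩ ⟨⟨ψ, hψ, hψc, ⟨δ', hδ', hψD⟩, hqψ⟩, hq⟩
    refine ⟨⟨φ + ψ, hφ.add hψ, hφc.add hψc, ⟨min δ δ', lt_min hδ hδ', fun x hx y hy => ?_⟩, ?_⟩,
      (weakGradGraph Ω).add_mem hp hq⟩
    · rcases tsupport_add φ ψ hx with h | h
      · exact (min_le_left _ _).trans (hφD x h y hy)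
      · exact (min_le_right _ _).trans (hψD x h y hy)
    · exact (Lp.coeFn_add p.1 q.1).trans (hpφ.add hqψ)
  neg_mem' := by
    rintro p ⟨⟨φ, hφ, hφc, ⟨δ, hδ, hφD⟩, hpφ⟩, hp⟩
    refine ⟨⟨-φ, hφ.neg, hφc.neg, ⟨δ, hδ, fun x hx y hy => hφD x ?_ y hy⟩, ?_⟩,
      (weakGradGraph Ω).neg_mem hp⟩
    · simpa [tsupport] using hx
    · exact (Lp.coeFn_neg p.1).trans hpφ.neg

lemma enorm_prod_sq_le {α β : Type*} [NormedAddCommGroup α] [NormedAddCommGroup β] {p : α × β}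
    {e : ℝ≥0∞} (h1 : ‖p.1‖ₑ ^ 2 ≤ e) (h2 : ‖p.2‖ₑ ^ 2 ≤ e) : ‖p‖ₑ ^ 2 ≤ e := by
  rcases max_choice ‖p.1‖ ‖p.2‖ with h | h <;>
    · rw [← ofReal_norm, Prod.norm_def, h, ofReal_norm]
      assumption

lemma norm_le_of_enorm_sq_le {α β : Type*} [NormedAddCommGroup α] [NormedAddCommGroup β] {a : α}
    {b : β} {c : ℝ≥0∞} (hc : c ≠ ⊤) (h : ‖a‖ₑ ^ 2 ≤ c * ‖b‖ₑ ^ 2) : ‖a‖ ≤ √c.toReal * ‖b‖ := by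
  have h1 := ENNReal.toReal_mono (by finiteness) h
  rw [ENNReal.toReal_mul, ENNReal.toReal_pow, ENNReal.toReal_pow, toReal_enorm, toReal_enorm] at h1
  refine le_of_sq_le_sq ?_ (by positivity)
  rwa [mul_pow, Real.sq_sqrt ENNReal.toReal_nonneg]

/-- A compactly supported Lipschitz function, as an element of the graph of the weak gradient. -/
lemma _root_.LipschitzWith.exists_mem_weakGradGraph {d : ℕ} {E : Rd d → ℂ} {K : ℝ≥0}
    (hE : LipschitzWith K E) (hc : HasCompactSupport E) (Ω : Set (Rd d)) :
    ∃ p ∈ weakGradGraph Ω, p.1 =ᵐ[volume.restrict Ω] E ∧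
      ‖p.1‖ₑ ^ 2 + ‖p.2‖ₑ ^ 2 = energy Ω E := by
  have h := hE.hasWeakGradient hc
  have h1 := h.memLp.restrict Ω
  have h2 := h.memLp_grad.restrict Ω
  refine ⟨(h1.toLp, h2.toLp), h.isWeakGrad h1.coeFn_toLp h2.coeFn_toLp, h1.coeFn_toLp, ?_⟩
  rw [Lp.enorm_toLp, Lp.enorm_toLp, eLpNorm_two_sq, eLpNorm_two_sq, energy]

lemma exists_mem_traceGraph_of_lipschitzWith {d : ℕ} {E : Rd d → ℂ} {K : ℝ≥0}
    (hE : LipschitzWith K E) (hc : HasCompactSupport E) {D : Set (Rd d)} (hD : IsClosed D)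
    (hED : ∀ y ∈ D, E =ᶠ[𝓝 y] 0) :
    ∃ p ∈ traceGraph D, p.1 =ᵐ[volume.restrict univ] E ∧ ‖p‖ₑ ^ 2 ≤ energy univ E := by
  obtain ⟨p, hp, hpE, hen⟩ := hE.exists_mem_weakGradGraph hc univ
  refine ⟨p, ⟨hp, ?_⟩, hpE, hen ▸ enorm_prod_sq_le le_self_add le_add_self⟩
  filter_upwards [ae_restrict_mem hD.measurableSet] with z hz
  exact (hasTraceAt_zero_of_eventuallyEq (hED z hz)).congr_ae (ae_eq_of_ae_restrict_univ hpE).symm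

lemma exists_testFunction_of_mem_smoothGraph {d : ℕ} {Ω D : Set (Rd d)} (hΩ : IsOpen Ω)
    {p : L2 Ω × L2Vec Ω} (hp : p ∈ smoothGraph Ω D) : ∃ φ : Rd d → ℂ, ContDiff ℝ ∞ φ ∧
      HasCompactSupport φ ∧ (∀ y ∈ D, φ =ᶠ[𝓝 y] 0) ∧ p.1 =ᵐ[volume.restrict Ω] φ ∧
      energy Ω φ ≤ 2 * ‖p‖ₑ ^ 2 := by
  obtain ⟨⟨φ, hφ, hφc, ⟨δ, hδ, hφD⟩, hpφ⟩, hpg⟩ := hp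
  refine ⟨φ, hφ, hφc, fun y hy => ?_, hpφ, ?_⟩
  · rw [← notMem_tsupport_iff_eventuallyEq]
    intro hyt
    have := hφD y hyt y hy
    rw [dist_self] at this
    linarith
  · obtain ⟨K, hK⟩ := hφ.lipschitzWith_of_hasCompactSupport hφc (by simp)
    obtain ⟨q, hq, hqφ, hen⟩ := hK.exists_mem_weakGradGraph hφc Ω
    have h1 : q.1 = p.1 := Lp.ext (hqφ.trans hpφ.symm)
    have h2 : q.2 = p.2 := IsWeakGrad.unique hΩ (h1 ▸ hq) hpg
    rw [← hen, h1, h2, two_mul]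
    gcongr
    · exact enorm_le_iff_norm_le.2 (norm_fst_le p)
    · exact enorm_le_iff_norm_le.2 (norm_snd_le p)

lemma coeFn_sum_ae {α F ι : Type*} [MeasurableSpace α] [NormedAddCommGroup F] {ν : Measure α}
    (s : Finset ι) (u : ι → Lp F 2 ν) :
    (∑ i ∈ s, u i : Lp F 2 ν) =ᵐ[ν] fun x => ∑ i ∈ s, u i x := by
  classical
  induction s using Finset.induction_on with
  | empty =>
    simp only [Finset.sum_empty]
    exact Lp.coeFn_zero _ _ _
  | insert a s ha ih =>
    filter_upwards [ih, Lp.coeFn_add (u a) (∑ i ∈ s, u i)] with x h1 h2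
    rw [Finset.sum_insert ha, Finset.sum_insert ha, h2, Pi.add_apply, h1]

/-- Test functions vanishing near `D` extend from `Ω` to `H¹_D(ℝ^d)` with control of the norm. -/
lemma GeometricAssumption.exists_surjectiveOnWith {d : ℕ} (hd : 1 ≤ d) {Ω D : Set (Rd d)}
    (h : GeometricAssumption Ω D) : ∃ C : ℝ, 0 < C ∧
      ((restrHom Ω).comp (NormedAddGroupHom.incl (traceGraph D))).SurjectiveOnWith
        (smoothGraph Ω D) C := by
  obtain ⟨ι, _, η, C, hext, hsum⟩ := h.exists_partition hd
  -- the summand `1` only serves to make the constant positive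
  refine ⟨1 + ∑ i, √(C i * 2).toReal, by positivity, fun p hp => ?_⟩
  obtain ⟨φ, hφ, hφc, hφD, hpφ, hen⟩ := exists_testFunction_of_mem_smoothGraph h.isOpen hp
  have hq : ∀ i, ∃ q ∈ traceGraph D, (∀ᵐ x ∂volume.restrict Ω, q.1 x = η i x • φ x) ∧
      ‖q‖ ≤ √(C i * 2).toReal * ‖p‖ := by
    intro i
    obtain ⟨E, ⟨K, hK⟩, hEc, hEΩ, hED, hEen⟩ := (hext i).2 φ hφ hφc hφD
    obtain ⟨q, hq, hqE, hqen⟩ := exists_mem_traceGraph_of_lipschitzWith hK hEc h.isClosed_D hED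
    have hCt := (hext i).1
    refine ⟨q, hq, ?_, norm_le_of_enorm_sq_le (by finiteness) ?_⟩
    · filter_upwards [hqE.filter_mono (ae_mono (Measure.restrict_mono (subset_univ Ω) le_rfl)),
        ae_restrict_mem h.isOpen.measurableSet] with x hx hxΩ
      rw [hx, hEΩ x hxΩ]
    · rw [mul_assoc]
      exact hqen.trans (hEen.trans (mul_le_mul' le_rfl hen))
  choose q hqD hqφ hqn using hq
  have hmem : ∑ i, q i ∈ traceGraph D := sum_mem fun i _ => hqD i
  refine ⟨⟨∑ i, q i, hmem⟩, ?_, ?_⟩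
  · have h1 : restr Ω (∑ i, q i).1 = p.1 := by
      refine Lp.ext ?_
      have hs := (coeFn_sum_ae Finset.univ fun i => (q i).1).filter_mono
        (ae_mono (Measure.restrict_mono (subset_univ Ω) le_rfl))
      filter_upwards [coeFn_restr Ω (∑ i, q i).1, hs, ae_all_iff.2 hqφ, hpφ,
        ae_restrict_mem h.isOpen.measurableSet] with x h1 h2 h3 h4 hx
      rw [h1, Prod.fst_sum, h2, h4, Finset.sum_congr rfl fun i _ => h3 i, ← Finset.sum_smul,
        hsum x hx, one_smul]
    refine Prod.ext h1 ?_
    have h2 : IsWeakGrad Ω (restr Ω (∑ i, q i).1) (restrVec Ω (∑ i, q i).2) := hmem.1.restr Ω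
    exact IsWeakGrad.unique h.isOpen (h1 ▸ h2) hp.2
  · calc ‖∑ i, q i‖ ≤ ∑ i, ‖q i‖ := norm_sum_le _ _
      _ ≤ ∑ i, √(C i * 2).toReal * ‖p‖ := Finset.sum_le_sum fun i _ => hqn i
      _ = (∑ i, √(C i * 2).toReal) * ‖p‖ := (Finset.sum_mul _ _ _).symm
      _ ≤ _ := by gcongr; linarith

/-! ### The form domain -/

lemma mem_closure_smoothGraph {d : ℕ} {Ω D : Set (Rd d)} (hΩ : IsOpen Ω) {u : L2 Ω}
    (hu : u ∈ formDomain Ω D) : (u, weakGrad Ω u) ∈ (smoothGraph Ω D).topologicalClosure := by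
  refine Metric.mem_closure_iff.2 fun ε hε => ?_
  obtain ⟨v, hv, huv⟩ := hu.2 ε hε
  obtain ⟨φ, hφ, hφc, -, hvφ⟩ := id hv
  obtain ⟨K, hK⟩ := hφ.lipschitzWith_of_hasCompactSupport hφc (by simp)
  obtain ⟨q, hq, hqφ, -⟩ := hK.exists_mem_weakGradGraph hφc Ω
  have hqv : q.1 = v := Lp.ext (hqφ.trans hvφ.symm)
  refine ⟨q, ⟨hqv ▸ hv, hq⟩, ?_⟩
  have hsub : IsWeakGrad Ω (u - q.1) (weakGrad Ω u - q.2) :=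
    (weakGradGraph Ω).sub_mem (x := (u, weakGrad Ω u)) (isWeakGrad_weakGrad hu.1) hq
  rw [dist_eq_norm]
  refine (hsub.norm_le_h1Norm hΩ).trans_lt ?_
  rwa [hqv]

lemma h1DNorm_le {d : ℕ} {Ω D : Set (Rd d)} {f : L2 (univ : Set (Rd d))} (hf : f ∈ H1DWhole D) :
    h1DNorm Ω D (restr Ω f) ≤ h1Norm univ f := by
  refine csInf_le ⟨0, ?_⟩ ⟨f, ⟨hf, rfl⟩, rfl⟩
  rintro _ ⟨f', -, rfl⟩
  exact Real.sqrt_nonneg _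

lemma h1Norm_le_h1DNorm {d : ℕ} {Ω D : Set (Rd d)} (hΩ : IsOpen Ω) {u : L2 Ω}
    (hu : u ∈ H1D Ω D) : h1Norm Ω u ≤ h1DNorm Ω D u := by
  obtain ⟨f, hf, rfl⟩ := hu
  refine le_csInf ⟨_, f, ⟨hf, rfl⟩, rfl⟩ ?_
  rintro _ ⟨f', ⟨hf', hff'⟩, rfl⟩
  obtain ⟨g, hg⟩ := hf'.1
  rw [← hff']
  exact hg.h1Norm_restr_le hΩ

lemma GeometricAssumption.isCompact {d : ℕ} {Ω D : Set (Rd d)} (h : GeometricAssumption Ω D) :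
    IsCompact D :=
  h.isBounded.isCompact_closure.of_isClosed_subset h.isClosed_D
    (h.D_subset.trans frontier_subset_closure)

/-- Extension: the elements of the form domain are restrictions of functions in `H¹_D(ℝ^d)`. The
extension of test functions passes to the closure because `H¹_D(ℝ^d)` is complete. -/
lemma GeometricAssumption.exists_extension {d : ℕ} (hd : 1 ≤ d) {Ω D : Set (Rd d)}
    (h : GeometricAssumption Ω D) : ∃ C : ℝ, 0 < C ∧ ∀ u ∈ formDomain Ω D,
      ∃ f ∈ H1DWhole D, restr Ω f = u ∧ h1Norm univ f ≤ C * h1Norm Ω u := by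
  obtain ⟨C₀, hm⟩ := exists_upperRegular hd h.isCompact h.dirichlet
  have : CompleteSpace (traceGraph D) := (hm.isClosed_traceGraph hd).completeSpace_coe
  obtain ⟨C, hC, hsurj⟩ := h.exists_surjectiveOnWith hd
  refine ⟨2 * (C + 1), by positivity, fun u hu => ?_⟩
  obtain ⟨q, hq, hqn⟩ := controlled_closure_of_complete hC one_pos hsurj _
    (mem_closure_smoothGraph h.isOpen hu)
  refine ⟨q.1.1, mem_H1DWhole_iff.2 ⟨q.1.2, q.2⟩, congrArg Prod.fst hq, ?_⟩
  calc h1Norm univ q.1.1 ≤ 2 * ‖q‖ := q.2.1.h1Norm_le isOpen_univ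
    _ ≤ 2 * ((C + 1) * h1Norm Ω u) := by
        gcongr
        refine hqn.trans ?_
        gcongr
        exact (isWeakGrad_weakGrad hu.1).norm_le_h1Norm h.isOpen
    _ = _ := by ring

lemma GeometricAssumption.H1D_subset_formDomain {d : ℕ} (hd : 1 ≤ d) {Ω D : Set (Rd d)}
    (h : GeometricAssumption Ω D) : H1D Ω D ⊆ formDomain Ω D := by
  obtain ⟨C, hm⟩ := exists_upperRegular hd h.isCompact h.dirichlet
  obtain ⟨c, hc, hlow⟩ := exists_le_surfaceMeasure_ball hd h.dirichlet
  obtain ⟨K, hK, hardy⟩ := hm.exists_lintegral_thickening_le hd hc hlow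
  have hfin := hm.isFinite
  rintro _ ⟨f, hf, rfl⟩
  obtain ⟨g, hg⟩ := hf.1
  refine ⟨⟨_, hg.restr Ω⟩, fun ε hε => ?_⟩
  obtain ⟨φ, hφ, hφc, hφD, h1, h2⟩ := hg.hasWeakGradient.exists_testFunction_approx h.isOpen
    h.isBounded h.isClosed_D (volume_eq_zero_of_surfaceMeasure (measure_ne_top _ _)) hK
    (hardy f g hg.hasWeakGradient hf.2) (ε := ENNReal.ofReal (ε / 4) ^ 2)
    (by have : 0 < ε / 4 := by positivity
        positivity)
  obtain ⟨L, hL⟩ := hφ.lipschitzWith_of_hasCompactSupport hφc (by simp)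
  have hw := hL.hasWeakGradient hφc
  have m1 := hw.memLp.restrict Ω
  have m2 := hw.memLp_grad.restrict Ω
  refine ⟨m1.toLp, ⟨φ, hφ, hφc, hφD, m1.coeFn_toLp⟩, ?_⟩
  have hsub : IsWeakGrad Ω (restr Ω f - m1.toLp) (restrVec Ω g - m2.toLp) :=
    (weakGradGraph Ω).sub_mem (x := (restr Ω f, restrVec Ω g)) (y := (m1.toLp, m2.toLp))
      (hg.restr Ω) (hw.isWeakGrad m1.coeFn_toLp m2.coeFn_toLp)
  have hnorm : ‖(restr Ω f - m1.toLp, restrVec Ω g - m2.toLp)‖ₑ ^ 2 ≤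
      ENNReal.ofReal (ε / 4) ^ 2 := by
    refine enorm_prod_sq_le ?_ ?_
    · rw [enorm_sub_sq_eq_lintegral]
      refine (lintegral_congr_ae ?_).trans_le h1
      filter_upwards [coeFn_restr Ω f, m1.coeFn_toLp] with x hx hx'
      rw [hx, hx']
    · rw [enorm_sub_sq_eq_lintegral]
      refine (lintegral_congr_ae ?_).trans_le h2
      filter_upwards [coeFn_restrVec Ω g, m2.coeFn_toLp] with x hx hx'
      rw [hx, hx']
  have hle : ‖(restr Ω f - m1.toLp, restrVec Ω g - m2.toLp)‖ ≤ ε / 4 := by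
    rw [← ENNReal.ofReal_le_ofReal_iff (by positivity), ofReal_norm]
    exact (ENNReal.pow_le_pow_left_iff two_ne_zero).1 hnorm
  have := hsub.h1Norm_le h.isOpen
  linarith

end MixedSobolev


theorem mainTheorem11 (d : ℕ) (hd : 2 ≤ d) (Ω D : Set (MixedSobolev.Rd d))
    (hΩD : MixedSobolev.GeometricAssumption Ω D) :
    MixedSobolev.formDomain Ω D = MixedSobolev.H1D Ω D ∧
      ∃ c C : ℝ, 0 < c ∧ 0 < C ∧ ∀ u ∈ MixedSobolev.formDomain Ω D,
        c * MixedSobolev.h1Norm Ω u ≤ MixedSobolev.h1DNorm Ω D u ∧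
          MixedSobolev.h1DNorm Ω D u ≤ C * MixedSobolev.h1Norm Ω u := by
  have hd1 : 1 ≤ d := one_le_two.trans hd
  obtain ⟨C, hC, hext⟩ := hΩD.exists_extension hd1
  have hsub : MixedSobolev.formDomain Ω D ⊆ MixedSobolev.H1D Ω D := fun u hu => by
    obtain ⟨f, hf, hfu, -⟩ := hext u hu
    exact ⟨f, hf, hfu⟩
  refine ⟨hsub.antisymm (hΩD.H1D_subset_formDomain hd1), 1, C, one_pos, hC, fun u hu => ⟨?_, ?_⟩⟩
  · rw [one_mul]
    exact MixedSobolev.h1Norm_le_h1DNorm hΩD.isOpen (hsub hu)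
  · obtain ⟨f, hf, rfl, hle⟩ := hext u hu
    exact (MixedSobolev.h1DNorm_le hf).trans hle
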